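/- Call a program for a random access machine a *distance-comparison program* if its memory consists of finitely many arrays of natural numbers (constant array names, computed indices), its elementary operations, each of cost $1$, are constants, reading and writing a cell, addition, truncated subtraction, branching and looping on whether a number is nonzero, and the comparison $|p_up_v|\le|p_wp_z|$ of two distances between input points given by their numbers, and distances are accessed in no other way. **Theorem.** There are a single distance-comparison program and a polynomial $B$ such that the following holds for all integers $k\ge 1$ and $n\ge 1$ (in particular for all $k\ge2$). Let $p_0,\dots,p_{kn-1}$ be $kn$ labelled points in a metric space (some of which may coincide), partitioned into $n$ tuples of exactly $k$ points each. Call a family of $k$ pairwise vertex-disjoint trees in the complete graph on the (labelled) points *feasible* if each of the trees contains exactly one point from each tuple, and let its *bottleneck* be the largest distance between the endpoints of an edge, over all edges of all $k$ trees ($0$ if there are no edges). Given $k$, $n$ and, for each point, the number of its tuple, and with access to comparisons of distances between the points, the program halts after at most $B(kn)$ elementary steps and outputs (as the number of the tree containing each point and the number of its parent in that tree) a feasible family whose bottleneck is at most $(3k-2)$ times the bottleneck of every feasible family, and so at most $(3k-2)$ times the optimum. That is, there is a polynomial-time $(3k-2)$-approximation algorithm for the metric $k$-disjoint bottleneck spanning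 tree problem; for $k=2$ the ratio is $4$. -/

import Mathlib

namespace KDBST

/-! ### The optimisation problem

The points are labelled by `Fin (k * n)`; the label `x` stands for the point `p x` of a metric
space `X`.  The partition into `n` tuples is given by `tup : Fin (k * n) → Fin n`. -/

/-- The labelled points are partitioned into `n` tuples with exactly `k` points each. -/
def IsTuplePartition {k n : ℕ} (tup : Fin (k * n) → Fin n) : Prop :=
  ∀ i : Fin n, Nat.card {x : Fin (k * n) // tup x = i} = k

/-- A family of `k` subgraphs of the complete graph on the points (the metric graph). -/
abbrev Family (k n : ℕ) : Type := Fin k → (⊤ : SimpleGraph (Fin (k * n))).Subgraph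

/-- Feasible solutions: `k` pairwise vertex-disjoint trees, each containing exactly one point
from each tuple. -/
structure IsFeasible {k n : ℕ} (tup : Fin (k * n) → Fin n) (T : Family k n) : Prop where
  isTree : ∀ c, (T c).coe.IsTree
  disjoint : ∀ c c', c ≠ c' → Disjoint (T c).verts (T c').verts
  exactly_one : ∀ (c : Fin k) (i : Fin n), ∃! x, x ∈ (T c).verts ∧ tup x = i

/-- The largest edge length over all edges of all the graphs of the family.  The set is finite, so
the supremum is a maximum; it is `0` when there are no edges at all. -/
noncomputable def bottleneck {k n : ℕ} {X : Type*} [MetricSpace X] (p : Fin (k * n) → X)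
    (T : Family k n) : ℝ :=
  sSup {r : ℝ | ∃ (c : Fin k) (x y : Fin (k * n)), (T c).Adj x y ∧ r = dist (p x) (p y)}

/-! ### The model of computation

Programs for a random access machine whose memory consists of arrays of natural numbers, the `i`-th
cell of array `a` being `M a i`.  Array names are constants of the program; indices are computed
(indirect addressing).  The only arithmetic on numbers is addition and truncated subtraction, so
that in `t` steps numbers grow by at most a factor exponential in `t` and unit cost is polynomially
equivalent to Turing machine time.  The metric space can be accessed only by comparing two
distances between input points. -/

/-- A memory state. -/
abbrev Mem : Type := ℕ → ℕ → ℕ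

/-- Arithmetic expressions. -/
inductive Exp : Type
  /-- a constant -/
  | lit (c : ℕ) : Exp
  /-- the content of the cell of array `a` whose index is the value of `i` -/
  | get (a : ℕ) (i : Exp) : Exp
  | add (e f : Exp) : Exp
  /-- truncated subtraction -/
  | sub (e f : Exp) : Exp
  /-- `1` if the distance between points number `u` and `v` is at most the distance between points
  number `w` and `z`, and `0` otherwise -/
  | distLe (u v w z : Exp) : Exp

/-- Programs. -/
inductive Prog : Type
  | skip : Prog
  /-- store the value of `e` in the cell of array `a` whose index is the value of `i` -/
  | set (a : ℕ) (i e : Exp) : Prog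
  | seq (P Q : Prog) : Prog
  /-- execute `P` if `e` is nonzero, and `Q` otherwise -/
  | ite (e : Exp) (P Q : Prog) : Prog
  /-- as long as `e` is nonzero, execute `P` -/
  | while (e : Exp) (P : Prog) : Prog

/-- Answers to distance comparisons, `D u v w z` meaning `|u v| ≤ |w z|`. -/
abbrev Comparisons : Type := ℕ → ℕ → ℕ → ℕ → Prop

open Classical in
/-- The value of an expression. -/
noncomputable def Exp.eval (D : Comparisons) (M : Mem) : Exp → ℕ
  | .lit c => c
  | .get a i => M a (i.eval D M)
  | .add e f => e.eval D M + f.eval D M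
  | .sub e f => e.eval D M - f.eval D M
  | .distLe u v w z =>
      if D (u.eval D M) (v.eval D M) (w.eval D M) (z.eval D M) then 1 else 0

/-- The number of elementary operations in the evaluation of an expression. -/
def Exp.cost : Exp → ℕ
  | .lit _ => 1
  | .get _ i => i.cost + 1
  | .add e f => e.cost + f.cost + 1
  | .sub e f => e.cost + f.cost + 1
  | .distLe u v w z => u.cost + v.cost + w.cost + z.cost + 1

/-- The memory after writing `v` into cell `i` of array `a`. -/
def Mem.write (M : Mem) (a i v : ℕ) : Mem :=
  fun b j => if b = a ∧ j = i then v else M b j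

/-- `Exec D P M M' t`: the program `P`, started with memory `M`, halts with memory `M'` after
exactly `t` elementary steps. -/
inductive Exec (D : Comparisons) : Prog → Mem → Mem → ℕ → Prop
  | skip (M : Mem) : Exec D .skip M M 1
  | set (M : Mem) (a : ℕ) (i e : Exp) :
      Exec D (.set a i e) M (M.write a (i.eval D M) (e.eval D M)) (i.cost + e.cost + 1)
  | seq {P Q : Prog} {M M₁ M₂ : Mem} {s t : ℕ} :
      Exec D P M M₁ s → Exec D Q M₁ M₂ t → Exec D (.seq P Q) M M₂ (s + t)
  | ite_true {e : Exp} {P Q : Prog} {M M₁ : Mem} {t : ℕ} :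
      e.eval D M ≠ 0 → Exec D P M M₁ t → Exec D (.ite e P Q) M M₁ (e.cost + 1 + t)
  | ite_false {e : Exp} {P Q : Prog} {M M₁ : Mem} {t : ℕ} :
      e.eval D M = 0 → Exec D Q M M₁ t → Exec D (.ite e P Q) M M₁ (e.cost + 1 + t)
  | while_true {e : Exp} {P : Prog} {M M₁ M₂ : Mem} {s t : ℕ} :
      e.eval D M ≠ 0 → Exec D P M M₁ s → Exec D (.while e P) M₁ M₂ t →
        Exec D (.while e P) M M₂ (e.cost + 1 + s + t)
  | while_false {e : Exp} {P : Prog} {M : Mem} :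
      e.eval D M = 0 → Exec D (.while e P) M M (e.cost + 1)

/-! ### Input and output of programs -/

/-- The distance comparisons of an instance.  A comparison that involves a number which is not the
number of a point has a negative answer. -/
def comparisons {k n : ℕ} {X : Type*} [MetricSpace X] (p : Fin (k * n) → X) : Comparisons :=
  fun u v w z => ∃ u' v' w' z' : Fin (k * n),
    (u' : ℕ) = u ∧ (v' : ℕ) = v ∧ (w' : ℕ) = w ∧ (z' : ℕ) = z ∧
      dist (p u') (p v') ≤ dist (p w') (p z')

/-- The initial memory: array `0` holds `k, n`, array `1` holds for each point the number of its
tuple, and all other cells are `0`. -/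
def inputMem {k n : ℕ} (tup : Fin (k * n) → Fin n) : Mem := fun a i =>
  if a = 0 then (if i = 0 then k else if i = 1 then n else 0)
  else if a = 1 then (if h : i < k * n then (tup ⟨i, h⟩ : ℕ) else 0)
  else 0

/-- The solution that a final memory describes.  Array `2` holds for each point the number of
the tree containing it, and array `3` holds for each point the number of its parent in that
tree (the root may, for instance, carry its own number). -/
def outputFamily (k n : ℕ) (M : Mem) : Family k n := fun c =>
  { verts := {x | M 2 x = c}
    Adj := fun x y => x ≠ y ∧ M 2 x = c ∧ M 2 y = c ∧ (M 3 x = y ∨ M 3 y = x)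
    adj_sub := fun h => h.1
    edge_vert := fun h => h.2.1
    symm := ⟨fun _ _ h => ⟨h.1.symm, h.2.2.1, h.2.1, h.2.2.2.symm⟩⟩ }

end KDBST

/-! Fix a threshold `l` and join two points when their distance is at most `l`. In a feasible family
of bottleneck at most `l` every tree stays inside one component, so a component met by `s` of the
trees contains exactly `s` points of every tuple: the threshold is balanced
(`IsFeasible.isBalanced`). The bottleneck of a family is itself a distance between two points, so
trying all pairs of points as thresholds and keeping the best balanced one yields a threshold at
most every feasible bottleneck. It remains to turn a balanced threshold `l` into a feasible family
of bottleneck at most `(3k-2)l`.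

Consider a component with `s` points in each tuple, and a rooted spanning tree of it. Cut the tree
into groups of exactly `s` points from the bottom up: take a lowest vertex `v` with at least `s`
ungrouped descendants and form a group from the last `s` of these. Below `v` every subtree has fewer
than `s` ungrouped points, so all points of the group are within `(s-1)l` of `v` (`dist_le_size`).
Hence the group has diameter at most `2(s-1)l`. It is attached to the later group that contains `v`,
or the parent of `v` if `v` itself was used; this site is within `sl` of every point of the group.
As the component has `sn` points, nothing is left over (`all_grouped`), and the groups form a rooted
tree.

Regard each point as an edge between its group and its tuple. This bipartite multigraph is
`s`-regular, so by König's theorem its edges are properly coloured with `s` colours; the proof by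
exchanging colours along alternating paths is itself the algorithm (`IsPartialColoring.step`). Each
colour class has one point in every group and one in every tuple, and inherits the tree structure of
the groups: the parent of `x` is the point of its colour in the group that contains the site of the
group of `x`. Such an edge has length at most `sl + 2(s-1)l = (3s-2)l`, and `s ≤ k`. The points of
tuple `0` in the component serve as its colours, so over all components there are exactly `k` trees
(`isSolution_of_coloring`).

For the running time, the algorithm consists of nested counting loops with at most `kn` rounds each,
so a polynomial bound follows by induction on the syntax (`exists_exec`). -/

namespace KDBST

/-! ### Loop programs

Programs whose only loops are counting loops, bounded by a register.  They have a total
denotational semantics and a polynomial cost bound that can be read off the syntax. -/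

/-- Programs with counting loops only; `loop v r P` executes `P` with `v = 0, 1, …` up to the
content of register `r`. -/
inductive Code : Type
  | skip : Code
  | set (a : ℕ) (i e : Exp) : Code
  | seq (P Q : Code) : Code
  | ite (e : Exp) (P Q : Code) : Code
  | loop (v r : ℕ) (P : Code) : Code

infixr:60 "⨾" => Code.seq

/-- The content of a register (cell `0` of an array). -/
abbrev reg (a : ℕ) : Exp := .get a (.lit 0)

/-- Assignment to a register. -/
abbrev Code.assign (a : ℕ) (e : Exp) : Code := .set a (.lit 0) e

namespace Code

/-- The translation into programs. -/
def prog : Code → Prog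
  | skip => .skip
  | set a i e => .set a i e
  | seq P Q => .seq P.prog Q.prog
  | ite e P Q => .ite e P.prog Q.prog
  | loop v r P => .seq (.set v (.lit 0) (.lit 0)) (.while (.sub (reg r) (reg v))
      (.seq P.prog (.set v (.lit 0) (.add (reg v) (.lit 1)))))

/-- The arrays a program may write to. -/
def writes : Code → List ℕ
  | skip => []
  | set a _ _ => [a]
  | seq P Q => P.writes ++ Q.writes
  | ite _ P Q => P.writes ++ Q.writes
  | loop v _ P => v :: P.writes

/-- All loops are bounded by register `r`, and neither `r` nor loop variables are modified. -/
def WellFormed (r : ℕ) : Code → Bool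
  | skip => true
  | set a _ _ => a ≠ r
  | seq P Q => P.WellFormed r && Q.WellFormed r
  | ite _ P Q => P.WellFormed r && Q.WellFormed r
  | loop v r' P => r' = r && v ≠ r && v ∉ P.writes && P.WellFormed r

/-- A bound for the number of steps, as a polynomial in the bound of the loops. -/
noncomputable def cost : Code → Polynomial ℕ
  | skip => 1
  | set _ i e => (i.cost + e.cost + 1 : ℕ)
  | seq P Q => P.cost + Q.cost
  | ite e P Q => (e.cost + 1 : ℕ) + P.cost + Q.cost
  | loop _ _ P => 20 + Polynomial.X * (P.cost + 20)

/-- The effect of a program on the memory. -/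
noncomputable def run (D : Comparisons) : Code → Mem → Mem
  | skip, M => M
  | set a i e, M => M.write a (i.eval D M) (e.eval D M)
  | seq P Q, M => Q.run D (P.run D M)
  | ite e P Q, M => if e.eval D M = 0 then Q.run D M else P.run D M
  | loop v r P, M => Nat.rec (M.write v 0 0) (fun i M' => (P.run D M').write v 0 (i + 1)) (M r 0)

end Code

theorem Mem.write_of_ne (M : Mem) {a b : ℕ} (h : b ≠ a) (i v : ℕ) : M.write a i v b = M b := by
  funext j; simp [Mem.write, h]

theorem Mem.write_self (M : Mem) (a i v : ℕ) : M.write a i v a = Function.update (M a) i v := by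
  funext j; simp [Mem.write, Function.update_apply]

namespace Code

variable {D : Comparisons}

/-- The list `writes` is syntactic, so for a concrete program the side condition is settled by
`decide`. Correctness proofs below use this to carry all untouched arrays through a sequence of
subprograms. -/
theorem run_frame (c : Code) (M : Mem) {a : ℕ} (h : a ∉ c.writes) : c.run D M a = M a := by
  induction c generalizing M with
  | skip => rfl
  | set b i e => exact M.write_of_ne (by simpa [writes] using h) _ _
  | seq P Q hP hQ =>
    simp only [writes, List.mem_append, not_or] at h
    simp [run, hP _ h.1, hQ _ h.2]
  | ite e P Q hP hQ =>
    simp only [writes, List.mem_append, not_or] at h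
    by_cases he : e.eval D M = 0 <;> simp [run, hP _ h.1, hQ _ h.2, he]
  | loop v r P hP =>
    simp only [writes, List.mem_cons, not_or] at h
    simp only [run]
    induction M r 0 with
    | zero => exact M.write_of_ne h.1 _ _
    | succ i ih => exact (Mem.write_of_ne _ h.1 _ _).trans ((hP _ h.2).trans ih)

theorem not_mem_writes {r : ℕ} {c : Code} (h : c.WellFormed r) : r ∉ c.writes := by
  induction c with
  | skip => simp [writes]
  | set a i e => simp [WellFormed] at h; simp [writes, Ne.symm h]
  | seq P Q hP hQ => simp [WellFormed] at h; simp [writes, hP h.1, hQ h.2]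
  | ite e P Q hP hQ => simp [WellFormed] at h; simp [writes, hP h.1, hQ h.2]
  | loop v r' P hP => simp [WellFormed] at h; simp [writes, hP h.2, Ne.symm h.1.1.2]

/-- The memory after `i` rounds of a loop. -/
noncomputable def rounds (D : Comparisons) (v : ℕ) (P : Code) (M : Mem) (i : ℕ) : Mem :=
  Nat.rec (M.write v 0 0) (fun i M' => (P.run D M').write v 0 (i + 1)) i

theorem run_loop (v r : ℕ) (P : Code) (M : Mem) :
    (loop v r P).run D M = rounds D v P M (M r 0) := rfl

theorem rounds_var (v : ℕ) (P : Code) (M : Mem) (i : ℕ) : rounds D v P M i v 0 = i := by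
  cases i <;> simp [rounds, Mem.write]

theorem rounds_frame {v a : ℕ} {P : Code} (M : Mem) (i : ℕ) (hv : a ≠ v) (ha : a ∉ P.writes) :
    rounds D v P M i a = M a := by
  induction i with
  | zero => exact M.write_of_ne hv _ _
  | succ i ih => exact (Mem.write_of_ne _ hv _ _).trans ((run_frame P _ ha).trans ih)

/-- Each evaluation of the loop test costs `6` and each increment of the loop variable costs `6`;
this gives `c + 12` per round and `6` for the final failing test. -/
theorem exec_while {v r : ℕ} {P : Code} (hvr : v ≠ r) (hv : v ∉ P.writes) (hr : r ∉ P.writes)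
    {b c : ℕ} (hP : ∀ M : Mem, M r 0 = b → ∃ t ≤ c, Exec D P.prog M (P.run D M) t) (M : Mem)
    (hM : M r 0 = b) (m i : ℕ) (hi : i + m = b) :
    ∃ t ≤ 6 + m * (c + 12), Exec D (.while (.sub (reg r) (reg v))
      (.seq P.prog (.set v (.lit 0) (.add (reg v) (.lit 1))))) (rounds D v P M i)
      (rounds D v P M b) t := by
  have hb : ∀ i, rounds D v P M i r 0 = b := fun i => by
    rw [rounds_frame M i (Ne.symm hvr) hr, hM]
  induction m generalizing i with
  | zero =>
    obtain rfl : i = b := by omega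
    refine ⟨_, ?_, Exec.while_false ?_⟩
    · simp [Exp.cost]
    · simp [Exp.eval, hb, rounds_var]
  | succ m ih =>
    obtain ⟨t, ht, hex⟩ := hP _ (hb i)
    obtain ⟨s, hs, hex'⟩ := ih (i + 1) (by omega)
    have h3 := Exec.set (D := D) (P.run D (rounds D v P M i)) v (.lit 0) (.add (reg v) (.lit 1))
    have h4 : (P.run D (rounds D v P M i)) v 0 = i := by rw [run_frame P _ hv, rounds_var]
    simp only [Exp.eval, h4] at h3
    refine ⟨_, ?_, Exec.while_true (by simp [Exp.eval, hb, rounds_var]; omega) (hex.seq h3) hex'⟩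
    simp only [Exp.cost]
    linarith

/-- The register `r` that bounds all loops is never written, so every loop, however deeply nested,
makes at most `B` rounds. The time bound is then a structural induction. -/
theorem exists_exec {r B : ℕ} (c : Code) (hc : c.WellFormed r) (M : Mem) (hM : M r 0 ≤ B) :
    ∃ t ≤ c.cost.eval B, Exec D c.prog M (c.run D M) t := by
  induction c generalizing M with
  | skip => exact ⟨1, by simp [cost], Exec.skip M⟩
  | set a i e => exact ⟨_, by simp [cost], Exec.set M a i e⟩
  | seq P Q hP hQ =>
    simp only [WellFormed, Bool.and_eq_true] at hc
    obtain ⟨s, hs, h1⟩ := hP hc.1 M hM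
    obtain ⟨t, ht, h2⟩ := hQ hc.2 (P.run D M) (by rwa [run_frame P M (not_mem_writes hc.1)])
    exact ⟨_, by simp only [cost, Polynomial.eval_add]; omega, h1.seq h2⟩
  | ite e P Q hP hQ =>
    simp only [WellFormed, Bool.and_eq_true] at hc
    by_cases he : e.eval D M = 0
    · obtain ⟨t, ht, h2⟩ := hQ hc.2 M hM
      simp only [run, he, if_true]
      exact ⟨_, by simp only [cost, Polynomial.eval_add, Polynomial.eval_natCast]; simp; omega,
        Exec.ite_false he h2⟩
    · obtain ⟨t, ht, h2⟩ := hP hc.1 M hM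
      simp only [run, he, if_false]
      exact ⟨_, by simp only [cost, Polynomial.eval_add, Polynomial.eval_natCast]; simp; omega,
        Exec.ite_true he h2⟩
  | loop v r' P hP =>
    simp only [WellFormed, Bool.and_eq_true, decide_eq_true_eq] at hc
    obtain ⟨⟨⟨rfl, hvr⟩, hv⟩, hw⟩ := hc
    obtain ⟨t, ht, hex⟩ := exec_while (D := D) hvr hv (not_mem_writes hw) (b := M r' 0)
      (c := P.cost.eval B) (fun M' h => hP hw M' (h ▸ hM)) M rfl (M r' 0) 0 (by simp)
    have h3 := Exec.set (D := D) M v (.lit 0) (.lit 0)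
    refine ⟨_, ?_, h3.seq hex⟩
    simp only [Exp.cost, cost, Polynomial.eval_add, Polynomial.eval_mul, Polynomial.eval_X,
      Polynomial.eval_ofNat]
    have := Nat.mul_le_mul hM (le_refl (P.cost.eval B + 12))
    nlinarith

/-- The invariant rule for loops. -/
theorem loop_induction {v r : ℕ} {P : Code} {M : Mem} (I : ℕ → Mem → Prop)
    (h0 : I 0 (M.write v 0 0))
    (hs : ∀ i < M r 0, ∀ M' : Mem, (∀ a, a ∉ v :: P.writes → M' a = M a) → M' v 0 = i → I i M' →
      I (i + 1) ((P.run D M').write v 0 (i + 1))) :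
    I (M r 0) ((loop v r P).run D M) := by
  rw [run_loop]
  have : ∀ i ≤ M r 0, I i (rounds D v P M i) := by
    intro i
    induction i with
    | zero => exact fun _ => h0
    | succ i ih =>
      intro hi
      refine hs i (by omega) _ (fun a ha => ?_) (rounds_var v P M i) (ih (by omega))
      simp only [List.mem_cons, not_or] at ha
      exact rounds_frame M i ha.1 ha.2
  exact this _ le_rfl

end Code

/-! ### Boolean expressions -/

namespace Exp

variable {D : Comparisons} {M : Mem}

/-- Truth of an expression, that is, being nonzero. -/
def Holds (D : Comparisons) (M : Mem) (e : Exp) : Prop := e.eval D M ≠ 0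

def eq (e f : Exp) : Exp := .sub (.lit 1) (.add (.sub e f) (.sub f e))
def lt (e f : Exp) : Exp := .sub f e
def and (e f : Exp) : Exp := .sub (.lit 1) (.add (.sub (.lit 1) e) (.sub (.lit 1) f))
def not (e : Exp) : Exp := .sub (.lit 1) e
def or (e f : Exp) : Exp := .add e f

theorem holds_eq (e f : Exp) : (eq e f).Holds D M ↔ e.eval D M = f.eval D M := by
  simp only [Holds, eq, eval]; omega

theorem holds_lt (e f : Exp) : (lt e f).Holds D M ↔ e.eval D M < f.eval D M := by
  simp only [Holds, lt, eval]; omega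

theorem holds_and (e f : Exp) : (and e f).Holds D M ↔ e.Holds D M ∧ f.Holds D M := by
  simp only [Holds, and, eval]; omega

theorem holds_or (e f : Exp) : (or e f).Holds D M ↔ e.Holds D M ∨ f.Holds D M := by
  simp only [Holds, or, eval]; omega

theorem holds_not (e : Exp) : (not e).Holds D M ↔ ¬ e.Holds D M := by
  simp only [Holds, not, eval]; omega

open Classical in
theorem eval_not (e : Exp) : (not e).eval D M = if e.Holds D M then 0 else 1 := by
  by_cases h : e.eval D M = 0
  · simp [Holds, not, eval, h]
  · simp [Holds, not, eval, h]; omega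

theorem holds_get (a : ℕ) (i : Exp) : (get a i).Holds D M ↔ M a (i.eval D M) ≠ 0 := Iff.rfl

theorem holds_lit (c : ℕ) : (lit c).Holds D M ↔ c ≠ 0 := Iff.rfl

theorem holds_distLe (u v w z : Exp) : (distLe u v w z).Holds D M ↔
    D (u.eval D M) (v.eval D M) (w.eval D M) (z.eval D M) := by
  simp [Holds, eval]

end Exp

/-! ### Standard loops -/

namespace Code

variable {D : Comparisons}

open Classical in
theorem run_ite (e : Exp) (P Q : Code) (M : Mem) :
    (ite e P Q).run D M = if e.Holds D M then P.run D M else Q.run D M := by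
  by_cases h : e.eval D M = 0 <;> simp [run, Exp.Holds, h]

theorem run_skip (M : Mem) : skip.run D M = M := rfl

theorem run_seq (P Q : Code) (M : Mem) : (P ⨾ Q).run D M = Q.run D (P.run D M) := rfl

theorem run_set (a : ℕ) (i e : Exp) (M : Mem) :
    (set a i e).run D M = M.write a (i.eval D M) (e.eval D M) := rfl

/-- Count in register `c` the `v` for which `e` holds after execution of `P`. -/
def count (r c v : ℕ) (P : Code) (e : Exp) : Code :=
  assign c (.lit 0) ⨾ loop v r (P ⨾ ite e (assign c (.add (reg c) (.lit 1))) skip)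

/-- Find the last `v` for which `e` holds after execution of `P`, and put it into register `c`. -/
def find (r c v : ℕ) (P : Code) (e : Exp) : Code :=
  loop v r (P ⨾ ite e (assign c (reg v)) skip)

/-- Replace the `v`-th cell of array `a` by the value of `f` if `e` holds after execution
of `P`. -/
def update (r a v : ℕ) (P : Code) (e f : Exp) : Code :=
  loop v r (P ⨾ ite e (set a (reg v) f) skip)

theorem run_count {r c v : ℕ} {P : Code} {e : Exp} {M : Mem}
    (hw : c ≠ v ∧ r ≠ c ∧ c ∉ P.writes ∧ v ∉ P.writes)
    (p : ℕ → Prop) [DecidablePred p]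
    (h : ∀ i < M r 0, ∀ M' : Mem, (∀ a, a ∉ (count r c v P e).writes → M' a = M a) → M' v 0 = i →
      (e.Holds D (P.run D M') ↔ p i)) :
    (count r c v P e).run D M c 0 = ((Finset.range (M r 0)).filter p).card := by
  obtain ⟨h1, h2, h4, h5⟩ := hw
  rw [count, run_seq]
  have hr : (assign c (.lit 0)).run D M r 0 = M r 0 := by
    rw [run_set, Mem.write_of_ne _ h2]
  have := loop_induction (D := D) (v := v) (r := r)
    (P := P ⨾ ite e (assign c (.add (reg c) (.lit 1))) skip)
    (M := (assign c (.lit 0)).run D M)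
    (fun i M' => M' c 0 = ((Finset.range i).filter p).card) ?_ ?_
  · rw [hr] at this
    exact this
  · simp [run_set, Mem.write_of_ne _ h1, Mem.write_self, Exp.eval]
  · intro i hi M' hM' hv hI
    rw [hr] at hi
    have hc : P.run D M' c 0 = M' c 0 := by rw [run_frame P _ h4]
    have hM'' : ∀ a, a ∉ (count r c v P e).writes → M' a = M a := by
      intro a ha
      simp only [count, writes, List.mem_append, List.mem_cons, not_or] at ha
      rw [hM' a (by simp only [writes, List.mem_append, List.mem_cons, not_or]; tauto), run_set,
        Mem.write_of_ne _ ha.1.1]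
    rw [Mem.write_of_ne _ h1, run_seq, run_ite, Finset.range_add_one, Finset.filter_insert,
      h i hi M' hM'' hv]
    split_ifs with hp
    · rw [Finset.card_insert_of_notMem (by simp)]
      simp [run_set, Mem.write_self, Exp.eval, hc, hI]
    · simp [run, hc, hI]

theorem run_find {r c v : ℕ} {P : Code} {e : Exp} {M : Mem}
    (hw : c ≠ v ∧ c ∉ P.writes ∧ v ∉ P.writes)
    (p : ℕ → Prop)
    (h : ∀ i < M r 0, ∀ M' : Mem, (∀ a, a ∉ (find r c v P e).writes → M' a = M a) → M' v 0 = i →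
      (e.Holds D (P.run D M') ↔ p i)) :
    (∃ i < M r 0, p i ∧ (∀ j < M r 0, p j → j ≤ i) ∧ (find r c v P e).run D M c 0 = i) ∨
      (∀ i < M r 0, ¬ p i) ∧ (find r c v P e).run D M c 0 = M c 0 := by
  classical
  obtain ⟨h1, h4, h5⟩ := hw
  refine loop_induction (D := D) (v := v) (r := r) (M := M)
    (P := P ⨾ ite e (assign c (reg v)) skip)
    (fun b M' => (∃ i < b, p i ∧ (∀ j < b, p j → j ≤ i) ∧ M' c 0 = i) ∨
      (∀ i < b, ¬ p i) ∧ M' c 0 = M c 0) ?_ ?_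
  · simp [Mem.write_of_ne _ h1]
  · intro i hi M' hM' hv hI
    have hc : P.run D M' c 0 = M' c 0 := by rw [run_frame P _ h4]
    have hv' : P.run D M' v 0 = i := by rw [run_frame P _ h5, hv]
    rw [Mem.write_of_ne _ h1, run_seq, run_ite, h i hi M' hM' hv]
    split_ifs with hp
    · left
      exact ⟨i, by omega, hp, fun j hj _ => by omega,
        by simp [run_set, Mem.write_self, Exp.eval, hv']⟩
    · simp only [run, hc]
      rcases hI with ⟨j, hj, hpj, hmax, hcj⟩ | ⟨hno, hcj⟩
      · refine Or.inl ⟨j, by omega, hpj, fun l hl hpl => ?_, hcj⟩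
        rcases Nat.lt_succ_iff_lt_or_eq.1 hl with hl | rfl
        · exact hmax l hl hpl
        · exact absurd hpl hp
      · refine Or.inr ⟨fun l hl => ?_, hcj⟩
        rcases Nat.lt_succ_iff_lt_or_eq.1 hl with hl | rfl
        · exact hno l hl
        · exact hp

/-- The test and the new value are examined in a memory where the cells below `i` already have their
new contents and the others their old ones. This permits recursive definitions of the array, as in
`subtree`. -/
theorem run_update {r a v : ℕ} {P : Code} {e f : Exp} {M : Mem}
    (hw : a ≠ v ∧ a ∉ P.writes ∧ v ∉ P.writes)
    (p : ℕ → Prop) [DecidablePred p] (g : ℕ → ℕ)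
    (h : ∀ i < M r 0, ∀ M' : Mem, (∀ b, b ∉ (update r a v P e f).writes → M' b = M b) →
      M' v 0 = i → (∀ j, M' a j = if j < i ∧ p j then g j else M a j) →
      (e.Holds D (P.run D M') ↔ p i) ∧ (p i → f.eval D (P.run D M') = g i)) (j : ℕ) :
    (update r a v P e f).run D M a j = if j < M r 0 ∧ p j then g j else M a j := by
  obtain ⟨h1, h4, h5⟩ := hw
  revert j
  refine loop_induction (D := D) (v := v) (r := r) (M := M)
    (P := P ⨾ ite e (set a (reg v) f) skip)
    (fun b M' => ∀ j, M' a j = if j < b ∧ p j then g j else M a j) ?_ ?_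
  · simp [Mem.write_of_ne _ h1]
  · intro i hi M' hM' hv hI j
    have hv' : P.run D M' v 0 = i := by rw [run_frame P _ h5, hv]
    obtain ⟨h6, h7⟩ := h i hi M' hM' hv hI
    rw [Mem.write_of_ne _ h1, run_seq, run_ite, h6]
    split_ifs with hp hj hj
    · rw [run_set, Mem.write_self]
      simp only [Exp.eval, hv', h7 hp, Function.update_apply, run_frame P _ h4, hI]
      rcases eq_or_ne j i with rfl | hji
      · simp
      · rw [if_neg hji, if_pos ⟨by omega, hj.2⟩]
    · rw [run_set, Mem.write_self]
      simp only [Exp.eval, hv', h7 hp, Function.update_apply, run_frame P _ h4, hI]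
      rw [if_neg (by rintro rfl; exact hj ⟨by omega, hp⟩), if_neg (fun h => hj ⟨by omega, h.2⟩)]
    · have hl : j < i := lt_of_le_of_ne (by omega) (by rintro rfl; exact hp hj.2)
      rw [run, run_frame P _ h4, hI, if_pos ⟨hl, hj.2⟩]
    · rw [run, run_frame P _ h4, hI, if_neg (fun h => hj ⟨by omega, h.2⟩)]

end Code
end KDBST

namespace KDBST

/-! ### Trees given by parent pointers -/

/-- Ranks increase along `f` and are bounded, so every vertex is led to `r` and the graph is
connected. All edges have the form `{x, f x}` with `x ≠ r`, so there are at most `|V| - 1` of them;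
a connected graph with so few edges is a tree. -/
theorem isTree_of_parent {V : Type*} [Finite V] (G : SimpleGraph V) (f : V → V) (rk : V → ℕ)
    (r : V) (hrk : ∀ x, x ≠ r → rk x < rk (f x)) (hr : f r = r)
    (hG : ∀ x y, G.Adj x y ↔ x ≠ y ∧ (f x = y ∨ f y = x)) : G.IsTree := by
  classical
  have hbd : ∃ B, ∀ x, rk x ≤ B := by
    obtain ⟨B, hB⟩ := (Set.finite_range rk).bddAbove
    exact ⟨B, fun x => hB ⟨x, rfl⟩⟩
  obtain ⟨B, hB⟩ := hbd
  have hreach : ∀ m x, B - rk x ≤ m → G.Reachable x r := by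
    intro m
    induction m with
    | zero =>
      intro x hx
      by_cases hxr : x = r
      · rw [hxr]
      · have := hrk x hxr; have := hB (f x); omega
    | succ m ih =>
      intro x hx
      by_cases hxr : x = r
      · rw [hxr]
      · have h1 := hrk x hxr
        have h2 := hB (f x)
        have h3 : G.Adj x (f x) := (hG _ _).2 ⟨fun h => by rw [← h] at h1; omega, Or.inl rfl⟩
        exact h3.reachable.trans (ih _ (by omega))
  have hconn : G.Connected :=
    { preconnected := fun x y => (hreach _ x le_rfl).trans (hreach _ y le_rfl).symm
      nonempty := ⟨r⟩ }
  refine SimpleGraph.isTree_iff_connected_and_card.2 ⟨hconn, ?_⟩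
  have h1 := hconn.card_vert_le_card_edgeSet_add_one
  have h2 : G.edgeSet ⊆ (fun x => s(x, f x)) '' {x | x ≠ r} := by
    intro e
    induction e with
    | h x y =>
      rw [SimpleGraph.mem_edgeSet, hG]
      rintro ⟨hne, h | h⟩
      · exact ⟨x, fun hx => hne (by rw [← h, hx, hr]), by rw [← h]⟩
      · exact ⟨y, fun hy => hne (by rw [← h, hy, hr]), by rw [← h, Sym2.eq_swap]⟩
  have h3 : G.edgeSet.ncard ≤ ({x | x ≠ r} : Set V).ncard :=
    (Set.ncard_le_ncard h2 (Set.toFinite _)).trans (Set.ncard_image_le (Set.toFinite _))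
  have h4 : ({x | x ≠ r} : Set V).ncard + 1 = Nat.card V := by
    have := Set.ncard_add_ncard_compl ({r} : Set V)
    rw [Set.ncard_singleton] at this
    have h5 : ({r} : Set V)ᶜ = {x | x ≠ r} := rfl
    rw [h5] at this
    omega
  have h5 : Nat.card G.edgeSet = G.edgeSet.ncard := rfl
  omega

/-! ### Instances on natural numbers -/

section
variable {k n : ℕ} {X : Type*} [MetricSpace X]

/-- The distance between points given by their numbers. -/
noncomputable def distN {m : ℕ} (p : Fin m → X) (x y : ℕ) : ℝ :=
  if h : x < m ∧ y < m then dist (p ⟨x, h.1⟩) (p ⟨y, h.2⟩) else 0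

theorem distN_fin {m : ℕ} (p : Fin m → X) (x y : Fin m) : distN p x y = dist (p x) (p y) := by
  simp [distN]

theorem distN_nonneg {m : ℕ} (p : Fin m → X) (x y : ℕ) : 0 ≤ distN p x y := by
  unfold distN; split_ifs <;> simp

theorem distN_comm {m : ℕ} (p : Fin m → X) (x y : ℕ) : distN p x y = distN p y x := by
  unfold distN; split_ifs with h h' h' <;> first | exact dist_comm _ _ | rfl | omega

theorem distN_self {m : ℕ} (p : Fin m → X) (x : ℕ) : distN p x x = 0 := by
  unfold distN; split_ifs <;> simp

theorem distN_triangle {m : ℕ} (p : Fin m → X) {x y z : ℕ} (hx : x < m) (hy : y < m)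
    (hz : z < m) : distN p x z ≤ distN p x y + distN p y z := by
  simp only [distN, hx, hy, hz, and_self, dite_true]
  exact dist_triangle _ _ _

theorem comparisons_iff (p : Fin (k * n) → X) {u v w z : ℕ} (hu : u < k * n) (hv : v < k * n)
    (hw : w < k * n) (hz : z < k * n) :
    comparisons p u v w z ↔ distN p u v ≤ distN p w z := by
  constructor
  · rintro ⟨u, v, w, z, rfl, rfl, rfl, rfl, h⟩
    simpa only [distN_fin] using h
  · intro h
    refine ⟨⟨u, hu⟩, ⟨v, hv⟩, ⟨w, hw⟩, ⟨z, hz⟩, rfl, rfl, rfl, rfl, ?_⟩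
    simpa [distN, hu, hv, hw, hz] using h

/-- The number of the tuple of a point given by its number. -/
def tupN (tup : Fin (k * n) → Fin n) : ℕ → ℕ := inputMem tup 1

theorem tupN_fin (tup : Fin (k * n) → Fin n) (x : Fin (k * n)) : tupN tup x = tup x := by
  simp [tupN, inputMem]

theorem tupN_lt (tup : Fin (k * n) → Fin n) {x : ℕ} (hx : x < k * n) : tupN tup x < n := by
  have := tupN_fin tup ⟨x, hx⟩
  simp only at this
  rw [this]
  exact (tup _).2

/-- The trees given by tree numbers `c` and parent pointers `q` are a feasible family with
edges of length at most `b`. -/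
structure IsSolution (k n : ℕ) (d : ℕ → ℕ → ℝ) (T : ℕ → ℕ) (b : ℝ) (c q : ℕ → ℕ) : Prop where
  tree_lt : ∀ x < k * n, c x < k
  exists_point : ∀ i < k, ∀ t < n, ∃ x < k * n, c x = i ∧ T x = t
  unique_point : ∀ x < k * n, ∀ y < k * n, c x = c y → T x = T y → x = y
  parent_lt : ∀ x < k * n, q x < k * n
  tree_parent : ∀ x < k * n, c (q x) = c x
  dist_parent : ∀ x < k * n, d x (q x) ≤ b
  rank : ∃ rk : ℕ → ℕ, ∀ x < k * n, q x ≠ x → rk x < rk (q x)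
  unique_root : ∀ x < k * n, ∀ y < k * n, c x = c y → q x = x → q y = y → x = y

/-- A point of maximal rank in its tree has no parent other than itself. -/
theorem exists_root {N : ℕ} {q rk c : ℕ → ℕ} (hq : ∀ x < N, q x < N) (hc : ∀ x < N, c (q x) = c x)
    (hrk : ∀ x < N, q x ≠ x → rk x < rk (q x)) {x : ℕ} (hx : x < N) :
    ∃ r < N, c r = c x ∧ q r = r := by
  obtain ⟨r, hr, hmax⟩ := Finset.exists_max_image ((Finset.range N).filter (c · = c x)) rk
    ⟨x, by simp [hx]⟩
  simp only [Finset.mem_filter, Finset.mem_range] at hr hmax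
  refine ⟨r, hr.1, hr.2, ?_⟩
  by_contra h
  have := hrk r hr.1 h
  have := hmax (q r) ⟨hq _ hr.1, (hc _ hr.1).trans hr.2⟩
  omega

theorem IsSolution.isFeasible {p : Fin (k * n) → X} {tup : Fin (k * n) → Fin n} {b : ℝ} {M : Mem}
    (hn : 1 ≤ n) (h : IsSolution k n (distN p) (tupN tup) b (M 2) (M 3)) :
    IsFeasible tup (outputFamily k n M) := by
  refine ⟨fun i => ?_, fun i j hij => ?_, fun i t => ?_⟩
  · obtain ⟨rk, hrk⟩ := h.rank
    obtain ⟨x, hx, hxc, -⟩ := h.exists_point i i.2 0 hn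
    obtain ⟨r, hr, hrc, hrr⟩ := exists_root h.parent_lt h.tree_parent hrk hx
    rw [hxc] at hrc
    have hadj : ∀ x y : Fin (k * n), (outputFamily k n M i).Adj x y ↔
        x ≠ y ∧ M 2 x = i ∧ M 2 y = i ∧ (M 3 x = y ∨ M 3 y = x) := fun x y => Iff.rfl
    have hmem : ∀ x : Fin (k * n), x ∈ (outputFamily k n M i).verts ↔ M 2 x = i := fun x => Iff.rfl
    generalize outputFamily k n M i = G at hadj hmem ⊢
    refine isTree_of_parent _ (fun x => ⟨⟨M 3 x, h.parent_lt _ x.1.2⟩, ?_⟩) (fun x => rk x.1)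
      ⟨⟨r, hr⟩, (hmem _).2 hrc⟩ (fun x hx => ?_) ?_ (fun x y => ?_)
    · exact (hmem _).2 ((h.tree_parent _ x.1.2).trans ((hmem _).1 x.2))
    · refine hrk _ x.1.2 (fun h' => hx ?_)
      ext
      exact h.unique_root _ x.1.2 _ hr (((hmem _).1 x.2).trans hrc.symm) h' hrr
    · ext; exact hrr
    · simp only [SimpleGraph.Subgraph.coe_adj, hadj, (hmem _).1 x.2, (hmem _).1 y.2, true_and, Ne,
        Subtype.ext_iff, Fin.ext_iff]
  · rw [Set.disjoint_left]
    intro x hx hx'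
    exact hij (Fin.ext ((show M 2 x = i from hx).symm.trans hx'))
  · obtain ⟨x, hx, hxc, hxt⟩ := h.exists_point i i.2 t t.2
    refine ⟨⟨x, hx⟩, ⟨hxc, ?_⟩, ?_⟩
    · rw [Fin.ext_iff, ← hxt, ← tupN_fin]
    · rintro y ⟨hyc, hyt⟩
      refine Fin.ext (h.unique_point _ y.2 _ hx ?_ ?_)
      · exact (show M 2 y = i from hyc).trans hxc.symm
      · rw [tupN_fin, hyt, hxt]

theorem IsSolution.bottleneck_le {p : Fin (k * n) → X} {tup : Fin (k * n) → Fin n} {b : ℝ}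
    {M : Mem} (hb : 0 ≤ b) (h : IsSolution k n (distN p) (tupN tup) b (M 2) (M 3)) :
    bottleneck p (outputFamily k n M) ≤ b := by
  refine Real.sSup_le ?_ hb
  rintro _ ⟨i, x, y, ⟨-, -, -, hxy | hxy⟩, rfl⟩
  · rw [← distN_fin, ← hxy]
    exact h.dist_parent _ x.2
  · rw [← distN_fin, ← hxy, distN_comm]
    exact h.dist_parent _ y.2

/-! ### Balanced thresholds -/

/-- Whenever the points are divided into classes, such that points at distance at most `l` are in
the same class, each class has the same number of points in all tuples. -/
def IsBalanced (N n : ℕ) (d : ℕ → ℕ → ℝ) (T : ℕ → ℕ) (l : ℝ) : Prop :=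
  ∀ C : ℕ → ℕ, (∀ x < N, ∀ y < N, d x y ≤ l → C x = C y) → ∀ r, ∀ i < n, ∀ j < n,
    ((Finset.range N).filter fun x => C x = r ∧ T x = i).card =
      ((Finset.range N).filter fun x => C x = r ∧ T x = j).card

theorem card_tuple {tup : Fin (k * n) → Fin n} (htup : IsTuplePartition tup) {i : ℕ} (hi : i < n) :
    ((Finset.range (k * n)).filter fun x => tupN tup x = i).card = k := by
  refine Eq.trans ?_ (htup ⟨i, hi⟩)
  rw [Nat.card_eq_fintype_card, Fintype.card_subtype]
  symm
  refine Finset.card_bij (fun x _ => x.1) ?_ ?_ ?_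
  · intro x hx
    simp only [Finset.mem_filter, Finset.mem_univ, true_and] at hx
    simp [tupN_fin, hx]
  · exact fun x _ y _ h => Fin.ext h
  · intro x hx
    simp only [Finset.mem_filter, Finset.mem_range] at hx
    refine ⟨⟨x, hx.1⟩, ?_, rfl⟩
    simp only [Finset.mem_filter, Finset.mem_univ, true_and, Fin.ext_iff]
    exact (tupN_fin tup ⟨x, hx.1⟩).symm.trans hx.2

/-- All points lie in a single class, which has `k` points in each tuple. Applied to the largest
distance, this ensures that some threshold is accepted. -/
theorem isBalanced_of_forall_dist_le {tup : Fin (k * n) → Fin n} (htup : IsTuplePartition tup)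
    {d : ℕ → ℕ → ℝ} {l : ℝ} (h : ∀ x < k * n, ∀ y < k * n, d x y ≤ l) :
    IsBalanced (k * n) n d (tupN tup) l := by
  intro C hC r i hi j hj
  by_cases hr : ∀ x < k * n, C x = r
  · have : ∀ i < n, ((Finset.range (k * n)).filter fun x => C x = r ∧ tupN tup x = i).card = k := by
      intro i hi
      refine Eq.trans ?_ (card_tuple htup hi)
      congr 1
      refine Finset.filter_congr fun x hx => ?_
      simp [hr x (Finset.mem_range.1 hx)]
    rw [this i hi, this j hj]
  · push Not at hr
    obtain ⟨x, hx, hxr⟩ := hr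
    have : ∀ i, ((Finset.range (k * n)).filter fun x => C x = r ∧ tupN tup x = i) = ∅ := by
      intro i
      refine Finset.filter_eq_empty_iff.2 fun y hy hyr => hxr ?_
      rw [← hyr.1]
      exact hC x hx y (Finset.mem_range.1 hy) (h _ hx _ (Finset.mem_range.1 hy))
    rw [this, this]

/-- The `k` disjoint trees contain `k` different points of the tuple of `x`, which are all the
points of that tuple. -/
theorem IsFeasible.exists_tree {tup : Fin (k * n) → Fin n} (htup : IsTuplePartition tup)
    {S : Family k n} (hS : IsFeasible tup S) (x : Fin (k * n)) : ∃ c, x ∈ (S c).verts := by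
  classical
  choose f hf using fun c => (hS.exactly_one c (tup x)).exists
  have hinj : Function.Injective
      (fun c => (⟨f c, (hf c).2⟩ : {y : Fin (k * n) // tup y = tup x})) := by
    intro c c' h
    by_contra hne
    have h' : f c = f c' := congrArg Subtype.val h
    exact Set.disjoint_left.1 (hS.disjoint c c' hne) (hf c).1 (h' ▸ (hf c').1)
  have hbij := (Fintype.bijective_iff_injective_and_card _).2
    ⟨hinj, by rw [← Nat.card_eq_fintype_card, ← Nat.card_eq_fintype_card, htup]; simp⟩
  obtain ⟨c, hc⟩ := hbij.2 ⟨x, rfl⟩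
  have hc' : f c = x := congrArg Subtype.val hc
  exact ⟨c, hc' ▸ (hf c).1⟩

theorem dist_le_bottleneck (p : Fin (k * n) → X) (S : Family k n) {c : Fin k}
    {x y : Fin (k * n)} (h : (S c).Adj x y) : dist (p x) (p y) ≤ bottleneck p S := by
  refine le_csSup ?_ ⟨c, x, y, h, rfl⟩
  refine Set.Finite.bddAbove (Set.Finite.subset
    (Set.finite_range fun z : Fin (k * n) × Fin (k * n) => dist (p z.1) (p z.2)) ?_)
  rintro _ ⟨c, x, y, -, rfl⟩
  exact ⟨(x, y), rfl⟩

/-- The supremum over a finite nonempty set is attained. Without edges the bottleneck is `0`, the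
distance of a point to itself, so this case is a threshold of the same kind. -/
theorem exists_eq_bottleneck (hN : 0 < k * n) (p : Fin (k * n) → X) (S : Family k n) :
    ∃ u < k * n, ∃ v < k * n, distN p u v = bottleneck p S := by
  set A := {r : ℝ | ∃ (c : Fin k) (x y : Fin (k * n)), (S c).Adj x y ∧ r = dist (p x) (p y)}
    with hA
  rcases A.eq_empty_or_nonempty with h | h
  · refine ⟨0, hN, 0, hN, ?_⟩
    rw [distN_self, bottleneck, ← hA, h, Real.sSup_empty]
  · have hfin : A.Finite := by
      refine Set.Finite.subset
        (Set.finite_range fun z : Fin (k * n) × Fin (k * n) => dist (p z.1) (p z.2)) ?_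
      rintro _ ⟨c, x, y, -, rfl⟩
      exact ⟨(x, y), rfl⟩
    obtain ⟨c, x, y, -, he⟩ := h.csSup_mem hfin
    exact ⟨x, x.2, y, y.2, by rw [distN_fin, ← he]; rfl⟩

/-- Classes are constant along edges of the trees, so each tree lies in one class. Sending a tree to
its point in tuple `i` is a bijection from the trees in class `r` onto the points of tuple `i` in
that class; the number of these trees does not depend on `i`. -/
theorem IsFeasible.isBalanced {p : Fin (k * n) → X} {tup : Fin (k * n) → Fin n}
    (htup : IsTuplePartition tup) {S : Family k n} (hS : IsFeasible tup S) :
    IsBalanced (k * n) n (distN p) (tupN tup) (bottleneck p S) := by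
  classical
  intro C hC r
  have hconst : ∀ c, ∀ x ∈ (S c).verts, ∀ y ∈ (S c).verts, C x = C y := by
    intro c x hx y hy
    have h := (hS.isTree c).1.preconnected ⟨x, hx⟩ ⟨y, hy⟩
    obtain ⟨w⟩ := h
    have : ∀ (a b : (S c).verts), (S c).coe.Walk a b → C a = C b := by
      intro a b w
      induction w with
      | nil => rfl
      | cons h _ ih =>
        rw [← ih]
        refine hC _ (Fin.is_lt _) _ (Fin.is_lt _) ?_
        rw [distN_fin]
        exact dist_le_bottleneck p S h
    exact this _ _ w
  choose tr htr using hS.exists_tree htup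
  choose f hf hfu using hS.exactly_one
  have key : ∀ i < n, ((Finset.range (k * n)).filter fun x => C x = r ∧ tupN tup x = i).card =
      (Finset.univ.filter fun c : Fin k => ∃ x ∈ (S c).verts, C x = r).card := by
    intro i hi
    symm
    refine Finset.card_bij (fun c _ => (f c ⟨i, hi⟩ : ℕ)) ?_ ?_ ?_
    · intro c hc
      simp only [Finset.mem_filter, Finset.mem_univ, true_and] at hc
      obtain ⟨x, hx, hxr⟩ := hc
      simp only [Finset.mem_filter, Finset.mem_range, Fin.is_lt, true_and, tupN_fin,
        (hf c ⟨i, hi⟩).2, and_true]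
      rw [← hxr]
      exact hconst c _ (hf c ⟨i, hi⟩).1 _ hx
    · intro c _ c' _ h
      by_contra hne
      have h' := Fin.ext h
      exact Set.disjoint_left.1 (hS.disjoint c c' hne) (hf c ⟨i, hi⟩).1
        (h' ▸ (hf c' ⟨i, hi⟩).1)
    · intro x hx
      simp only [Finset.mem_filter, Finset.mem_range] at hx
      obtain ⟨hx, hxr, hxi⟩ := hx
      have h1 := htr ⟨x, hx⟩
      refine ⟨tr ⟨x, hx⟩, ?_, ?_⟩
      · simp only [Finset.mem_filter, Finset.mem_univ, true_and]
        exact ⟨_, h1, hxr⟩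
      · rw [← hfu _ ⟨i, hi⟩ ⟨x, hx⟩ ⟨h1, ?_⟩]
        rw [Fin.ext_iff, ← tupN_fin]
        exact hxi
  intro i hi j hj
  rw [key i hi, key j hj]

end
end KDBST

namespace KDBST

/-! ### Array names -/

notation "NUM" => 4
notation "ORD" => 5
notation "POS" => 6
notation "PAR" => 7
notation "COMP" => 8
notation "LINK" => 9
notation "THU" => 10
notation "THV" => 11
notation "FOUND" => 12
notation "BU" => 13
notation "BV" => 14
notation "LI" => 15
notation "LX" => 16
notation "FX" => 17

/-! ### Spanning forests -/

/-- The points are numbered anew by `ord`, and `par` are the parent pointers of a spanning forest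
of the graph `close`, whose components are described by `comp`. -/
structure IsForest (N : ℕ) (close : ℕ → ℕ → Prop) (ord pos par comp : ℕ → ℕ) : Prop where
  ord_lt : ∀ i < N, ord i < N
  pos_ord : ∀ i < N, pos (ord i) = i + 1
  exists_ord : ∀ x < N, ∃ i < N, ord i = x
  par_le : ∀ i < N, par i ≤ i
  comp_par : ∀ i < N, comp (par i) = comp i
  comp_root : ∀ i < N, par i = i → comp i = i
  close_par : ∀ i < N, par i ≠ i → close (ord (par i)) (ord i)
  comp_eq : ∀ i < N, ∀ j < N, close (ord i) (ord j) → comp i = comp j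

/-- The state of the construction of a spanning forest after `i` steps. -/
structure IsPartialForest (N : ℕ) (close : ℕ → ℕ → Prop) (i : ℕ) (ord pos par comp link : ℕ → ℕ) :
    Prop where
  ord_lt : ∀ a < i, ord a < N
  pos_ord : ∀ a < i, pos (ord a) = a + 1
  exists_ord : ∀ x < N, pos x ≠ 0 → ∃ a < i, ord a = x
  par_le : ∀ a < i, par a ≤ a
  comp_par : ∀ a < i, comp (par a) = comp a
  comp_root : ∀ a < i, par a = a → comp a = a
  close_par : ∀ a < i, par a ≠ a → close (ord (par a)) (ord a)
  comp_eq : ∀ a < i, ∀ b < i, close (ord a) (ord b) → comp a = comp b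
  link_zero : ∀ x < N, link x = 0 → ∀ a < i, ¬ close (ord a) x
  link_pos : ∀ x < N, link x ≠ 0 → link x - 1 < i ∧ close (ord (link x - 1)) x
  current : ∀ a < i, ∀ x < N, pos x = 0 → close (ord a) x → comp a = comp (i - 1)

variable {N : ℕ} {close : ℕ → ℕ → Prop} {i : ℕ} {ord pos par comp link : ℕ → ℕ}

theorem IsPartialForest.exists_pos_eq_zero
    (h : IsPartialForest N close i ord pos par comp link) (hi : i < N) : ∃ x < N, pos x = 0 := by
  by_contra! hc
  have : Finset.range N ⊆ (Finset.range i).image ord := by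
    intro x hx
    obtain ⟨a, ha, he⟩ := h.exists_ord x (Finset.mem_range.1 hx) (hc x (Finset.mem_range.1 hx))
    exact Finset.mem_image.2 ⟨a, Finset.mem_range.2 ha, he⟩
  have h1 := Finset.card_le_card this
  have h2 := Finset.card_image_le (s := Finset.range i) (f := ord)
  simp only [Finset.card_range] at h1 h2
  omega

/-- A nonzero `link x` is one more than the number of a placed point close to `x`. Unplaced points
with a link take precedence, so a new root is started only when no unplaced point is close to a
placed one. Hence all unplaced points that are close to something placed are close only to the
component of the last placed point (`current`); this is why two components never turn out to be
joined later. -/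
theorem IsPartialForest.step (h : IsPartialForest N close i ord pos par comp link)
    (hsymm : ∀ x < N, ∀ y < N, close x y → close y x)
    {z : ℕ} (hz : z < N) (hpz : pos z = 0) (hlink : link z = 0 → ∀ x < N, pos x = 0 → link x = 0)
    {ord' pos' par' comp' link' : ℕ → ℕ} (hord : ord' = Function.update ord i z)
    (hpos : pos' = Function.update pos z (i + 1))
    (hpar : par' = Function.update par i (if link z = 0 then i else link z - 1))
    (hcomp : comp' = Function.update comp i (if link z = 0 then i else comp (link z - 1)))
    (hlink' : ∀ x < N, (close z x → link' x = i + 1) ∧ (¬ close z x → link' x = link x)) :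
    IsPartialForest N close (i + 1) ord' pos' par' comp' link' := by
  have o1 : ord' i = z := by simp [hord]
  have o2 : ∀ a < i, ord' a = ord a := fun a ha => by
    rw [hord, Function.update_of_ne (by omega)]
  have p1 : pos' z = i + 1 := by simp [hpos]
  have p2 : ∀ x, x ≠ z → pos' x = pos x := fun x hx => by rw [hpos, Function.update_of_ne hx]
  have r1 : par' i = if link z = 0 then i else link z - 1 := by simp [hpar]
  have r2 : ∀ a < i, par' a = par a := fun a ha => by
    rw [hpar, Function.update_of_ne (by omega)]
  have c1 : comp' i = if link z = 0 then i else comp (link z - 1) := by simp [hcomp]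
  have c2 : ∀ a < i, comp' a = comp a := fun a ha => by
    rw [hcomp, Function.update_of_ne (by omega)]
  have hne : ∀ a < i, ord a ≠ z := fun a ha he => by
    have := h.pos_ord a ha
    rw [he] at this
    omega
  have hcase : ∀ {p : ℕ → Prop}, (∀ a < i, p a) → p i → ∀ a < i + 1, p a := by
    intro p h1 h2 a ha
    rcases Nat.lt_succ_iff_lt_or_eq.1 ha with h | rfl
    exacts [h1 _ h, h2]
  -- All placed points close to `z`, including the one that becomes its parent, belong to the
  -- current component.
  have hcur : ∀ a < i, close (ord a) z → comp' a = comp' i := by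
    intro a ha hc
    have hl : link z ≠ 0 := fun hl => h.link_zero z hz hl a ha hc
    obtain ⟨h1, h2⟩ := h.link_pos z hz hl
    rw [c2 a ha, c1, if_neg hl, h.current a ha z hz hpz hc, h.current _ h1 z hz hpz h2]
  constructor
  · exact hcase (fun a ha => by rw [o2 a ha]; exact h.ord_lt a ha) (by rwa [o1])
  · exact hcase (fun a ha => by rw [o2 a ha, p2 _ (hne a ha)]; exact h.pos_ord a ha) (by rw [o1, p1])
  · intro x hx hp
    by_cases hxz : x = z
    · exact ⟨i, by omega, by rw [o1, hxz]⟩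
    · rw [p2 x hxz] at hp
      obtain ⟨a, ha, he⟩ := h.exists_ord x hx hp
      exact ⟨a, by omega, by rw [o2 a ha, he]⟩
  · refine hcase (fun a ha => by rw [r2 a ha]; exact h.par_le a ha) ?_
    rw [r1]
    split_ifs with hl
    · exact le_rfl
    · have := (h.link_pos z hz hl).1
      omega
  · refine hcase (fun a ha => ?_) ?_
    · have := h.par_le a ha
      rw [r2 a ha, c2 a ha, c2 _ (by omega)]; exact h.comp_par a ha
    · rw [r1]
      split_ifs with hl
      · rfl
      · rw [c1, if_neg hl, c2 _ (h.link_pos z hz hl).1]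
  · refine hcase (fun a ha => by rw [r2 a ha, c2 a ha]; exact h.comp_root a ha) ?_
    rw [r1, c1]
    split_ifs with hl
    · exact fun _ => rfl
    · have := (h.link_pos z hz hl).1
      omega
  · refine hcase (fun a ha => ?_) ?_
    · have := h.par_le a ha
      rw [r2 a ha, o2 a ha, o2 _ (by omega)]; exact h.close_par a ha
    · rw [r1]
      split_ifs with hl
      · exact fun h => absurd rfl h
      · obtain ⟨h1, h2⟩ := h.link_pos z hz hl
        intro _
        rw [o1, o2 _ h1]
        exact h2
  · refine hcase (fun a ha => hcase (fun b hb => ?_) ?_) (hcase (fun b hb => ?_) fun _ => rfl)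
    · rw [o2 a ha, o2 b hb, c2 a ha, c2 b hb]; exact h.comp_eq a ha b hb
    · rw [o2 a ha, o1]; exact hcur a ha
    · rw [o2 b hb, o1]
      exact fun hc => (hcur b hb (hsymm _ hz _ (h.ord_lt b hb) hc)).symm
  · intro x hx hl
    have hnc : ¬ close z x := fun hc => by rw [(hlink' x hx).1 hc] at hl; omega
    rw [(hlink' x hx).2 hnc] at hl
    exact hcase (fun a ha => by rw [o2 a ha]; exact h.link_zero x hx hl a ha) (by rwa [o1])
  · intro x hx hl
    by_cases hc : close z x
    · rw [(hlink' x hx).1 hc]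
      simp [o1, hc]
    · rw [(hlink' x hx).2 hc] at hl ⊢
      obtain ⟨h1, h2⟩ := h.link_pos x hx hl
      exact ⟨by omega, by rwa [o2 _ h1]⟩
  · refine hcase (fun a ha x hx hp hc => ?_) (fun _ _ _ _ => rfl)
    have hxz : x ≠ z := by rintro rfl; omega
    rw [p2 x hxz] at hp
    rw [o2 a ha] at hc
    have hlx : link x ≠ 0 := fun hl => h.link_zero x hx hl a ha hc
    have hlz : link z ≠ 0 := fun hl => hlx (hlink hl x hx hp)
    obtain ⟨h1, h2⟩ := h.link_pos z hz hlz
    rw [Nat.add_sub_cancel]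
    rw [c2 a ha, c1, if_neg hlz, h.current a ha x hx hp hc, h.current _ h1 z hz hpz h2]

theorem IsPartialForest.isForest (h : IsPartialForest N close N ord pos par comp link) :
    IsForest N close ord pos par comp where
  ord_lt := h.ord_lt
  pos_ord := h.pos_ord
  exists_ord x hx := by
    have hsub : (Finset.range N).image ord ⊆ Finset.range N := by
      intro y hy
      obtain ⟨a, ha, rfl⟩ := Finset.mem_image.1 hy
      exact Finset.mem_range.2 (h.ord_lt a (Finset.mem_range.1 ha))
    have hcard : ((Finset.range N).image ord).card = N := by
      rw [Finset.card_image_of_injOn, Finset.card_range]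
      intro a ha b hb he
      have h1 := h.pos_ord a (Finset.mem_range.1 ha)
      have h2 := h.pos_ord b (Finset.mem_range.1 hb)
      rw [he] at h1
      omega
    have := Finset.eq_of_subset_of_card_le hsub (by rw [hcard, Finset.card_range])
    have hx' : x ∈ (Finset.range N).image ord := by rw [this]; exact Finset.mem_range.2 hx
    obtain ⟨a, ha, he⟩ := Finset.mem_image.1 hx'
    exact ⟨a, Finset.mem_range.1 ha, he⟩
  par_le := h.par_le
  comp_par := h.comp_par
  comp_root := h.comp_root
  close_par := h.close_par
  comp_eq := h.comp_eq

/-! ### The spanning forest program -/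

namespace Code

/-- Add the point `FX` to the spanning forest. -/
def place : Code :=
  set ORD (reg LI) (reg FX) ⨾
  set POS (reg FX) (.add (reg LI) (.lit 1)) ⨾
  ite (.get LINK (reg FX))
    (set PAR (reg LI) (.sub (.get LINK (reg FX)) (.lit 1)) ⨾
      set COMP (reg LI) (.get COMP (.sub (.get LINK (reg FX)) (.lit 1))))
    (set PAR (reg LI) (reg LI) ⨾ set COMP (reg LI) (reg LI))

/-- Find a point that is to be added to the spanning forest. -/
def choose : Code :=
  find NUM FX LX skip (.not (.get POS (reg LX))) ⨾
  find NUM FX LX skip (.and (.not (.get POS (reg LX))) (.get LINK (reg LX)))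

/-- Record the points that are close to the point `FX`. -/
def relink : Code :=
  update NUM LINK LX skip (.distLe (reg FX) (reg LX) (reg THU) (reg THV)) (.add (reg LI) (.lit 1))

/-- Construct a spanning forest. -/
def forest : Code :=
  update NUM POS LX skip (.lit 1) (.lit 0) ⨾
  update NUM LINK LX skip (.lit 1) (.lit 0) ⨾
  loop LI NUM (choose ⨾ place ⨾ relink)

variable {D : Comparisons}

/-- The second search keeps the result of the first one if it fails. So a linked unplaced point is
preferred, and an arbitrary unplaced point is the fallback. -/
theorem run_choose (M : Mem) (hex : ∃ x < M NUM 0, M POS x = 0) :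
    choose.run D M FX 0 < M NUM 0 ∧ M POS (choose.run D M FX 0) = 0 ∧
      (M LINK (choose.run D M FX 0) = 0 → ∀ x < M NUM 0, M POS x = 0 → M LINK x = 0) := by
  rw [choose, run_seq]
  have hf := run_find (D := D) (r := NUM) (c := FX) (v := LX) (P := skip)
    (e := .not (.get POS (reg LX))) (M := M) (by decide) (fun x => M POS x = 0) (by
      intro i _ M' hM' hv
      simp [run_skip, Exp.holds_not, Exp.holds_get, Exp.eval, hv, hM' POS (by decide)])
  have hM1 := fun a (ha : a ∉ _) =>
    run_frame (D := D) (find NUM FX LX skip (.not (.get POS (reg LX)))) M (a := a) ha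
  set M1 := (find NUM FX LX skip (.not (.get POS (reg LX)))).run D M
  have hf' := run_find (D := D) (r := NUM) (c := FX) (v := LX) (P := skip)
    (e := .and (.not (.get POS (reg LX))) (.get LINK (reg LX))) (M := M1) (by decide)
    (fun x => M POS x = 0 ∧ M LINK x ≠ 0) (by
      intro i _ M' hM' hv
      simp [run_skip, Exp.holds_not, Exp.holds_and, Exp.holds_get, Exp.eval, hv, hM' POS (by decide),
        hM' LINK (by decide), hM1 POS (by decide), hM1 LINK (by decide)])
  rw [hM1 NUM (by decide)] at hf'
  rcases hf' with ⟨z, hz, ⟨h1, h2⟩, -, h3⟩ | ⟨hno, h3⟩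
  · rw [h3]
    exact ⟨hz, h1, fun h => absurd h h2⟩
  · obtain ⟨y, hy, hy0⟩ := hex
    rcases hf with ⟨z, hz, h1, -, h4⟩ | ⟨hno', -⟩
    · rw [h3, h4]
      refine ⟨hz, h1, fun _ x hx hx0 => ?_⟩
      by_contra hl
      exact hno x hx ⟨hx0, hl⟩
    · exact absurd hy0 (hno' y hy)

theorem run_place (M : Mem) :
    place.run D M ORD = Function.update (M ORD) (M LI 0) (M FX 0) ∧
    place.run D M POS = Function.update (M POS) (M FX 0) (M LI 0 + 1) ∧
    place.run D M PAR = Function.update (M PAR) (M LI 0)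
      (if M LINK (M FX 0) = 0 then M LI 0 else M LINK (M FX 0) - 1) ∧
    place.run D M COMP = Function.update (M COMP) (M LI 0)
      (if M LINK (M FX 0) = 0 then M LI 0 else M COMP (M LINK (M FX 0) - 1)) := by
  by_cases h : M LINK (M FX 0) = 0 <;>
    simp [place, run_seq, run_set, run_ite, Exp.holds_get, Exp.eval, Mem.write_self,
      Mem.write_of_ne, h]

theorem run_relink (M : Mem) (x : ℕ) (hx : x < M NUM 0) :
    (D (M FX 0) x (M THU 0) (M THV 0) → relink.run D M LINK x = M LI 0 + 1) ∧
    (¬ D (M FX 0) x (M THU 0) (M THV 0) → relink.run D M LINK x = M LINK x) := by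
  classical
  have h := run_update (D := D) (r := NUM) (a := LINK) (v := LX) (P := skip)
    (e := .distLe (reg FX) (reg LX) (reg THU) (reg THV)) (f := .add (reg LI) (.lit 1)) (M := M)
    (by decide) (fun x => D (M FX 0) x (M THU 0) (M THV 0)) (fun _ => M LI 0 + 1) (by
      intro i _ M' hM' hv _
      simp [run_skip, Exp.holds_distLe, Exp.eval, hv, hM' FX (by decide), hM' THU (by decide),
        hM' THV (by decide), hM' LI (by decide)]) x
  rw [relink, h]
  simp +contextual [hx]

theorem run_forest (M : Mem)
    (hsymm : ∀ x < M NUM 0, ∀ y < M NUM 0, D x y (M THU 0) (M THV 0) → D y x (M THU 0) (M THV 0)) :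
    IsForest (M NUM 0) (fun x y => D x y (M THU 0) (M THV 0)) (forest.run D M ORD)
      (forest.run D M POS) (forest.run D M PAR) (forest.run D M COMP) := by
  -- The program is run once for each threshold, so `POS` and `LINK` may contain remnants of an
  -- earlier run and have to be cleared.
  have hp : ∀ x < M NUM 0, (update NUM POS LX skip (.lit 1) (.lit 0)).run D M POS x = 0 := by
    intro x hx
    rw [run_update (D := D) (r := NUM) (a := POS) (v := LX) (P := skip) (by decide)
      (fun _ => True) (fun _ => 0) (by simp [run_skip, Exp.holds_lit, Exp.eval])]
    simp [hx]
  have hM1 := fun a (ha : a ∉ _) =>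
    run_frame (D := D) (update NUM POS LX skip (.lit 1) (.lit 0)) M (a := a) ha
  rw [forest, run_seq, run_seq]
  set M1 := (update NUM POS LX skip (.lit 1) (.lit 0)).run D M
  have hl : ∀ x < M NUM 0, (update NUM LINK LX skip (.lit 1) (.lit 0)).run D M1 LINK x = 0 := by
    intro x hx
    rw [run_update (D := D) (r := NUM) (a := LINK) (v := LX) (P := skip) (by decide)
      (fun _ => True) (fun _ => 0) (by simp [run_skip, Exp.holds_lit, Exp.eval])]
    simp [hx, hM1 NUM (by decide)]
  have hM2 := fun a (ha : a ∉ _) =>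
    run_frame (D := D) (update NUM LINK LX skip (.lit 1) (.lit 0)) M1 (a := a) ha
  set M2 := (update NUM LINK LX skip (.lit 1) (.lit 0)).run D M1
  have e1 : M2 NUM = M NUM := (hM2 NUM (by decide)).trans (hM1 NUM (by decide))
  have e2 : M2 POS = M1 POS := hM2 POS (by decide)
  have e3 : M2 THU = M THU := (hM2 THU (by decide)).trans (hM1 THU (by decide))
  have e4 : M2 THV = M THV := (hM2 THV (by decide)).trans (hM1 THV (by decide))
  clear_value M1 M2
  rw [← e2] at hp
  rw [← e1, ← e3, ← e4] at hsymm ⊢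
  rw [← e1] at hp hl
  clear e1 e2 e3 e4 hM1 hM2
  refine IsPartialForest.isForest (link := (loop LI NUM (choose ⨾ place ⨾ relink)).run D M2 LINK) ?_
  refine loop_induction (D := D) (v := LI) (r := NUM) (P := choose ⨾ place ⨾ relink) (M := M2)
    (fun i M' => IsPartialForest (M2 NUM 0) (fun x y => D x y (M2 THU 0) (M2 THV 0)) i
      (M' ORD) (M' POS) (M' PAR) (M' COMP) (M' LINK)) ?_ ?_
  · simp only [Mem.write_of_ne _ (show ORD ≠ LI by decide), Mem.write_of_ne _ (show POS ≠ LI by decide),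
      Mem.write_of_ne _ (show PAR ≠ LI by decide), Mem.write_of_ne _ (show COMP ≠ LI by decide),
      Mem.write_of_ne _ (show LINK ≠ LI by decide)]
    constructor <;> simp +contextual [hp, hl]
  · intro i hi M' hM' hv h
    simp only [Mem.write_of_ne _ (show ORD ≠ LI by decide), Mem.write_of_ne _ (show POS ≠ LI by decide),
      Mem.write_of_ne _ (show PAR ≠ LI by decide), Mem.write_of_ne _ (show COMP ≠ LI by decide),
      Mem.write_of_ne _ (show LINK ≠ LI by decide)]
    have n1 : M' NUM = M2 NUM := hM' NUM (by decide)
    have n2 : M' THU = M2 THU := hM' THU (by decide)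
    have n3 : M' THV = M2 THV := hM' THV (by decide)
    have hc := run_choose (D := D) M' (by rw [n1]; exact h.exists_pos_eq_zero hi)
    have hM3 := fun a (ha : a ∉ _) => run_frame (D := D) choose M' (a := a) ha
    simp only [run_seq]
    set M3 := choose.run D M'
    obtain ⟨p1, p2, p3, p4⟩ := run_place (D := D) M3
    have hM4 := fun a (ha : a ∉ _) => run_frame (D := D) place M3 (a := a) ha
    set M4 := place.run D M3
    have hr := run_relink (D := D) M4
    have hM5 := fun a (ha : a ∉ _) => run_frame (D := D) relink M4 (a := a) ha
    set M5 := relink.run D M4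
    clear_value M3 M4 M5
    rw [hM4 NUM (by decide), hM3 NUM (by decide), hM4 FX (by decide), hM4 THU (by decide),
      hM4 THV (by decide), hM3 THU (by decide), hM3 THV (by decide), hM4 LI (by decide),
      hM3 LI (by decide), hM4 LINK (by decide), hM3 LINK (by decide), n1, n2, n3, hv] at hr
    rw [hM5 ORD (by decide), hM5 POS (by decide), hM5 PAR (by decide), hM5 COMP (by decide)]
    rw [hM3 LI (by decide), hv] at p1 p2 p3 p4
    rw [hM3 LINK (by decide)] at p3 p4
    rw [hM3 ORD (by decide)] at p1
    rw [hM3 POS (by decide)] at p2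
    rw [hM3 PAR (by decide)] at p3
    rw [hM3 COMP (by decide)] at p4
    rw [n1] at hc
    exact h.step hsymm hc.1 hc.2.1 hc.2.2 p1 p2 p3 p4 hr

end Code
end KDBST

namespace KDBST

notation "TUP" => 1
notation "LR" => 18
notation "LT" => 19
notation "CA" => 20
notation "CB" => 21
notation "WRONG" => 22
notation "BAD" => 23
notation "SIZE" => 24

/-! ### Checking balance -/

namespace Code

variable {D : Comparisons}

/-- The tuple of a point given by its new number. -/
def _root_.KDBST.Exp.tup (e : Exp) : Exp := .get TUP (.get ORD e)

/-- Count in register `c` the points of component `LR` in tuple `t`. -/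
def countCell (c : ℕ) (t : Exp) : Code :=
  count NUM c LX skip (.and (.eq (.get COMP (reg LX)) (reg LR)) (.eq (reg LX).tup t))

/-- Count in `WRONG` the tuples which contain a wrong number of points of component `LR`. -/
def countViolations : Code :=
  count NUM WRONG LT (countCell CA (reg LT) ⨾ countCell CB (.lit 0))
    (.and (.lt (reg LT) (.get 0 (.lit 1))) (.not (.eq (reg CA) (reg CB))))

/-- Check whether the components have the same number of points in all tuples, and compute these
numbers. -/
def check : Code :=
  count NUM BAD LR countViolations (reg WRONG) ⨾
  update NUM SIZE LR (countCell CB (.lit 0)) (.lit 1) (reg CB)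

/-- The number of points of a component in a tuple. -/
def cell (N : ℕ) (comp T : ℕ → ℕ) (r t : ℕ) : ℕ :=
  ((Finset.range N).filter fun x => comp x = r ∧ T x = t).card

theorem run_countCell {c : ℕ} (hc : c = CA ∨ c = CB) (e : Exp) (M : Mem) (t : ℕ)
    (he : ∀ M' : Mem, (∀ a, a ≠ c → a ≠ LX → M' a = M a) → e.eval D M' = t) :
    (countCell c e).run D M c 0 =
      cell (M NUM 0) (M COMP) (fun x => M TUP (M ORD x)) (M LR 0) t := by
  rw [countCell, run_count (by rcases hc with rfl | rfl <;> decide)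
    (fun x => M COMP x = M LR 0 ∧ M TUP (M ORD x) = t)]
  · rfl
  · intro i _ M' hM' hv
    have h : ∀ a, a ≠ c → a ≠ LX → M' a = M a := fun a h1 h2 => hM' a (by
      simp [count, writes, h1, h2])
    simp only [run_skip, Exp.holds_and, Exp.holds_eq, Exp.eval, Exp.tup, hv, he M' h]
    rw [h COMP (by rcases hc with rfl | rfl <;> decide) (by decide),
      h LR (by rcases hc with rfl | rfl <;> decide) (by decide),
      h TUP (by rcases hc with rfl | rfl <;> decide) (by decide),
      h ORD (by rcases hc with rfl | rfl <;> decide) (by decide)]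

/-- Loops are bounded by the number of points only, which is why the candidate tuples `t` are
additionally tested against `n`, stored in cell `1` of array `0`. Every tuple is compared with tuple
`0`. -/
theorem run_countViolations (M : Mem) :
    countViolations.run D M WRONG 0 ≠ 0 ↔ ∃ t < M NUM 0, t < M 0 1 ∧
      cell (M NUM 0) (M COMP) (fun x => M TUP (M ORD x)) (M LR 0) t ≠
        cell (M NUM 0) (M COMP) (fun x => M TUP (M ORD x)) (M LR 0) 0 := by
  rw [countViolations, run_count (by decide) (fun t => t < M 0 1 ∧
      cell (M NUM 0) (M COMP) (fun x => M TUP (M ORD x)) (M LR 0) t ≠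
        cell (M NUM 0) (M COMP) (fun x => M TUP (M ORD x)) (M LR 0) 0)]
  · simp [Finset.card_eq_zero, Finset.filter_eq_empty_iff]
  · intro i _ M' hM' hv
    have h1 := run_countCell (D := D) (c := CA) (Or.inl rfl) (reg LT) M' i (by
      intro M'' hM''
      simp [Exp.eval, hM'' LT (by decide) (by decide), hv])
    have hM1 := fun a (ha : a ∉ _) => run_frame (D := D) (countCell CA (reg LT)) M' (a := a) ha
    rw [run_seq]
    set M1 := (countCell CA (reg LT)).run D M'
    have h2 := run_countCell (D := D) (c := CB) (Or.inr rfl) (.lit 0) M1 0 (by simp [Exp.eval])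
    have hM2 := fun a (ha : a ∉ _) => run_frame (D := D) (countCell CB (.lit 0)) M1 (a := a) ha
    set M2 := (countCell CB (.lit 0)).run D M1
    clear_value M1 M2
    simp only [hM1 NUM (by decide), hM1 COMP (by decide), hM1 TUP (by decide), hM1 ORD (by decide),
      hM1 LR (by decide)] at h2
    simp only [Exp.holds_and, Exp.holds_lt, Exp.holds_not, Exp.holds_eq, Exp.eval,
      hM2 LT (by decide), hM1 LT (by decide), hM2 0 (by decide), hM1 0 (by decide), hv,
      hM2 CA (by decide), h1, h2, hM' 0 (by decide), hM' NUM (by decide), hM' COMP (by decide),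
      hM' TUP (by decide), hM' ORD (by decide), hM' LR (by decide)]

theorem run_check (M : Mem) :
    (check.run D M BAD 0 = 0 ↔ ∀ r < M NUM 0, ∀ t < M NUM 0, t < M 0 1 →
      cell (M NUM 0) (M COMP) (fun x => M TUP (M ORD x)) r t =
        cell (M NUM 0) (M COMP) (fun x => M TUP (M ORD x)) r 0) ∧
    ∀ r < M NUM 0, check.run D M SIZE r =
      cell (M NUM 0) (M COMP) (fun x => M TUP (M ORD x)) r 0 := by
  rw [check, run_seq]
  have h1 := run_count (D := D) (r := NUM) (c := BAD) (v := LR) (P := countViolations)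
    (e := reg WRONG) (M := M) (by decide) (fun r => ∃ t < M NUM 0, t < M 0 1 ∧
      cell (M NUM 0) (M COMP) (fun x => M TUP (M ORD x)) r t ≠
        cell (M NUM 0) (M COMP) (fun x => M TUP (M ORD x)) r 0) (by
      intro i _ M' hM' hv
      rw [Exp.holds_get, Exp.eval, run_countViolations]
      simp only [hM' 0 (by decide), hM' NUM (by decide), hM' COMP (by decide), hv,
        hM' TUP (by decide), hM' ORD (by decide)])
  have hM1 := fun a (ha : a ∉ _) =>
    run_frame (D := D) (count NUM BAD LR countViolations (reg WRONG)) M (a := a) ha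
  set M1 := (count NUM BAD LR countViolations (reg WRONG)).run D M
  constructor
  · rw [run_frame _ _ (by decide), h1, Finset.card_eq_zero, Finset.filter_eq_empty_iff]
    simp
  · intro r hr
    rw [run_update (D := D) (r := NUM) (a := SIZE) (v := LR) (by decide) (fun _ => True)
      (fun r => cell (M NUM 0) (M COMP) (fun x => M TUP (M ORD x)) r 0)]
    · simp [hM1 NUM (by decide), hr]
    · intro i _ M' hM' hv _
      simp only [Exp.holds_lit, Exp.eval, ne_eq, one_ne_zero, not_false_eq_true, true_and,
        forall_const]
      rw [run_countCell (Or.inr rfl) (.lit 0) M' 0 (by simp [Exp.eval])]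
      simp only [hM' NUM (by decide), hM' COMP (by decide), hv, hM1 NUM (by decide),
        hM1 COMP (by decide), hM' TUP (by decide), hM' ORD (by decide), hM1 TUP (by decide),
        hM1 ORD (by decide)]

end Code
end KDBST

namespace KDBST

/-! ### Grouping the points of a tree -/

/-- `x` is a descendant of `v` with respect to the parent pointers `par`. -/
def Desc (par : ℕ → ℕ) (v x : ℕ) : Prop := ∃ m, par^[m] x = v

/-- A rooted forest on `0, …, N - 1`, with edges of length at most `l`, all of whose components
`r` consist of a multiple of `size r > 0` points. -/
structure IsMetricForest (N : ℕ) (par comp size : ℕ → ℕ) (δ : ℕ → ℕ → ℝ) (l : ℝ) : Prop where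
  par_le : ∀ i < N, par i ≤ i
  comp_par : ∀ i < N, comp (par i) = comp i
  comp_root : ∀ i < N, par i = i → comp i = i
  size_pos : ∀ i < N, 0 < size (comp i)
  size_dvd : ∀ i < N, size (comp i) ∣ ((Finset.range N).filter fun j => comp j = comp i).card
  dist_par : ∀ i < N, par i ≠ i → δ i (par i) ≤ l
  dist_comm : ∀ i j, δ i j = δ j i
  dist_self : ∀ i, δ i i = 0
  triangle : ∀ i < N, ∀ j < N, ∀ m < N, δ i m ≤ δ i j + δ j m
  nonneg : 0 ≤ l

/-- The number of ungrouped descendants of `v`. -/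
noncomputable def weight (N : ℕ) (par grp : ℕ → ℕ) (v : ℕ) : ℕ :=
  open Classical in ((Finset.range N).filter fun x => Desc par v x ∧ grp x = 0).card

/-- The state of the grouping after `s` steps; `grp x` is the number of the group of `x`, or `0`,
and `site g` is a point of the group to which group `g` is to be attached. -/
structure IsPartialGrouping (N : ℕ) (par comp size : ℕ → ℕ) (δ : ℕ → ℕ → ℝ) (l : ℝ) (s : ℕ)
    (grp site : ℕ → ℕ) : Prop where
  grp_le : ∀ x < N, grp x ≤ s
  grp_par : ∀ x < N, grp x = 0 → grp (par x) = 0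
  comp_eq : ∀ x < N, ∀ y < N, grp x ≠ 0 → grp x = grp y → comp x = comp y
  card : ∀ x < N, grp x ≠ 0 →
    ((Finset.range N).filter fun y => grp y = grp x).card = size (comp x)
  site_lt : ∀ x < N, grp x ≠ 0 → site (grp x) < N
  comp_site : ∀ x < N, grp x ≠ 0 → comp (site (grp x)) = comp x
  diam : ∀ x < N, ∀ y < N, grp x ≠ 0 → grp x = grp y → δ x y ≤ 2 * (size (comp x) - 1) * l
  dist_site : ∀ x < N, grp x ≠ 0 → δ x (site (grp x)) ≤ size (comp x) * l
  later : ∀ x < N, grp x ≠ 0 → grp (site (grp x)) = 0 ∨ grp x < grp (site (grp x)) ∨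
    grp x = grp (site (grp x)) ∧ grp x = grp (comp x)
  progress : (∀ x < N, grp x ≠ 0) ∨ s ≤ ((Finset.range N).filter fun x => grp x ≠ 0).card

/-- A division of a forest into groups. -/
structure IsGrouping (N : ℕ) (comp size : ℕ → ℕ) (δ : ℕ → ℕ → ℝ) (l : ℝ) (grp site : ℕ → ℕ) :
    Prop where
  comp_eq : ∀ x < N, ∀ y < N, grp x = grp y → comp x = comp y
  card : ∀ x < N, ((Finset.range N).filter fun y => grp y = grp x).card = size (comp x)
  site_lt : ∀ x < N, site (grp x) < N
  comp_site : ∀ x < N, comp (site (grp x)) = comp x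
  diam : ∀ x < N, ∀ y < N, grp x = grp y → δ x y ≤ 2 * (size (comp x) - 1) * l
  dist_site : ∀ x < N, δ x (site (grp x)) ≤ size (comp x) * l
  later : ∀ x < N, grp x < grp (site (grp x)) ∨
    grp x = grp (site (grp x)) ∧ grp x = grp (comp x)

/-- The new group `s + 1` consists of the last descendants of `v`. -/
structure IsExtension (N : ℕ) (par size comp : ℕ → ℕ) (s v : ℕ) (grp grp' : ℕ → ℕ) : Prop where
  grp_eq : ∀ x < N, grp' x = grp x ∨ grp' x = s + 1 ∧ Desc par v x ∧ grp x = 0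
  card : ((Finset.range N).filter fun x => grp' x = s + 1).card = size (comp v)
  order : ∀ x < N, Desc par v x → grp' x = 0 → ∀ y < N, grp' y = s + 1 → x < y

section

variable {N : ℕ} {par comp size : ℕ → ℕ} {δ : ℕ → ℕ → ℝ} {l : ℝ} {s : ℕ} {grp site : ℕ → ℕ}

theorem Desc.refl (par : ℕ → ℕ) (v : ℕ) : Desc par v v := ⟨0, rfl⟩

theorem Desc.of_par {v x : ℕ} (h : Desc par v (par x)) : Desc par v x := by
  obtain ⟨m, hm⟩ := h
  exact ⟨m + 1, by rwa [Function.iterate_succ_apply]⟩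

theorem Desc.to_par {v x : ℕ} (h : Desc par v x) : Desc par (par v) x := by
  obtain ⟨m, hm⟩ := h
  exact ⟨m + 1, by rw [Function.iterate_succ_apply', hm]⟩

/-- The recursion by which descendants are marked in one upward sweep: parents have smaller numbers,
and roots are their own parents. -/
theorem desc_iff {v x : ℕ} : Desc par v x ↔ x = v ∨ par x ≠ x ∧ Desc par v (par x) := by
  constructor
  · rintro ⟨m, hm⟩
    by_cases hx : par x = x
    · left
      rwa [Function.iterate_fixed hx] at hm
    · cases m with
      | zero => exact Or.inl hm
      | succ m => exact Or.inr ⟨hx, m, by rwa [Function.iterate_succ_apply] at hm⟩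
  · rintro (rfl | ⟨-, h⟩)
    exacts [Desc.refl _ _, h.of_par]

/-- Induction along the path from a descendant. -/
theorem Desc.rec_path {v : ℕ} {motive : ℕ → Prop} (h0 : motive v)
    (hs : ∀ x, x ≠ v → par x ≠ x → Desc par v (par x) → motive (par x) → motive x)
    {x : ℕ} (h : Desc par v x) : motive x := by
  obtain ⟨m, hm⟩ := h
  induction m generalizing x with
  | zero =>
    have hxv : x = v := hm
    exact hxv ▸ h0
  | succ m ih =>
    rw [Function.iterate_succ_apply] at hm
    by_cases hx : x = v
    · exact hx ▸ h0
    · by_cases hp : par x = x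
      · rw [hp] at hm
        exact ih hm
      · exact hs x hx hp ⟨m, hm⟩ (ih hm)

namespace IsMetricForest

variable (F : IsMetricForest N par comp size δ l)
include F

theorem par_lt {i : ℕ} (hi : i < N) : par i < N := (F.par_le i hi).trans_lt hi

theorem desc_le {v x : ℕ} (h : Desc par v x) (hx : x < N) : v ≤ x := by
  refine h.rec_path (motive := fun x => x < N → v ≤ x) (fun _ => le_rfl) ?_ hx
  intro x _ _ _ ih hx
  exact (ih (F.par_lt hx)).trans (F.par_le x hx)

theorem comp_desc {v x : ℕ} (h : Desc par v x) (hx : x < N) : comp x = comp v := by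
  refine h.rec_path (motive := fun x => x < N → comp x = comp v) (fun _ => rfl) ?_ hx
  intro x _ _ _ ih hx
  rw [← F.comp_par x hx, ih (F.par_lt hx)]

theorem desc_comp {x : ℕ} (hx : x < N) : Desc par (comp x) x := by
  induction x using Nat.strong_induction_on with
  | _ x ih =>
    by_cases hp : par x = x
    · rw [F.comp_root x hx hp]
      exact Desc.refl _ _
    · have := F.par_le x hx
      have := ih (par x) (by omega) (by omega)
      rw [F.comp_par x hx] at this
      exact this.of_par

theorem comp_lt {x : ℕ} (hx : x < N) : comp x < N := (F.desc_le (F.desc_comp hx) hx).trans_lt hx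

theorem comp_comp {x : ℕ} (hx : x < N) : comp (comp x) = comp x :=
  (F.comp_desc (F.desc_comp hx) hx).symm

end IsMetricForest

variable (F : IsMetricForest N par comp size δ l)
  (G : IsPartialGrouping N par comp size δ l s grp site)

include F G

namespace IsPartialGrouping

theorem grp_desc {v x : ℕ} (h : Desc par v x) (hx : x < N) (hg : grp x = 0) : grp v = 0 := by
  refine h.rec_path (motive := fun x => x < N → grp x = 0 → grp v = 0) (fun _ h => h) ?_ hx hg
  intro x _ _ _ ih hx hg
  exact ih (F.par_lt hx) (G.grp_par x hx hg)

omit F G in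
theorem weight_pos {x : ℕ} (hx : x < N) (hg : grp x = 0) : 0 < weight N par grp x := by
  classical
  exact Finset.card_pos.2 ⟨x, by simp [hx, hg, Desc.refl]⟩

theorem weight_lt {x : ℕ} (hx : x < N) (hg : grp x = 0) (hp : par x ≠ x) :
    weight N par grp x < weight N par grp (par x) := by
  classical
  refine Finset.card_lt_card (Finset.ssubset_iff_of_subset ?_ |>.2 ⟨par x, ?_, ?_⟩)
  · intro y hy
    simp only [Finset.mem_filter] at hy ⊢
    exact ⟨hy.1, hy.2.1.to_par, hy.2.2⟩
  · simp only [Finset.mem_filter, Finset.mem_range]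
    exact ⟨F.par_lt hx, Desc.refl _ _, G.grp_par x hx hg⟩
  · simp only [Finset.mem_filter, Finset.mem_range]
    rintro ⟨h1, h2, -⟩
    have := F.desc_le h2 h1
    have := F.par_le x hx
    omega

/-- Along the path from `x` up to `w` all points are ungrouped. Each step has length at most `l` and
increases the weight by at least one, since the parent counts itself (`weight_lt`). -/
theorem dist_le_weight {w x : ℕ} (h : Desc par w x) (hx : x < N) (hg : grp x = 0) :
    δ x w ≤ ((weight N par grp w : ℝ) - weight N par grp x) * l := by
  refine h.rec_path (motive := fun x => x < N → grp x = 0 →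
    δ x w ≤ ((weight N par grp w : ℝ) - weight N par grp x) * l) ?_ ?_ hx hg
  · intro _ _
    simp [F.dist_self]
  · intro x _ hp hd ih hx hg
    have hpx := F.par_lt hx
    have h1 := ih hpx (G.grp_par x hx hg)
    have h2 := F.triangle x hx (par x) hpx w ((F.desc_le hd hpx).trans_lt hpx)
    have h3 := F.dist_par x hx hp
    have h4 : (weight N par grp x : ℝ) + 1 ≤ weight N par grp (par x) := by
      exact_mod_cast weight_lt F G hx hg hp
    nlinarith [F.nonneg]

/-- The path from `x` to `v` passes through a child `w` of `v`. As `w > v`, it has weight at most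
`size - 1`, while `x` has weight at least `1`; so `x` is within `(size - 2) * l` of `w`, and the
edge from `w` to `v` adds `l`. -/
theorem dist_le_size {v x : ℕ} (hmax : ∀ w < N, v < w → weight N par grp w < size (comp w))
    (h : Desc par v x) (hx : x < N) (hg : grp x = 0) : δ x v ≤ (size (comp v) - 1) * l := by
  have hl := F.nonneg
  by_cases hxv : x = v
  · subst hxv
    rw [F.dist_self]
    have : (1 : ℝ) ≤ size (comp x) := by exact_mod_cast F.size_pos x hx
    exact mul_nonneg (by linarith) hl
  · have hchild : ∃ w, par w = v ∧ w ≠ v ∧ Desc par w x := by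
      refine h.rec_path (motive := fun x => x ≠ v → ∃ w, par w = v ∧ w ≠ v ∧ Desc par w x)
        (fun h => absurd rfl h) ?_ hxv
      intro x hxv hp hd ih _
      by_cases hpv : par x = v
      · exact ⟨x, hpv, hxv, Desc.refl _ _⟩
      · obtain ⟨w, h1, h2, h3⟩ := ih hpv
        exact ⟨w, h1, h2, h3.of_par⟩
    obtain ⟨w, hw, hwv, hd⟩ := hchild
    have hwN : w < N := (F.desc_le hd hx).trans_lt hx
    have hvN : v < N := hw ▸ F.par_lt hwN
    have h1 := dist_le_weight F G hd hx hg
    have h2 := F.triangle x hx w hwN v hvN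
    have h3 := F.dist_par w hwN (by rw [hw]; exact hwv.symm)
    rw [hw] at h3
    have hvw : v < w := lt_of_le_of_ne (hw ▸ F.par_le w hwN) hwv.symm
    have hc : comp w = comp v := by rw [← hw, F.comp_par w hwN]
    have h4 : (weight N par grp w : ℝ) + 1 ≤ size (comp v) := by
      rw [← hc]
      exact_mod_cast hmax w hwN hvw
    have h5 : (1 : ℝ) ≤ weight N par grp x := by exact_mod_cast weight_pos hx hg
    nlinarith

/-- Taking the last descendants of `v` keeps the ungrouped points closed under passing to the
parent. As `v` precedes all its other descendants, it stays ungrouped if any of them does, and is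
then the site. Otherwise the site is its parent, which is still ungrouped unless `v` is a root; in
that case the new group contains the root and is attached to itself. -/
theorem extend {v : ℕ} (hv : v < N) (hw : size (comp v) ≤ weight N par grp v)
    (hmax : ∀ w < N, v < w → weight N par grp w < size (comp w)) {grp' site' : ℕ → ℕ}
    (E : IsExtension N par size comp s v grp grp')
    (hsite : site' = Function.update site (s + 1) (if grp' v = 0 then v else par v)) :
    IsPartialGrouping N par comp size δ l (s + 1) grp' site' := by
  classical
  have hl := F.nonneg
  have hgv : grp v = 0 := by
    obtain ⟨x, hx⟩ := Finset.card_pos.1 ((F.size_pos v hv).trans_le hw)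
    simp only [Finset.mem_filter, Finset.mem_range] at hx
    exact grp_desc F G hx.2.1 hx.1 hx.2.2
  have hnew : ∀ x < N, grp' x = s + 1 → Desc par v x ∧ grp x = 0 := by
    intro x hx h
    rcases E.grp_eq x hx with h' | h'
    · have := G.grp_le x hx
      omega
    · exact h'.2
  have hold : ∀ x < N, grp' x ≠ s + 1 → grp' x = grp x := fun x hx h =>
    (E.grp_eq x hx).resolve_right fun h' => h h'.1
  have hkeep : ∀ x < N, grp x ≠ 0 → grp' x = grp x := fun x hx h =>
    (E.grp_eq x hx).resolve_right fun h' => h h'.2.2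
  have hzero : ∀ x < N, grp' x = 0 → grp x = 0 := fun x hx h => by
    rw [← hold x hx (by omega), h]
  have hcomp : ∀ x < N, grp' x = s + 1 → comp x = comp v := fun x hx h =>
    F.comp_desc (hnew x hx h).1 hx
  have hdist : ∀ x < N, grp' x = s + 1 → δ x v ≤ (size (comp v) - 1) * l := fun x hx h =>
    dist_le_size F G hmax (hnew x hx h).1 hx (hnew x hx h).2
  have s1 : site' (s + 1) = if grp' v = 0 then v else par v := by simp [hsite]
  have s2 : ∀ x < N, site' (grp x) = site (grp x) := fun x hx => by
    have := G.grp_le x hx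
    rw [hsite, Function.update_of_ne (by omega)]
  have hpv := F.par_lt hv
  constructor
  · intro x hx
    have := G.grp_le x hx
    rcases E.grp_eq x hx with h | h <;> omega
  · intro x hx h
    have h1 := G.grp_par x hx (hzero x hx h)
    rcases E.grp_eq (par x) (F.par_lt hx) with h2 | h2
    · rw [h2, h1]
    -- If the parent of a remaining point `x` were taken, then `x`, also a descendant of `v`, would
    -- have to precede its parent.
    · have := E.order x hx h2.2.1.of_par h (par x) (F.par_lt hx) h2.1
      have := F.par_le x hx
      omega
  · intro x hx y hy h0 h
    by_cases hs : grp' x = s + 1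
    · rw [hcomp x hx hs, hcomp y hy (h ▸ hs)]
    · have h1 := hold x hx hs
      have h2 := hold y hy (h ▸ hs)
      exact G.comp_eq x hx y hy (by rwa [← h1]) (by rw [← h1, ← h2, h])
  · intro x hx h0
    by_cases hs : grp' x = s + 1
    · rw [hs, E.card, hcomp x hx hs]
    · have h1 := hold x hx hs
      rw [h1] at h0 hs
      rw [← G.card x hx h0, h1]
      congr 1
      refine Finset.filter_congr fun y hy => ?_
      rcases E.grp_eq y (Finset.mem_range.1 hy) with h | h
      · rw [h]
      · rw [h.1, h.2.2]
        exact iff_of_false (Ne.symm hs) (Ne.symm h0)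
  · intro x hx h0
    by_cases hs : grp' x = s + 1
    · rw [hs, s1]
      split_ifs <;> assumption
    · have h1 := hold x hx hs
      rw [h1] at h0
      rw [h1, s2 x hx]
      exact G.site_lt x hx h0
  · intro x hx h0
    by_cases hs : grp' x = s + 1
    · rw [hs, s1, hcomp x hx hs]
      split_ifs
      · rfl
      · exact F.comp_par v hv
    · have h1 := hold x hx hs
      rw [h1] at h0
      rw [h1, s2 x hx]
      exact G.comp_site x hx h0
  · intro x hx y hy h0 h
    by_cases hs : grp' x = s + 1
    · have h1 := hdist x hx hs
      have h2 := hdist y hy (h ▸ hs)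
      have h3 := F.triangle x hx v hv y hy
      rw [F.dist_comm v y] at h3
      rw [hcomp x hx hs]
      linarith
    · have h1 := hold x hx hs
      have h2 := hold y hy (h ▸ hs)
      exact G.diam x hx y hy (by rwa [← h1]) (by rw [← h1, ← h2, h])
  · intro x hx h0
    by_cases hs : grp' x = s + 1
    · have h1 := hdist x hx hs
      rw [hs, s1, hcomp x hx hs]
      split_ifs
      · linarith
      · have h2 := F.triangle x hx v hv (par v) hpv
        by_cases hp : par v = v
        · rw [hp]
          linarith
        · have h3 := F.dist_par v hv hp
          linarith
    · have h1 := hold x hx hs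
      rw [h1] at h0
      rw [h1, s2 x hx]
      exact G.dist_site x hx h0
  · intro x hx h0
    by_cases hs : grp' x = s + 1
    · rw [hs, s1, hcomp x hx hs]
      split_ifs with h
      · exact Or.inl h
      · have hvs : grp' v = s + 1 := by
          by_contra h'
          exact h ((hold v hv h').trans hgv)
        by_cases hp : par v = v
        · right; right
          rw [hp, hvs, F.comp_root v hv hp, hvs]
          exact ⟨rfl, rfl⟩
        · left
          rcases E.grp_eq _ hpv with h1 | h1
          · rw [h1]
            exact G.grp_par v hv hgv
          -- The proper parent of `v` has a smaller number than `v`, so it is not a descendant of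
          -- `v` and cannot belong to the new group.
          · have := F.desc_le h1.2.1 hpv
            have := F.par_le v hv
            omega
    · have h1 := hold x hx hs
      rw [h1] at h0
      rw [h1, s2 x hx]
      have hsl := G.site_lt x hx h0
      rcases G.later x hx h0 with h2 | h2 | h2
      · rcases E.grp_eq _ hsl with h3 | h3
        · left
          rw [h3, h2]
        · right; left
          have := G.grp_le x hx
          omega
      · right; left
        rwa [hkeep _ hsl (by omega)]
      · right; right
        rw [hkeep _ hsl (by omega), hkeep _ (F.comp_lt hx) (by omega)]
        exact h2
  · right
    have hlt : s ≤ ((Finset.range N).filter fun x => grp x ≠ 0).card :=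
      G.progress.resolve_left fun h => h v hv hgv
    refine Nat.succ_le_of_lt (hlt.trans_lt (Finset.card_lt_card ?_))
    have hpos : 0 < ((Finset.range N).filter fun x => grp' x = s + 1).card := by
      rw [E.card]
      exact F.size_pos v hv
    obtain ⟨y, hy⟩ := Finset.card_pos.1 hpos
    simp only [Finset.mem_filter, Finset.mem_range] at hy
    refine (Finset.ssubset_iff_of_subset ?_).2 ⟨y, ?_, ?_⟩
    · intro x hx
      simp only [Finset.mem_filter, Finset.mem_range] at hx ⊢
      exact ⟨hx.1, by rw [hkeep x hx.1 hx.2]; exact hx.2⟩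
    · simp [hy]
    · simp [hnew y hy.1 hy.2]

/-- The component has a multiple of `size` points, and so do its groups together; hence the number
of ungrouped points, which is the weight of the root, is a multiple of `size`. Being less than
`size`, it is zero. -/
theorem all_grouped (h : ∀ v < N, weight N par grp v < size (comp v)) : ∀ x < N, grp x ≠ 0 := by
  classical
  intro x hx hg
  have hr := F.comp_lt hx
  have hcc := F.comp_comp hx
  have hdesc : ∀ y < N, (Desc par (comp x) y ↔ comp y = comp x) := by
    intro y hy
    constructor
    · intro hd
      rw [F.comp_desc hd hy, hcc]
    · intro hc
      rw [← hc]
      exact F.desc_comp hy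
  set A := (Finset.range N).filter fun y => comp y = comp x with hA
  have h1 : (A.filter fun y => grp y = 0).card = weight N par grp (comp x) := by
    rw [weight, hA, Finset.filter_filter]
    congr 1
    refine Finset.filter_congr fun y hy => ?_
    rw [hdesc y (Finset.mem_range.1 hy)]
  have h2 : size (comp x) ∣ (A.filter fun y => ¬ grp y = 0).card := by
    rw [Finset.card_eq_sum_card_image grp]
    refine Finset.dvd_sum fun g hgi => ?_
    obtain ⟨y, hy, rfl⟩ := Finset.mem_image.1 hgi
    simp only [hA, Finset.mem_filter, Finset.mem_range] at hy
    rw [← hy.1.2, ← G.card y hy.1.1 hy.2, hA, Finset.filter_filter, Finset.filter_filter]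
    refine dvd_of_eq ?_
    congr 1
    refine Finset.filter_congr fun z hz => ?_
    constructor
    · intro hz'
      exact ⟨(G.comp_eq y hy.1.1 z (Finset.mem_range.1 hz) hy.2 hz'.symm).symm.trans hy.1.2,
        by rw [hz']; exact hy.2, hz'⟩
    · exact fun hz' => hz'.2.2
  have h3 := Finset.card_filter_add_card_filter_not (s := A) (fun y => grp y = 0)
  have h4 : size (comp x) ∣ (A.filter fun y => grp y = 0).card :=
    (Nat.dvd_add_left h2).1 (h3 ▸ F.size_dvd x hx)
  rw [h1] at h4
  have h5 : 0 < weight N par grp (comp x) :=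
    weight_pos hr (grp_desc F G (F.desc_comp hx) hx hg)
  have h6 := Nat.le_of_dvd h5 h4
  have h7 := h _ hr
  rw [hcc] at h7
  omega

omit F in
theorem idle (h : ∀ x < N, grp x ≠ 0) : IsPartialGrouping N par comp size δ l (s + 1) grp site :=
  { G with
    grp_le := fun x hx => (G.grp_le x hx).trans (Nat.le_succ s)
    progress := Or.inl h }

omit F in
theorem isGrouping (hs : s = N) : IsGrouping N comp size δ l grp site := by
  have hall : ∀ x < N, grp x ≠ 0 := by
    rcases G.progress with h | h
    · exact h
    · intro x hx hg
      have : (Finset.range N).filter (fun x => grp x ≠ 0) ⊂ Finset.range N :=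
        (Finset.ssubset_iff_of_subset (Finset.filter_subset _ _)).2
          ⟨x, Finset.mem_range.2 hx, by simp [hg]⟩
      have := Finset.card_lt_card this
      rw [Finset.card_range] at this
      omega
  exact
    { comp_eq := fun x hx y hy h => G.comp_eq x hx y hy (hall x hx) h
      card := fun x hx => G.card x hx (hall x hx)
      site_lt := fun x hx => G.site_lt x hx (hall x hx)
      comp_site := fun x hx => G.comp_site x hx (hall x hx)
      diam := fun x hx y hy h => G.diam x hx y hy (hall x hx) h
      dist_site := fun x hx => G.dist_site x hx (hall x hx)
      later := fun x hx => (G.later x hx (hall x hx)).resolve_left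
        (hall _ (G.site_lt x hx (hall x hx))) }

end IsPartialGrouping

end
end KDBST

/-! ### The grouping program -/

namespace KDBST

notation "LS" => 25
notation "LW" => 26
notation "MARK" => 27
notation "CNT" => 28
notation "BEST" => 29
notation "GRP" => 30
notation "SITE" => 31

namespace Code

variable {D : Comparisons}

/-- Mark the descendants of the point in register `v`. -/
def subtree (v : ℕ) : Code :=
  update NUM MARK LX skip (.lit 1) (.not (.not (.or (.eq (reg LX) (reg v))
    (.and (.lt (.get PAR (reg LX)) (reg LX)) (.get MARK (.get PAR (reg LX)))))))

/-- Find the last point with sufficiently many ungrouped descendants. -/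
def weigh : Code :=
  find NUM BEST LW
    (subtree LW ⨾ count NUM CNT LX skip (.and (.get MARK (reg LX)) (.not (.get GRP (reg LX)))))
    (.not (.lt (reg CNT) (.get SIZE (.get COMP (reg LW)))))

/-- The points in reverse order. -/
def _root_.KDBST.Exp.back : Exp := .sub (.sub (reg NUM) (.lit 1)) (reg LX)

/-- Put the last `CNT` marked ungrouped points into group `LS + 1`. -/
def take : Code :=
  loop LX NUM (ite (.and (reg CNT) (.and (.get MARK .back) (.not (.get GRP .back))))
    (set GRP .back (.add (reg LS) (.lit 1)) ⨾ assign CNT (.sub (reg CNT) (.lit 1))) skip)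

/-- Record the point to whose group the new group is to be attached. -/
def attach : Code :=
  ite (.get GRP (reg BEST)) (set SITE (.add (reg LS) (.lit 1)) (.get PAR (reg BEST)))
    (set SITE (.add (reg LS) (.lit 1)) (reg BEST))

/-- Form a group, if possible. -/
def formGroup : Code :=
  assign BEST (reg NUM) ⨾ weigh ⨾
  ite (.lt (reg BEST) (reg NUM))
    (subtree BEST ⨾ assign CNT (.get SIZE (.get COMP (reg BEST))) ⨾ take ⨾ attach) skip

/-- Divide the points into groups. -/
def groups : Code :=
  update NUM GRP LX skip (.lit 1) (.lit 0) ⨾ loop LS NUM formGroup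

-- A single sweep in increasing order suffices, because the mark of the parent has been computed
-- before it is consulted. The double negation in `subtree` normalises the stored truth values to
-- `0` and `1`.
open Classical in
theorem run_subtree {v : ℕ} (hv : v = LW ∨ v = BEST) (M : Mem)
    (hpar : ∀ x < M NUM 0, M PAR x ≤ x) (x : ℕ) (hx : x < M NUM 0) :
    (subtree v).run D M MARK x = if Desc (M PAR) (M v 0) x then 1 else 0 := by
  rw [subtree, run_update (by decide) (fun _ => True)
    (fun x => if Desc (M PAR) (M v 0) x then 1 else 0)]
  · simp [hx]
  · intro i hi M' hM' hv' hmark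
    refine ⟨by simp [Exp.holds_lit], fun _ => ?_⟩
    have hMv : M' v = M v := hM' v (by rcases hv with rfl | rfl <;> decide)
    have hMP : M' PAR = M PAR := hM' PAR (by simp [update, writes])
    have hp := hpar i hi
    have hd : Desc (M PAR) (M v 0) i ↔
        i = M v 0 ∨ M PAR i < i ∧ Desc (M PAR) (M v 0) (M PAR i) := by
      rw [desc_iff, lt_iff_le_and_ne]
      simp [hp]
    rw [run_skip, Exp.eval_not]
    simp only [Exp.holds_not, Exp.holds_or, Exp.holds_eq, Exp.holds_and, Exp.holds_lt,
      Exp.holds_get, Exp.eval, hv', hMP, hMv, hmark, hd]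
    by_cases h1 : i = M v 0
    · simp [h1]
    · by_cases h2 : M PAR i < i
      · by_cases h3 : Desc (M PAR) (M v 0) (M PAR i) <;> simp [h1, h2, h3]
      · simp [h1, h2]

theorem run_weigh (M : Mem) (hpar : ∀ x < M NUM 0, M PAR x ≤ x) :
    (∃ v < M NUM 0, M SIZE (M COMP v) ≤ weight (M NUM 0) (M PAR) (M GRP) v ∧
      (∀ w < M NUM 0, M SIZE (M COMP w) ≤ weight (M NUM 0) (M PAR) (M GRP) w → w ≤ v) ∧
        weigh.run D M BEST 0 = v) ∨
    (∀ v < M NUM 0, ¬ M SIZE (M COMP v) ≤ weight (M NUM 0) (M PAR) (M GRP) v) ∧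
      weigh.run D M BEST 0 = M BEST 0 := by
  classical
  refine run_find (by decide)
    (fun v => M SIZE (M COMP v) ≤ weight (M NUM 0) (M PAR) (M GRP) v) ?_
  intro i _ M' hM' hv
  have h1 := run_subtree (D := D) (v := LW) (Or.inl rfl) M'
  have hM1 := fun a (ha : a ∉ _) => run_frame (D := D) (subtree LW) M' (a := a) ha
  rw [run_seq]
  set M1 := (subtree LW).run D M'
  rw [hM' NUM (by decide), hM' PAR (by decide), hv] at h1
  have h2 := run_count (D := D) (r := NUM) (c := CNT) (v := LX) (P := skip)
    (e := .and (.get MARK (reg LX)) (.not (.get GRP (reg LX)))) (M := M1) (by decide)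
    (fun x => Desc (M PAR) i x ∧ M GRP x = 0) (by
      intro x hx M'' hM'' hv'
      rw [hM1 NUM (by decide), hM' NUM (by decide)] at hx
      simp [run_skip, Exp.holds_and, Exp.holds_not, Exp.holds_get, Exp.eval, hv',
        hM'' MARK (by decide), hM'' GRP (by decide), h1 hpar x hx, hM1 GRP (by decide),
        hM' GRP (by decide)])
  have hM2 := fun a (ha : a ∉ _) => run_frame (D := D) (count NUM CNT LX skip
    (.and (.get MARK (reg LX)) (.not (.get GRP (reg LX))))) M1 (a := a) ha
  simp only [Exp.holds_not, Exp.holds_lt, Exp.eval, h2, hM2 SIZE (by decide),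
    hM2 COMP (by decide), hM2 LW (by decide), hM1 SIZE (by decide), hM1 COMP (by decide),
    hM1 LW (by decide), hv, hM1 NUM (by decide), hM' NUM (by decide), hM' SIZE (by decide),
    hM' COMP (by decide), not_lt]
  exact Iff.rfl

/-- The scan runs from the highest number downwards and skips an eligible point only when the
counter is exhausted, so the points taken come after all eligible points that remain. -/
theorem run_take {M : Mem} {v : ℕ}
    (hmark : ∀ x < M NUM 0, M MARK x ≠ 0 ↔ Desc (M PAR) v x)
    (hle : ∀ x < M NUM 0, M GRP x ≤ M LS 0)
    (hcnt : M CNT 0 = M SIZE (M COMP v))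
    (hw : M SIZE (M COMP v) ≤ weight (M NUM 0) (M PAR) (M GRP) v) :
    IsExtension (M NUM 0) (M PAR) (M SIZE) (M COMP) (M LS 0) v (M GRP) (take.run D M GRP) := by
  classical
  have key := loop_induction (D := D) (v := LX) (r := NUM)
    (P := ite (.and (reg CNT) (.and (.get MARK .back) (.not (.get GRP .back))))
      (set GRP .back (.add (reg LS) (.lit 1)) ⨾ assign CNT (.sub (reg CNT) (.lit 1))) skip) (M := M)
    (fun i M' =>
      (∀ x < M NUM 0, M' GRP x = M GRP x ∨
        M NUM 0 ≤ x + i ∧ M' GRP x = M LS 0 + 1 ∧ Desc (M PAR) v x ∧ M GRP x = 0) ∧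
      ((Finset.range (M NUM 0)).filter fun x => M' GRP x = M LS 0 + 1).card + M' CNT 0 =
        M SIZE (M COMP v) ∧
      (M' CNT 0 ≠ 0 → ∀ x < M NUM 0, M NUM 0 ≤ x + i → Desc (M PAR) v x → M GRP x = 0 →
        M' GRP x = M LS 0 + 1) ∧
      (∀ x < M NUM 0, Desc (M PAR) v x → M' GRP x = 0 →
        ∀ y < M NUM 0, M' GRP y = M LS 0 + 1 → x < y)) ?_ ?_
  · obtain ⟨h1, h2, h3, h4⟩ := key
    refine ⟨fun x hx => (h1 x hx).imp_right And.right, ?_, h4⟩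
    -- With a nonzero counter at the end, all eligible points were taken, at least `size` of them by
    -- `hw`; so the count is exact in this case too.
    by_cases hc : (take.run D M) CNT 0 = 0
    · rw [take] at hc
      rw [hc] at h2
      exact h2
    · refine le_antisymm (by rw [← h2]; exact Nat.le_add_right _ _) (hw.trans ?_)
      refine Finset.card_le_card fun x hx => ?_
      simp only [Finset.mem_filter, Finset.mem_range] at hx ⊢
      exact ⟨hx.1, h3 hc x hx.1 (by omega) hx.2.1 hx.2.2⟩
  · simp only [Mem.write_of_ne _ (show GRP ≠ LX by decide),
      Mem.write_of_ne _ (show CNT ≠ LX by decide), add_zero, hcnt]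
    have h0 : ∀ x < M NUM 0, M GRP x ≠ M LS 0 + 1 := fun x hx => by
      have := hle x hx
      omega
    refine ⟨fun x _ => by simp, ?_, fun _ x hx h => by omega, fun x _ _ _ y hy h =>
      absurd h (h0 y hy)⟩
    rw [Finset.filter_eq_empty_iff.2 fun x hx => h0 x (Finset.mem_range.1 hx)]
    simp
  · rintro i hi M' hM' hv ⟨h1, h2, h3, h4⟩
    simp only [Mem.write_of_ne _ (show GRP ≠ LX by decide),
      Mem.write_of_ne _ (show CNT ≠ LX by decide)]
    obtain ⟨z, hz, hzi⟩ : ∃ z < M NUM 0, z = M NUM 0 - 1 - i := ⟨_, by omega, rfl⟩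
    have hback : Exp.back.eval D M' = z := by
      simp [Exp.back, Exp.eval, hv, hM' NUM (by decide), hzi]
    have hzg : M' GRP z = M GRP z := (h1 z hz).resolve_right fun h => by omega
    have hcond : (Exp.and (reg CNT) (.and (.get MARK .back) (.not (.get GRP .back)))).Holds D M' ↔
        M' CNT 0 ≠ 0 ∧ Desc (M PAR) v z ∧ M GRP z = 0 := by
      simp only [Exp.holds_and, Exp.holds_not, Exp.holds_get, hback, Exp.eval,
        hM' MARK (by decide), hmark z hz, hzg, not_not, ne_eq]
    rw [run_ite]
    by_cases hc : (Exp.and (reg CNT) (.and (.get MARK .back) (.not (.get GRP .back)))).Holds D M'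
    · rw [if_pos hc]
      obtain ⟨c1, c2, c3⟩ := hcond.1 hc
      have g1 : ((set GRP .back (.add (reg LS) (.lit 1)) ⨾
          assign CNT (.sub (reg CNT) (.lit 1))).run D M') GRP =
            Function.update (M' GRP) z (M LS 0 + 1) := by
        simp [run_seq, run_set, Mem.write_self, Mem.write_of_ne, hback, Exp.eval,
          hM' LS (by decide)]
      have g2 : ((set GRP .back (.add (reg LS) (.lit 1)) ⨾
          assign CNT (.sub (reg CNT) (.lit 1))).run D M') CNT 0 = M' CNT 0 - 1 := by
        simp [run_seq, run_set, Mem.write_self, Mem.write_of_ne, Exp.eval]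
      rw [g1, g2]
      have hfilter : ((Finset.range (M NUM 0)).filter
          fun x => Function.update (M' GRP) z (M LS 0 + 1) x = M LS 0 + 1) =
          insert z ((Finset.range (M NUM 0)).filter fun x => M' GRP x = M LS 0 + 1) := by
        ext x
        simp only [Finset.mem_filter, Finset.mem_range, Finset.mem_insert, Function.update_apply]
        split_ifs with hxz
        · simp [hxz, hz]
        · simp [hxz]
      refine ⟨fun x hx => ?_, ?_, fun hc' x hx hxi hd hg => ?_, fun x hx hd hx0 y hy hys => ?_⟩
      · by_cases hxz : x = z
        · subst hxz
          exact Or.inr ⟨by omega, by simp, c2, c3⟩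
        · rw [Function.update_of_ne hxz]
          exact (h1 x hx).imp_right fun h => ⟨by omega, h.2⟩
      · rw [hfilter, Finset.card_insert_of_notMem (by simp [hzg, c3])]
        omega
      · by_cases hxz : x = z
        · simp [hxz]
        · rw [Function.update_of_ne hxz]
          exact h3 c1 x hx (by omega) hd hg
      · by_cases hxz : x = z
        · subst hxz
          simp at hx0
        · rw [Function.update_of_ne hxz] at hx0
          by_cases hyz : y = z
          · by_contra hlt
            have hgx : M GRP x = 0 := by
              rcases h1 x hx with h | h
              · rw [← h, hx0]
              · exact h.2.2.2
            have := h3 c1 x hx (by omega) hd hgx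
            omega
          · rw [Function.update_of_ne hyz] at hys
            exact h4 x hx hd hx0 y hy hys
    · rw [if_neg hc, run_skip]
      refine ⟨fun x hx => (h1 x hx).imp_right fun h => ⟨by omega, h.2⟩, h2, ?_, h4⟩
      intro c1 x hx hxi hd hg
      by_cases hxz : x = z
      · subst hxz
        exact absurd (hcond.2 ⟨c1, hd, hg⟩) hc
      · exact h3 c1 x hx (by omega) hd hg

theorem run_attach (M : Mem) : attach.run D M SITE = Function.update (M SITE) (M LS 0 + 1)
    (if M GRP (M BEST 0) = 0 then M BEST 0 else M PAR (M BEST 0)) := by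
  by_cases h : M GRP (M BEST 0) = 0 <;>
    simp [attach, run_set, run_ite, Exp.holds_get, Exp.eval, Mem.write_self, h]

/-- `BEST` is preset to the number of points, which is not the number of a point, to signal a
failing search. Since the search returns the largest heavy vertex, all later vertices are light, as
`extend` requires; if it fails, all points are already grouped. -/
theorem run_formGroup {M : Mem} {δ : ℕ → ℕ → ℝ} {l : ℝ}
    (F : IsMetricForest (M NUM 0) (M PAR) (M COMP) (M SIZE) δ l)
    (G : IsPartialGrouping (M NUM 0) (M PAR) (M COMP) (M SIZE) δ l (M LS 0) (M GRP) (M SITE)) :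
    IsPartialGrouping (M NUM 0) (M PAR) (M COMP) (M SIZE) δ l (M LS 0 + 1)
      (formGroup.run D M GRP) (formGroup.run D M SITE) := by
  have hb : (assign BEST (reg NUM)).run D M BEST 0 = M NUM 0 := by
    simp [run_set, Mem.write_self, Exp.eval]
  have hM1 := fun a (ha : a ∉ _) => run_frame (D := D) (assign BEST (reg NUM)) M (a := a) ha
  rw [formGroup, run_seq, run_seq]
  set M1 := (assign BEST (reg NUM)).run D M
  have hwe := run_weigh (D := D) M1
  have hM2 := fun a (ha : a ∉ _) => (run_frame (D := D) weigh M1 (a := a) ha)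
  set M2 := weigh.run D M1
  rw [hb, hM1 NUM (by decide), hM1 PAR (by decide), hM1 SIZE (by decide), hM1 COMP (by decide),
    hM1 GRP (by decide)] at hwe
  have e1 : M2 NUM = M NUM := (hM2 NUM (by decide)).trans (hM1 NUM (by decide))
  have e2 : M2 PAR = M PAR := (hM2 PAR (by decide)).trans (hM1 PAR (by decide))
  have e3 : M2 COMP = M COMP := (hM2 COMP (by decide)).trans (hM1 COMP (by decide))
  have e4 : M2 SIZE = M SIZE := (hM2 SIZE (by decide)).trans (hM1 SIZE (by decide))
  have e5 : M2 GRP = M GRP := (hM2 GRP (by decide)).trans (hM1 GRP (by decide))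
  have e6 : M2 SITE = M SITE := (hM2 SITE (by decide)).trans (hM1 SITE (by decide))
  have e7 : M2 LS = M LS := (hM2 LS (by decide)).trans (hM1 LS (by decide))
  clear_value M1 M2
  rw [run_ite]
  rcases hwe F.par_le with ⟨v, hv, hvw, hmax, hbest⟩ | ⟨hno, hbest⟩
  · rw [if_pos (by simp [Exp.holds_lt, Exp.eval, hbest, e1, hv])]
    have hst := run_subtree (D := D) (v := BEST) (Or.inr rfl) M2
    have hM3 := fun a (ha : a ∉ _) => run_frame (D := D) (subtree BEST) M2 (a := a) ha
    simp only [run_seq]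
    set M3 := (subtree BEST).run D M2
    have hcn : (assign CNT (.get SIZE (.get COMP (reg BEST)))).run D M3 CNT 0 =
        M3 SIZE (M3 COMP (M3 BEST 0)) := by
      simp [run_set, Mem.write_self, Exp.eval]
    have hM4 := fun a (ha : a ∉ _) =>
      run_frame (D := D) (assign CNT (.get SIZE (.get COMP (reg BEST)))) M3 (a := a) ha
    set M4 := (assign CNT (.get SIZE (.get COMP (reg BEST)))).run D M3
    have f1 : M4 NUM = M NUM := (hM4 _ (by decide)).trans ((hM3 _ (by decide)).trans e1)
    have f2 : M4 PAR = M PAR := (hM4 _ (by decide)).trans ((hM3 _ (by decide)).trans e2)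
    have f3 : M4 COMP = M COMP := (hM4 _ (by decide)).trans ((hM3 _ (by decide)).trans e3)
    have f4 : M4 SIZE = M SIZE := (hM4 _ (by decide)).trans ((hM3 _ (by decide)).trans e4)
    have f5 : M4 GRP = M GRP := (hM4 _ (by decide)).trans ((hM3 _ (by decide)).trans e5)
    have f6 : M4 SITE = M SITE := (hM4 _ (by decide)).trans ((hM3 _ (by decide)).trans e6)
    have f7 : M4 LS = M LS := (hM4 _ (by decide)).trans ((hM3 _ (by decide)).trans e7)
    have f8 : M4 BEST 0 = v := by rw [hM4 _ (by decide), hM3 _ (by decide), hbest]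
    have f9 : M4 MARK = M3 MARK := hM4 _ (by decide)
    have htake := run_take (D := D) (M := M4) (v := v)
    have hM5 := fun a (ha : a ∉ _) => run_frame (D := D) take M4 (a := a) ha
    set M5 := take.run D M4
    have hat := run_attach (D := D) M5
    have hM6 := run_frame (D := D) attach M5 (a := GRP) (by decide)
    rw [hM3 SIZE (by decide), hM3 COMP (by decide), hM3 BEST (by decide), hbest, e3, e4] at hcn
    rw [f1, f2, f3, f4, f5, f7, f9, hcn] at htake
    rw [e1, e2, hbest] at hst
    rw [hM5 SITE (by decide), hM5 LS (by decide), hM5 BEST (by decide), hM5 PAR (by decide), f2,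
      f6, f7, f8] at hat
    rw [hM6]
    refine G.extend F hv hvw (fun w hw hvw' => ?_) (htake (fun x hx => ?_) G.grp_le rfl hvw) hat
    · by_contra hlt
      have := hmax w hw (by omega)
      omega
    · rw [hst F.par_le x hx]
      simp
  · rw [if_neg (by simp [Exp.holds_lt, Exp.eval, hbest, e1]), run_skip, e5, e6]
    exact G.idle (G.all_grouped F fun v hv => not_le.1 (hno v hv))

theorem run_groups {M : Mem} {δ : ℕ → ℕ → ℝ} {l : ℝ}
    (F : IsMetricForest (M NUM 0) (M PAR) (M COMP) (M SIZE) δ l) :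
    IsGrouping (M NUM 0) (M COMP) (M SIZE) δ l (groups.run D M GRP) (groups.run D M SITE) := by
  have hg : ∀ x < M NUM 0, (update NUM GRP LX skip (.lit 1) (.lit 0)).run D M GRP x = 0 := by
    intro x hx
    rw [run_update (by decide) (fun _ => True) (fun _ => 0)
      (by simp [run_skip, Exp.holds_lit, Exp.eval])]
    simp [hx]
  have hM1 := fun a (ha : a ∉ _) =>
    run_frame (D := D) (update NUM GRP LX skip (.lit 1) (.lit 0)) M (a := a) ha
  rw [groups, run_seq]
  set M1 := (update NUM GRP LX skip (.lit 1) (.lit 0)).run D M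
  rw [← hM1 NUM (by decide), ← hM1 COMP (by decide), ← hM1 SIZE (by decide)] at F ⊢
  rw [← hM1 PAR (by decide)] at F
  rw [← hM1 NUM (by decide)] at hg
  clear_value M1
  refine IsPartialGrouping.isGrouping (par := M1 PAR) (s := M1 NUM 0) ?_ rfl
  refine loop_induction (D := D) (v := LS) (r := NUM) (P := formGroup) (M := M1)
    (fun s M' => IsPartialGrouping (M1 NUM 0) (M1 PAR) (M1 COMP) (M1 SIZE) δ l s
      (M' GRP) (M' SITE)) ?_ ?_
  · simp only [Mem.write_of_ne _ (show GRP ≠ LS by decide),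
      Mem.write_of_ne _ (show SITE ≠ LS by decide)]
    constructor <;> simp +contextual [hg, F.par_lt]
  · intro s hs M' hM' hv h
    simp only [Mem.write_of_ne _ (show GRP ≠ LS by decide),
      Mem.write_of_ne _ (show SITE ≠ LS by decide)]
    have := run_formGroup (D := D) (M := M') (δ := δ) (l := l)
    rw [hM' NUM (by decide), hM' PAR (by decide), hM' COMP (by decide), hM' SIZE (by decide),
      hv] at this
    exact this F h

end Code
end KDBST

namespace KDBST

/-! ### Colouring the points

Each point gets as its colour a point of tuple `0` in the same component (increased by `1`), such
that points of the same group or of the same tuple get different colours. -/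

/-- A colouring of the first `q` points. -/
structure IsPartialColoring (N : ℕ) (comp T grp : ℕ → ℕ) (q : ℕ) (col : ℕ → ℕ) : Prop where
  col_eq_zero : ∀ x < N, q ≤ x → col x = 0
  col_ne_zero : ∀ x < N, x < q → col x ≠ 0
  col_lt : ∀ x < N, x < q → col x - 1 < N
  tup_col : ∀ x < N, x < q → T (col x - 1) = 0
  comp_col : ∀ x < N, x < q → comp (col x - 1) = comp x
  eq_of_grp : ∀ x < N, ∀ y < N, col x ≠ 0 → col x = col y → grp x = grp y → x = y
  eq_of_tup : ∀ x < N, ∀ y < N, col x ≠ 0 → col x = col y → T x = T y → x = y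

/-- The points `y` and `z` are consecutive points of a path coloured with `a` and `b`. -/
def Linked (T grp col : ℕ → ℕ) (a b y z : ℕ) : Prop :=
  col y = a ∧ col z = b ∧ grp y = grp z ∨ col y = b ∧ col z = a ∧ T y = T z

/-- The set of points with `mark` is a union of alternating paths that contains all points of
colour `a` in tuple `t`. -/
structure IsAlternating (N : ℕ) (T grp col : ℕ → ℕ) (a b t : ℕ) (mark : ℕ → ℕ) : Prop where
  start : ∀ x < N, col x = a → T x = t → mark x ≠ 0
  closed : ∀ y < N, mark y ≠ 0 → ∀ z < N, Linked T grp col a b y z → mark z ≠ 0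
  pred : ∀ z < N, mark z ≠ 0 →
    col z = a ∧ T z = t ∨ ∃ y < N, mark y ≠ 0 ∧ Linked T grp col a b y z

/-- Pigeonhole: `q` is uncoloured, so the points of `B` use at most `B.card - 1` colours. -/
theorem exists_free {A B : Finset ℕ} (h : B.card ≤ A.card) {q : ℕ} {col : ℕ → ℕ} (hq : q ∈ B)
    (hcol : col q = 0) : ∃ a ∈ A, ∀ y ∈ B, col y ≠ a + 1 := by
  by_contra! hc
  have hsub : A ⊆ (B.erase q).image fun y => col y - 1 := by
    intro a ha
    obtain ⟨y, hy, hya⟩ := hc a ha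
    refine Finset.mem_image.2 ⟨y, Finset.mem_erase.2 ⟨?_, hy⟩, by omega⟩
    rintro rfl
    omega
  have h1 := (Finset.card_le_card hsub).trans Finset.card_image_le
  have h2 := Finset.card_erase_lt_of_mem hq
  omega

/-- König's argument: `a` is free at the group of `q` and `b` at its tuple, and exchanging both
colours along the alternating path that starts with colour `a` in the tuple of `q` makes `a` free
there. The path enters a group only by a point of colour `a`, so it never reaches the group of `q`.
That every marked point is a start or has a marked predecessor is all that is used of the path; no
order along it is needed. -/
theorem IsPartialColoring.step {N : ℕ} {comp T grp col mark : ℕ → ℕ} {q a b : ℕ} (hq : q < N)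
    (h : IsPartialColoring N comp T grp q col)
    (ha : a < N) (hTa : T a = 0) (hca : comp a = comp q)
    (hfa : ∀ y < N, col y = a + 1 → grp y ≠ grp q)
    (hb : b < N) (hTb : T b = 0) (hcb : comp b = comp q)
    (hfb : ∀ y < N, col y = b + 1 → T y ≠ T q)
    (hm : IsAlternating N T grp col (a + 1) (b + 1) (T q) mark) {col' : ℕ → ℕ}
    (hq' : col' q = a + 1)
    (hflip : ∀ x < N, x ≠ q → mark x ≠ 0 → col' x = a + 1 + (b + 1) - col x)
    (hkeep : ∀ x < N, x ≠ q → mark x = 0 → col' x = col x) :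
    IsPartialColoring N comp T grp (q + 1) col' := by
  have hmc : ∀ x < N, mark x ≠ 0 → col x = a + 1 ∨ col x = b + 1 := by
    intro x hx hmx
    rcases hm.pred x hx hmx with h1 | ⟨y, -, -, h1 | h1⟩
    exacts [Or.inl h1.1, Or.inr h1.2.1, Or.inl h1.2.1]
  have hcq : col q = 0 := h.col_eq_zero q hq le_rfl
  have hmq : mark q = 0 := by
    by_contra h0
    have := hmc q hq h0
    omega
  have hlt : ∀ x < N, col x ≠ 0 → x < q := fun x hx h0 => by
    by_contra hge
    exact h0 (h.col_eq_zero x hx (by omega))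
  -- the predecessor of a marked point of colour `b`
  have hpredb : a ≠ b → ∀ z < N, mark z ≠ 0 → col z = b + 1 →
      ∃ y < N, mark y ≠ 0 ∧ col y = a + 1 ∧ grp y = grp z := by
    intro hab z hz hmz hcz
    rcases hm.pred z hz hmz with h1 | ⟨y, hy, hmy, h1 | h1⟩
    · omega
    · exact ⟨y, hy, hmy, h1.1, h1.2.2⟩
    · omega
  have hpreda : a ≠ b → ∀ z < N, mark z ≠ 0 → col z = a + 1 →
      T z = T q ∨ ∃ y < N, mark y ≠ 0 ∧ col y = b + 1 ∧ T y = T z := by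
    intro hab z hz hmz hcz
    rcases hm.pred z hz hmz with h1 | ⟨y, hy, hmy, h1 | h1⟩
    · exact Or.inl h1.2
    · omega
    · exact Or.inr ⟨y, hy, hmy, h1.1, h1.2.2⟩
  -- The case `a = b` is not excluded; the exchange then changes nothing.
  have hval : ∀ x < N, x ≠ q → col' x = col x ∧ (mark x = 0 ∨ a = b) ∨
      a ≠ b ∧ mark x ≠ 0 ∧ (col x = a + 1 ∧ col' x = b + 1 ∨ col x = b + 1 ∧ col' x = a + 1) := by
    intro x hx hxq
    by_cases hmx : mark x = 0
    · exact Or.inl ⟨hkeep x hx hxq hmx, Or.inl hmx⟩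
    · have h1 := hflip x hx hxq hmx
      have h2 := hmc x hx hmx
      omega
  have hne : ∀ x < N, x < q → col' x ≠ 0 ∧ col' x - 1 < N ∧ T (col' x - 1) = 0 ∧
      comp (col' x - 1) = comp x := by
    intro x hx hxq
    rcases hval x hx hxq.ne with ⟨h1, -⟩ | ⟨-, -, ⟨h1, h2⟩ | ⟨h1, h2⟩⟩
    · rw [h1]
      exact ⟨h.col_ne_zero x hx hxq, h.col_lt x hx hxq, h.tup_col x hx hxq, h.comp_col x hx hxq⟩
    · have h3 := h.comp_col x hx hxq
      rw [h1, Nat.add_sub_cancel] at h3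
      rw [h2, Nat.add_sub_cancel]
      exact ⟨by omega, hb, hTb, by rw [← h3, hca, hcb]⟩
    · have h3 := h.comp_col x hx hxq
      rw [h1, Nat.add_sub_cancel] at h3
      rw [h2, Nat.add_sub_cancel]
      exact ⟨by omega, ha, hTa, by rw [← h3, hca, hcb]⟩
  have hsplit : ∀ {p : ℕ → Prop}, (∀ x < N, x < q → p x) → p q → ∀ x < N, x < q + 1 → p x := by
    intro p h1 h2 x hx hxq
    rcases Nat.lt_succ_iff_lt_or_eq.1 hxq with h3 | rfl
    exacts [h1 x hx h3, h2]
  -- conflicts with the new point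
  have hnewg : ∀ x < N, x ≠ q → col' x = a + 1 → grp x ≠ grp q := by
    intro x hx hxq hc hg
    rcases hval x hx hxq with ⟨h1, -⟩ | ⟨hab, hmx, ⟨h1, h2⟩ | ⟨h1, h2⟩⟩
    · exact hfa x hx (h1 ▸ hc) hg
    · omega
    · obtain ⟨y, hy, -, hcy, hgy⟩ := hpredb hab x hx hmx h1
      exact hfa y hy hcy (hgy.trans hg)
  have hnewt : ∀ x < N, x ≠ q → col' x = a + 1 → T x ≠ T q := by
    intro x hx hxq hc ht
    rcases hval x hx hxq with ⟨h1, h2⟩ | ⟨hab, hmx, ⟨h1, h2⟩ | ⟨h1, h2⟩⟩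
    · have hcx : col x = a + 1 := h1 ▸ hc
      rcases h2 with h2 | rfl
      · exact hm.start x hx hcx ht h2
      · exact hfb x hx hcx ht
    · omega
    · exact hfb x hx h1 ht
  -- conflicts of a flipped and an unflipped point
  have hmixg : ∀ x < N, ∀ y < N, a ≠ b → mark x ≠ 0 → mark y = 0 → grp x = grp y →
      ¬ (col x = a + 1 ∧ col y = b + 1) ∧ ¬ (col x = b + 1 ∧ col y = a + 1) := by
    intro x hx y hy hab hmx hmy hg
    refine ⟨fun hc => hm.closed x hx hmx y hy (Or.inl ⟨hc.1, hc.2, hg⟩) hmy, fun hc => ?_⟩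
    obtain ⟨z, hz, hmz, hcz, hgz⟩ := hpredb hab x hx hmx hc.1
    have := h.eq_of_grp z hz y hy (by omega) (hcz.trans hc.2.symm) (hgz.trans hg)
    exact hmz (this ▸ hmy)
  have hmixt : ∀ x < N, ∀ y < N, a ≠ b → mark x ≠ 0 → mark y = 0 → T x = T y →
      ¬ (col x = a + 1 ∧ col y = b + 1) ∧ ¬ (col x = b + 1 ∧ col y = a + 1) := by
    intro x hx y hy hab hmx hmy ht
    refine ⟨fun hc => ?_, fun hc => hm.closed x hx hmx y hy (Or.inr ⟨hc.1, hc.2, ht⟩) hmy⟩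
    rcases hpreda hab x hx hmx hc.1 with h1 | ⟨z, hz, hmz, hcz, htz⟩
    · exact hfb y hy hc.2 (ht.symm.trans h1)
    · have := h.eq_of_tup z hz y hy (by omega) (hcz.trans hc.2.symm) (htz.trans ht)
      exact hmz (this ▸ hmy)
  -- properness on the old points, for groups and tuples alike
  have hold : ∀ f : ℕ → ℕ,
      (∀ x < N, ∀ y < N, col x ≠ 0 → col x = col y → f x = f y → x = y) →
      (∀ x < N, ∀ y < N, a ≠ b → mark x ≠ 0 → mark y = 0 → f x = f y →
        ¬ (col x = a + 1 ∧ col y = b + 1) ∧ ¬ (col x = b + 1 ∧ col y = a + 1)) →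
      (∀ x < N, x ≠ q → col' x = a + 1 → f x ≠ f q) →
      ∀ x < N, ∀ y < N, col' x ≠ 0 → col' x = col' y → f x = f y → x = y := by
    intro f hf hmix hnew x hx y hy h0 hc hfe
    by_cases hxq : x = q
    · by_contra hxy
      refine hnew y hy (fun hyq => hxy (hxq.trans hyq.symm)) ?_ (hfe.symm.trans (by rw [hxq]))
      rw [← hc, hxq, hq']
    · by_cases hyq : y = q
      · exact absurd (hfe.trans (by rw [hyq])) (hnew x hx hxq (by rw [hc, hyq, hq']))
      · have e1 := hval x hx hxq
        have e2 := hval y hy hyq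
        have e3 := hmix x hx y hy
        have e4 := hmix y hy x hx
        by_cases hcc : col x = col y
        · exact hf x hx y hy (by omega) hcc hfe
        · exfalso
          rcases e1 with ⟨h1, h1'⟩ | ⟨hab, hmx, h1⟩
          · rcases e2 with ⟨h2, -⟩ | ⟨hab, hmy, h2⟩
            · exact hcc (by rw [← h1, ← h2, hc])
            · have e5 := e4 hab hmy (h1'.resolve_right hab) hfe.symm
              omega
          · rcases e2 with ⟨h2, h2'⟩ | ⟨-, hmy, h2⟩
            · have e5 := e3 hab hmx (h2'.resolve_right hab) hfe
              omega
            · omega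
  constructor
  · intro x hx hqx
    have hcx : col x = 0 := h.col_eq_zero x hx (by omega)
    rw [hkeep x hx (by omega) (by_contra fun h0 => by have := hmc x hx h0; omega), hcx]
  · exact hsplit (fun x hx hxq => (hne x hx hxq).1) (by omega)
  · exact hsplit (fun x hx hxq => (hne x hx hxq).2.1) (by rwa [hq', Nat.add_sub_cancel])
  · exact hsplit (fun x hx hxq => (hne x hx hxq).2.2.1) (by rwa [hq', Nat.add_sub_cancel])
  · exact hsplit (fun x hx hxq => (hne x hx hxq).2.2.2) (by rwa [hq', Nat.add_sub_cancel])
  · exact hold grp h.eq_of_grp hmixg hnewg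
  · exact hold T h.eq_of_tup hmixt hnewt

end KDBST

/-! ### The colouring program -/

namespace KDBST

notation "LQ" => 32
notation "LA" => 33
notation "AL" => 34
notation "BE" => 35
notation "LRD" => 36
notation "LY" => 37
notation "COL" => 38

namespace Code

variable {D : Comparisons}

/-- Find a colour for point `LQ` which is not used by the points satisfying `same`. -/
def freeColor (c : ℕ) (same : Exp) : Code :=
  find NUM c LA
    (count NUM CA LX skip (.and (.eq (.get COL (reg LX)) (.add (reg LA) (.lit 1))) same))
    (.and (.not (reg CA)) (.and (.eq (reg LA).tup (.lit 0))
      (.eq (.get COMP (reg LA)) (.get COMP (reg LQ)))))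

/-- Points `LX` and `LQ` are in the same group. -/
def _root_.KDBST.Exp.sameGrp : Exp := .eq (.get GRP (reg LX)) (.get GRP (reg LQ))

/-- Points `LX` and `LQ` are in the same tuple. -/
def _root_.KDBST.Exp.sameTup : Exp := .eq (reg LX).tup (reg LQ).tup

/-- Point `LX` is the successor of point `LY` on an alternating path. -/
def _root_.KDBST.Exp.linked : Exp :=
  .or (.and (.eq (.get COL (reg LY)) (.add (reg AL) (.lit 1)))
      (.and (.eq (.get COL (reg LX)) (.add (reg BE) (.lit 1)))
        (.eq (.get GRP (reg LY)) (.get GRP (reg LX)))))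
    (.and (.eq (.get COL (reg LY)) (.add (reg BE) (.lit 1)))
      (.and (.eq (.get COL (reg LX)) (.add (reg AL) (.lit 1)))
        (.eq (reg LY).tup (reg LX).tup)))

/-- Mark the successors of all marked points. -/
def spread : Code :=
  loop LY NUM (update NUM MARK LX skip (.and (.get MARK (reg LY)) .linked) (.lit 1))

/-- Mark the starting points of alternating paths. -/
def markStart : Code :=
  update NUM MARK LX skip (.lit 1) (.not (.not (.and
    (.eq (.get COL (reg LX)) (.add (reg AL) (.lit 1))) .sameTup)))

/-- Exchange the colours of the marked points. -/
def flip : Code :=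
  update NUM COL LX skip (.get MARK (reg LX)) (.sub
    (.add (.add (reg AL) (.lit 1)) (.add (reg BE) (.lit 1))) (.get COL (reg LX)))

/-- Colour the point `LQ`. -/
def colorPoint : Code :=
  freeColor AL .sameGrp ⨾ freeColor BE .sameTup ⨾ markStart ⨾ loop LRD NUM spread ⨾ flip ⨾
    set COL (reg LQ) (.add (reg AL) (.lit 1))

/-- Colour all points. -/
def coloring : Code :=
  update NUM COL LX skip (.lit 1) (.lit 0) ⨾ loop LQ NUM colorPoint

theorem run_freeColor {c : ℕ} (hc : c = AL ∨ c = BE) {same : Exp} (M : Mem) {p : ℕ → Prop}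
    (hsame : ∀ x < M NUM 0, ∀ M' : Mem, M' LX 0 = x → M' LQ = M LQ → M' GRP = M GRP →
      M' TUP = M TUP → M' ORD = M ORD → (same.Holds D M' ↔ p x))
    (hex : ∃ a < M NUM 0, M TUP (M ORD a) = 0 ∧ M COMP a = M COMP (M LQ 0) ∧
      ∀ x < M NUM 0, M COL x = a + 1 → ¬ p x) :
    ∃ a < M NUM 0, (freeColor c same).run D M c 0 = a ∧ M TUP (M ORD a) = 0 ∧
      M COMP a = M COMP (M LQ 0) ∧ ∀ x < M NUM 0, M COL x = a + 1 → ¬ p x := by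
  classical
  have hfind := run_find (D := D) (r := NUM) (c := c) (v := LA)
    (P := count NUM CA LX skip (.and (.eq (.get COL (reg LX)) (.add (reg LA) (.lit 1))) same))
    (e := .and (.not (reg CA)) (.and (.eq (reg LA).tup (.lit 0))
      (.eq (.get COMP (reg LA)) (.get COMP (reg LQ))))) (M := M)
    (by rcases hc with rfl | rfl <;> simp [count, writes])
    (fun a => M TUP (M ORD a) = 0 ∧ M COMP a = M COMP (M LQ 0) ∧
      ∀ x < M NUM 0, M COL x = a + 1 → ¬ p x) (by
    intro i _ M' hM' hv
    have hM : ∀ b, b ≠ CA → b ≠ LX → b ≠ LA → b ≠ c → M' b = M b := fun b h1 h2 h3 h4 =>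
      hM' b (by simp [find, count, writes, h1, h2, h3, h4])
    have hN : ∀ b, b = NUM ∨ b = COL ∨ b = LQ ∨ b = GRP ∨ b = TUP ∨ b = ORD ∨ b = COMP →
        M' b = M b := fun b hb => by
      refine hM b ?_ ?_ ?_ ?_ <;> rcases hc with rfl | rfl <;>
        rcases hb with rfl | rfl | rfl | rfl | rfl | rfl | rfl <;> decide
    have hcnt := run_count (D := D) (r := NUM) (c := CA) (v := LX) (P := skip)
      (e := .and (.eq (.get COL (reg LX)) (.add (reg LA) (.lit 1))) same) (M := M') (by decide)
      (fun x => M COL x = i + 1 ∧ p x) (by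
        intro x hx M'' hM'' hv'
        have hF : ∀ b, b ≠ CA → b ≠ LX → M'' b = M' b := fun b h1 h2 =>
          hM'' b (by simp [count, writes, h1, h2])
        rw [hN NUM (by decide)] at hx
        have h1 := hsame x hx M'' hv'
          ((hF _ (by decide) (by decide)).trans (hN _ (by decide)))
          ((hF _ (by decide) (by decide)).trans (hN _ (by decide)))
          ((hF _ (by decide) (by decide)).trans (hN _ (by decide)))
          ((hF _ (by decide) (by decide)).trans (hN _ (by decide)))
        simp only [run_skip, Exp.holds_and, Exp.holds_eq, Exp.eval, hv', h1,
          hF COL (by decide) (by decide), hF LA (by decide) (by decide), hN COL (by decide), hv])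
    have hF : ∀ b, b ≠ CA → b ≠ LX → (count NUM CA LX skip (.and (.eq (.get COL (reg LX))
        (.add (reg LA) (.lit 1))) same)).run D M' b = M' b := fun b h1 h2 =>
      run_frame _ _ (by simp [count, writes, h1, h2])
    simp only [Exp.holds_and, Exp.holds_not, Exp.holds_get, Exp.holds_eq, Exp.eval, Exp.tup, hcnt,
      hF LA (by decide) (by decide), hF TUP (by decide) (by decide),
      hF ORD (by decide) (by decide), hF COMP (by decide) (by decide),
      hF LQ (by decide) (by decide), hv, hN NUM (by decide), hN TUP (by decide),
      hN ORD (by decide), hN COMP (by decide), hN LQ (by decide), ne_eq, not_not,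
      Finset.card_eq_zero, Finset.filter_eq_empty_iff, Finset.mem_range, not_and]
    tauto)
  rcases hfind with ⟨a, ha, h1, -, h2⟩ | ⟨hno, -⟩
  · exact ⟨a, ha, h2, h1⟩
  · obtain ⟨a, ha, h⟩ := hex
    exact absurd h (hno a ha)

/-- Marks are set in place, so one sweep may advance several steps along a path. Only four
consequences matter: marks persist, successors of previously marked points become marked, new marks
have marked predecessors, and a closed set of marks does not grow. -/
theorem run_spread (M : Mem) :
    let L := Linked (fun x => M TUP (M ORD x)) (M GRP) (M COL) (M AL 0 + 1) (M BE 0 + 1)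
    (∀ x, M MARK x ≠ 0 → spread.run D M MARK x ≠ 0) ∧
    (∀ y < M NUM 0, M MARK y ≠ 0 → ∀ z < M NUM 0, L y z → spread.run D M MARK z ≠ 0) ∧
    (∀ z < M NUM 0, spread.run D M MARK z ≠ 0 → M MARK z ≠ 0 ∨
      ∃ y < M NUM 0, spread.run D M MARK y ≠ 0 ∧ L y z) ∧
    ((∀ y < M NUM 0, M MARK y ≠ 0 → ∀ z < M NUM 0, L y z → M MARK z ≠ 0) →
      ∀ z < M NUM 0, spread.run D M MARK z ≠ 0 → M MARK z ≠ 0) := by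
  classical
  intro L
  refine loop_induction (D := D) (v := LY) (r := NUM) (M := M)
    (P := update NUM MARK LX skip (.and (.get MARK (reg LY)) .linked) (.lit 1))
    (fun i M' => (∀ x, M MARK x ≠ 0 → M' MARK x ≠ 0) ∧
      (∀ y < i, M MARK y ≠ 0 → ∀ z < M NUM 0, L y z → M' MARK z ≠ 0) ∧
      (∀ z < M NUM 0, M' MARK z ≠ 0 → M MARK z ≠ 0 ∨
        ∃ y < M NUM 0, M' MARK y ≠ 0 ∧ L y z) ∧
      ((∀ y < M NUM 0, M MARK y ≠ 0 → ∀ z < M NUM 0, L y z → M MARK z ≠ 0) →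
        ∀ z < M NUM 0, M' MARK z ≠ 0 → M MARK z ≠ 0)) ?_ ?_
  · simp only [Mem.write_of_ne _ (show MARK ≠ LY by decide)]
    exact ⟨fun _ h => h, fun _ h => by omega, fun _ _ h => Or.inl h, fun _ _ _ h => h⟩
  · rintro i hi M' hM' hv ⟨h1, h2, h3, h4⟩
    simp only [Mem.write_of_ne _ (show MARK ≠ LY by decide)]
    have hu := run_update (D := D) (r := NUM) (a := MARK) (v := LX) (P := skip)
      (e := .and (.get MARK (reg LY)) .linked) (f := .lit 1) (M := M') (by decide)
      (fun z => M' MARK i ≠ 0 ∧ L i z) (fun _ => 1) (by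
        intro z hz M'' hM'' hv' hmk
        refine ⟨?_, fun _ => rfl⟩
        -- The inner loop sets marks only if `i` is already marked, so whether `i` is marked does
        -- not change during that loop.
        have hi' : M'' MARK i ≠ 0 ↔ M' MARK i ≠ 0 := by
          rw [hmk]
          split_ifs with hc
          · exact iff_of_true one_ne_zero hc.2.1
          · exact Iff.rfl
        simp only [run_skip, Exp.linked, Exp.holds_and, Exp.holds_or, Exp.holds_eq, Exp.holds_get,
          Exp.eval, Exp.tup, hM'' LY (by decide), hv, hv', hM'' COL (by decide),
          hM'' GRP (by decide), hM'' TUP (by decide), hM'' ORD (by decide), hM'' AL (by decide),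
          hM'' BE (by decide), hM' COL (by decide), hM' GRP (by decide), hM' TUP (by decide),
          hM' ORD (by decide), hM' AL (by decide), hM' BE (by decide), hi']
        exact Iff.rfl)
    rw [hM' NUM (by decide)] at hu
    have hmono : ∀ x, M' MARK x ≠ 0 → (update NUM MARK LX skip
        (.and (.get MARK (reg LY)) .linked) (.lit 1)).run D M' MARK x ≠ 0 := by
      intro x hx
      rw [hu]
      split_ifs
      exacts [one_ne_zero, hx]
    refine ⟨fun x hx => hmono x (h1 x hx), fun y hy hmy z hz hl => ?_, fun z hz hmz => ?_,
      fun hcl z hz hmz => ?_⟩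
    · rcases Nat.lt_succ_iff_lt_or_eq.1 hy with hy | rfl
      · exact hmono z (h2 y hy hmy z hz hl)
      · rw [hu, if_pos ⟨hz, h1 y hmy, hl⟩]
        exact one_ne_zero
    · rw [hu] at hmz
      split_ifs at hmz with hc
      · exact Or.inr ⟨i, hi, hmono i hc.2.1, hc.2.2⟩
      · exact (h3 z hz hmz).imp_right fun ⟨y, hy, hmy, hl⟩ => ⟨y, hy, hmono y hmy, hl⟩
    · rw [hu] at hmz
      split_ifs at hmz with hc
      · exact hcl i hi (h4 hcl i hi hc.2.1) z hz hc.2.2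
      · exact h4 hcl z hz hmz

/-- A sweep that adds no mark certifies closure, and every other sweep adds at least one. So after
as many sweeps as there are points the marks are closed, if only because all points are marked. -/
theorem run_saturate {M : Mem} {t : ℕ} (hstart : ∀ x < M NUM 0, M MARK x ≠ 0 ↔
      M COL x = M AL 0 + 1 ∧ M TUP (M ORD x) = t) :
    IsAlternating (M NUM 0) (fun x => M TUP (M ORD x)) (M GRP) (M COL) (M AL 0 + 1) (M BE 0 + 1) t
      ((loop LRD NUM spread).run D M MARK) := by
  classical
  obtain ⟨L, hL⟩ : ∃ L, L = Linked (fun x => M TUP (M ORD x)) (M GRP) (M COL) (M AL 0 + 1)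
    (M BE 0 + 1) := ⟨_, rfl⟩
  have key := loop_induction (D := D) (v := LRD) (r := NUM) (M := M) (P := spread)
    (fun i M' => (∀ x, M MARK x ≠ 0 → M' MARK x ≠ 0) ∧
      (∀ z < M NUM 0, M' MARK z ≠ 0 → M MARK z ≠ 0 ∨ ∃ y < M NUM 0, M' MARK y ≠ 0 ∧ L y z) ∧
      ((∀ y < M NUM 0, M' MARK y ≠ 0 → ∀ z < M NUM 0, L y z → M' MARK z ≠ 0) ∨
        i ≤ ((Finset.range (M NUM 0)).filter fun x => M' MARK x ≠ 0).card)) ?_ ?_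
  · obtain ⟨h1, h2, h3⟩ := key
    refine ⟨fun x hx hc ht => h1 x ((hstart x hx).2 ⟨hc, ht⟩), ?_, fun z hz hmz => ?_⟩
    · rw [← hL]
      rcases h3 with h3 | h3
      · exact h3
      · intro y _ _ z hz _
        have := Finset.eq_of_subset_of_card_le (Finset.filter_subset
          (fun x => (loop LRD NUM spread).run D M MARK x ≠ 0) (Finset.range (M NUM 0)))
          (by rw [Finset.card_range]; exact h3)
        have hz' := Finset.mem_range.2 hz
        rw [← this] at hz'
        exact (Finset.mem_filter.1 hz').2
    · rw [← hL]
      exact (h2 z hz hmz).imp_left (hstart z hz).1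
  · simp only [Mem.write_of_ne _ (show MARK ≠ LRD by decide)]
    exact ⟨fun _ h => h, fun _ _ h => Or.inl h, Or.inr (Nat.zero_le _)⟩
  · rintro i hi M' hM' hv ⟨h1, h2, h3⟩
    simp only [Mem.write_of_ne _ (show MARK ≠ LRD by decide)]
    have hs := run_spread (D := D) M'
    simp only [hM' TUP (by decide), hM' ORD (by decide), hM' GRP (by decide), hM' COL (by decide),
      hM' AL (by decide), hM' BE (by decide), hM' NUM (by decide), ← hL] at hs
    obtain ⟨s1, s2, s3, s4⟩ := hs
    generalize spread.run D M' MARK = mk at s1 s2 s3 s4 ⊢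
    refine ⟨fun x hx => s1 x (h1 x hx), fun z hz hmz => ?_, ?_⟩
    · rcases s3 z hz hmz with h4 | h4
      · exact (h2 z hz h4).imp_right fun ⟨y, hy, hmy, hl⟩ => ⟨y, hy, s1 y hmy, hl⟩
      · exact Or.inr h4
    · by_cases hsame : ∀ x < M NUM 0, mk x ≠ 0 → M' MARK x ≠ 0
      · exact Or.inl fun y hy hmy z hz hl => s2 y hy (hsame y hy hmy) z hz hl
      · push Not at hsame
        obtain ⟨x, hx, hmx, hx0⟩ := hsame
        refine Or.inr ?_
        have hlt : ((Finset.range (M NUM 0)).filter fun x => M' MARK x ≠ 0).card <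
            ((Finset.range (M NUM 0)).filter fun x => mk x ≠ 0).card := by
          refine Finset.card_lt_card ((Finset.ssubset_iff_of_subset ?_).2 ⟨x, ?_, ?_⟩)
          · intro y hy
            simp only [Finset.mem_filter] at hy ⊢
            exact ⟨hy.1, s1 y hy.2⟩
          · simp [hx, hmx]
          · simp [hx0]
        rcases h3 with h3 | h3
        · exact absurd hx0 (s4 h3 x hx hmx)
        · omega

theorem run_markStart (M : Mem) (x : ℕ) (hx : x < M NUM 0) : markStart.run D M MARK x ≠ 0 ↔
    M COL x = M AL 0 + 1 ∧ M TUP (M ORD x) = M TUP (M ORD (M LQ 0)) := by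
  classical
  rw [markStart, run_update (by decide) (fun _ => True)
    (fun x => if M COL x = M AL 0 + 1 ∧ M TUP (M ORD x) = M TUP (M ORD (M LQ 0)) then 1 else 0)]
  · simp [hx]
  · intro i _ M' hM' hv _
    refine ⟨by simp [Exp.holds_lit], fun _ => ?_⟩
    simp only [run_skip, Exp.eval_not, Exp.holds_not, Exp.holds_and, Exp.holds_eq, Exp.sameTup,
      Exp.tup, Exp.eval, hv, hM' COL (by decide), hM' AL (by decide), hM' TUP (by decide),
      hM' ORD (by decide), hM' LQ (by decide), ite_not]

theorem run_flip (M : Mem) (x : ℕ) (hx : x < M NUM 0) :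
    (M MARK x ≠ 0 → flip.run D M COL x = M AL 0 + 1 + (M BE 0 + 1) - M COL x) ∧
    (M MARK x = 0 → flip.run D M COL x = M COL x) := by
  rw [flip, run_update (by decide) (fun x => M MARK x ≠ 0)
    (fun x => M AL 0 + 1 + (M BE 0 + 1) - M COL x)]
  · simp +contextual [hx]
  · intro i _ M' hM' hv hcol
    simp [run_skip, Exp.holds_get, Exp.eval, hv, hM' MARK (by decide), hM' AL (by decide),
      hM' BE (by decide), hcol]

theorem run_colorPoint {M : Mem} (hq : M LQ 0 < M NUM 0)
    (hcard : ∀ x < M NUM 0, ((Finset.range (M NUM 0)).filter fun y => M GRP y = M GRP x).card ≤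
      cell (M NUM 0) (M COMP) (fun x => M TUP (M ORD x)) (M COMP x) 0)
    (hcell : ∀ x < M NUM 0,
      cell (M NUM 0) (M COMP) (fun x => M TUP (M ORD x)) (M COMP x) (M TUP (M ORD x)) ≤
      cell (M NUM 0) (M COMP) (fun x => M TUP (M ORD x)) (M COMP x) 0)
    (h : IsPartialColoring (M NUM 0) (M COMP) (fun x => M TUP (M ORD x)) (M GRP) (M LQ 0)
      (M COL)) :
    IsPartialColoring (M NUM 0) (M COMP) (fun x => M TUP (M ORD x)) (M GRP) (M LQ 0 + 1)
      (colorPoint.run D M COL) := by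
  have hcq : M COL (M LQ 0) = 0 := h.col_eq_zero _ hq le_rfl
  have hexg := exists_free (hcard _ hq) (q := M LQ 0) (col := M COL) (by simp [hq]) hcq
  have hext := exists_free (hcell _ hq) (q := M LQ 0) (col := M COL) (by simp [hq]) hcq
  simp only [Finset.mem_filter, Finset.mem_range, and_imp] at hexg hext
  obtain ⟨a, ⟨ha, hca, hTa⟩, hfa⟩ := hexg
  obtain ⟨b, ⟨hb, hcb, hTb⟩, hfb⟩ := hext
  -- The pigeonhole principle makes `b` free in the part of the tuple inside the component of `LQ`.
  -- As colours are points of the component they are used in, `b` is then free in the whole tuple.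
  have hfb' : ∀ x < M NUM 0, M COL x = b + 1 → ¬ M TUP (M ORD x) = M TUP (M ORD (M LQ 0)) := by
    intro x hx hc ht
    have hxq : x < M LQ 0 := by
      by_contra hge
      have := h.col_eq_zero x hx (by omega)
      omega
    have := h.comp_col x hx hxq
    rw [hc, Nat.add_sub_cancel, hcb] at this
    exact hfb x hx this.symm ht hc
  have r1 := run_freeColor (D := D) (c := AL) (Or.inl rfl) (same := .sameGrp) M
    (p := fun x => M GRP x = M GRP (M LQ 0))
    (fun x _ M' h1 h2 h3 _ _ => by simp [Exp.sameGrp, Exp.holds_eq, Exp.eval, h1, h2, h3])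
    ⟨a, ha, hTa, hca, fun x hx hc hg => hfa x hx hg hc⟩
  clear a ha hca hTa hfa
  have hM1 := fun a (ha : a ∉ _) => run_frame (D := D) (freeColor AL .sameGrp) M (a := a) ha
  rw [colorPoint]
  simp only [run_seq]
  set M1 := (freeColor AL .sameGrp).run D M
  have r2 := run_freeColor (D := D) (c := BE) (Or.inr rfl) (same := .sameTup) M1
    (p := fun x => M1 TUP (M1 ORD x) = M1 TUP (M1 ORD (M1 LQ 0)))
    (fun x _ M' h1 h2 _ h4 h5 => by
      simp [Exp.sameTup, Exp.tup, Exp.holds_eq, Exp.eval, h1, h2, h4, h5])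
  have hM2 := fun a (ha : a ∉ _) => run_frame (D := D) (freeColor BE .sameTup) M1 (a := a) ha
  set M2 := (freeColor BE .sameTup).run D M1
  rw [hM1 NUM (by decide), hM1 TUP (by decide), hM1 ORD (by decide), hM1 COMP (by decide),
    hM1 COL (by decide), hM1 LQ (by decide)] at r2
  have r3 := run_markStart (D := D) M2
  have hM3 := fun a (ha : a ∉ _) => run_frame (D := D) markStart M2 (a := a) ha
  set M3 := markStart.run D M2
  have r4 := run_saturate (D := D) (M := M3) (t := M TUP (M ORD (M LQ 0)))
  have hM4 := fun a (ha : a ∉ _) => run_frame (D := D) (loop LRD NUM spread) M3 (a := a) ha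
  set M4 := (loop LRD NUM spread).run D M3
  have r5 := run_flip (D := D) M4
  have hM5 := fun a (ha : a ∉ _) => run_frame (D := D) flip M4 (a := a) ha
  set M5 := flip.run D M4
  have e3 : ∀ a, a = NUM ∨ a = TUP ∨ a = ORD ∨ a = COL ∨ a = LQ ∨ a = GRP ∨ a = COMP →
      M2 a = M a := by
    rintro a (rfl | rfl | rfl | rfl | rfl | rfl | rfl) <;>
      exact (hM2 _ (by decide)).trans (hM1 _ (by decide))
  obtain ⟨a, ha, hAL, hTa, hca, hfa⟩ := r1
  obtain ⟨b, hb, hBE, hTb, hcb, hfb⟩ := r2 ⟨b, hb, hTb, hcb, hfb'⟩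
  have hAL2 : M2 AL 0 = a := by rw [hM2 _ (by decide), hAL]
  simp only [hM3 NUM (by decide), hM3 TUP (by decide), hM3 ORD (by decide), hM3 COL (by decide),
    hM3 GRP (by decide), hM3 AL (by decide), hM3 BE (by decide), e3 NUM (by decide),
    e3 TUP (by decide), e3 ORD (by decide), e3 COL (by decide), e3 GRP (by decide),
    e3 LQ (by decide), hAL2, hBE] at r3 r4
  simp only [hM4 NUM (by decide), hM4 AL (by decide), hM4 BE (by decide), hM4 COL (by decide),
    hM3 NUM (by decide), hM3 AL (by decide), hM3 BE (by decide), hM3 COL (by decide),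
    e3 NUM (by decide), e3 COL (by decide), hAL2, hBE] at r5
  have hlast : ((set COL (reg LQ) (.add (reg AL) (.lit 1))).run D M5) COL =
      Function.update (M5 COL) (M LQ 0) (a + 1) := by
    simp [run_set, Mem.write_self, Exp.eval, hM5 LQ (by decide), hM4 LQ (by decide),
      hM3 LQ (by decide), e3 LQ (by decide), hM5 AL (by decide), hM4 AL (by decide),
      hM3 AL (by decide), hAL2]
  rw [hlast]
  refine h.step hq ha hTa hca hfa hb hTb hcb hfb (r4 r3) (by simp) (fun x hx hxq hm => ?_)
    (fun x hx hxq hm => ?_)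
  · rw [Function.update_of_ne hxq]
    exact (r5 x hx).1 hm
  · rw [Function.update_of_ne hxq]
    exact (r5 x hx).2 hm

theorem run_coloring {M : Mem}
    (hcard : ∀ x < M NUM 0, ((Finset.range (M NUM 0)).filter fun y => M GRP y = M GRP x).card ≤
      cell (M NUM 0) (M COMP) (fun x => M TUP (M ORD x)) (M COMP x) 0)
    (hcell : ∀ x < M NUM 0,
      cell (M NUM 0) (M COMP) (fun x => M TUP (M ORD x)) (M COMP x) (M TUP (M ORD x)) ≤
      cell (M NUM 0) (M COMP) (fun x => M TUP (M ORD x)) (M COMP x) 0) :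
    IsPartialColoring (M NUM 0) (M COMP) (fun x => M TUP (M ORD x)) (M GRP) (M NUM 0)
      (coloring.run D M COL) := by
  have hc : ∀ x < M NUM 0, (update NUM COL LX skip (.lit 1) (.lit 0)).run D M COL x = 0 := by
    intro x hx
    rw [run_update (by decide) (fun _ => True) (fun _ => 0)
      (by simp [run_skip, Exp.holds_lit, Exp.eval])]
    simp [hx]
  have hM1 := fun a (ha : a ∉ _) =>
    run_frame (D := D) (update NUM COL LX skip (.lit 1) (.lit 0)) M (a := a) ha
  rw [coloring, run_seq]
  set M1 := (update NUM COL LX skip (.lit 1) (.lit 0)).run D M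
  rw [← hM1 NUM (by decide), ← hM1 COMP (by decide), ← hM1 TUP (by decide),
    ← hM1 ORD (by decide), ← hM1 GRP (by decide)] at *
  clear_value M1
  refine loop_induction (D := D) (v := LQ) (r := NUM) (P := colorPoint) (M := M1)
    (fun q M' => IsPartialColoring (M1 NUM 0) (M1 COMP) (fun x => M1 TUP (M1 ORD x)) (M1 GRP) q
      (M' COL)) ?_ ?_
  · simp only [Mem.write_of_ne _ (show COL ≠ LQ by decide)]
    constructor <;> simp +contextual [hc]
  · intro q hq M' hM' hv h
    simp only [Mem.write_of_ne _ (show COL ≠ LQ by decide)]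
    have := run_colorPoint (D := D) (M := M')
    rw [hM' NUM (by decide), hM' COMP (by decide), hM' TUP (by decide), hM' ORD (by decide),
      hM' GRP (by decide), hv] at this
    exact this hq hcard hcell h

end Code
end KDBST

namespace KDBST

notation "RANK" => 39

open Code (cell)

/-! ### The solution described by a grouping and a colouring -/

theorem exists_preimage {A B : Finset ℕ} {f : ℕ → ℕ} (hf : ∀ a ∈ A, f a ∈ B)
    (hinj : ∀ a ∈ A, ∀ b ∈ A, f a = f b → a = b) (h : B.card ≤ A.card) {b : ℕ} (hb : b ∈ B) :
    ∃ a ∈ A, f a = b := by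
  have hsub : A.image f ⊆ B := by
    intro x hx
    obtain ⟨a, ha, rfl⟩ := Finset.mem_image.1 hx
    exact hf a ha
  have := Finset.eq_of_subset_of_card_le hsub
    (by rwa [Finset.card_image_of_injOn fun a ha b hb h => hinj a ha b hb h])
  rw [← this] at hb
  exact Finset.mem_image.1 hb

/-- The number of points of tuple `0` before a given point. -/
def rank (N : ℕ) (T : ℕ → ℕ) (a : ℕ) : ℕ :=
  ((Finset.range N).filter fun x => x < a ∧ T x = 0).card

section
variable {N k : ℕ} {T : ℕ → ℕ}

theorem rank_lt_rank {a b : ℕ} (ha : a < N) (hT : T a = 0) (h : a < b) :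
    rank N T a < rank N T b := by
  refine Finset.card_lt_card ((Finset.ssubset_iff_of_subset ?_).2 ⟨a, ?_, ?_⟩)
  · intro x hx
    simp only [Finset.mem_filter] at hx ⊢
    exact ⟨hx.1, hx.2.1.trans h, hx.2.2⟩
  · simp [ha, hT, h]
  · simp

theorem rank_injective {a b : ℕ} (ha : a < N) (hTa : T a = 0) (hb : b < N) (hTb : T b = 0)
    (h : rank N T a = rank N T b) : a = b := by
  rcases lt_trichotomy a b with h1 | h1 | h1
  · have := rank_lt_rank ha hTa h1
    omega
  · exact h1
  · have := rank_lt_rank hb hTb h1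
    omega

theorem rank_lt (hk : ((Finset.range N).filter fun x => T x = 0).card = k) {a : ℕ} (ha : a < N)
    (hT : T a = 0) : rank N T a < k := by
  rw [← hk]
  refine Finset.card_lt_card ((Finset.ssubset_iff_of_subset ?_).2 ⟨a, ?_, ?_⟩)
  · intro x hx
    simp only [Finset.mem_filter] at hx ⊢
    exact ⟨hx.1, hx.2.2⟩
  · simp [ha, hT]
  · simp

theorem exists_rank_eq (hk : ((Finset.range N).filter fun x => T x = 0).card = k) {i : ℕ}
    (hi : i < k) : ∃ a < N, T a = 0 ∧ rank N T a = i := by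
  obtain ⟨a, ha, h⟩ := exists_preimage (A := (Finset.range N).filter fun x => T x = 0)
    (B := Finset.range k) (f := rank N T) (fun a ha => by
      simp only [Finset.mem_filter, Finset.mem_range] at ha ⊢
      exact rank_lt hk ha.1 ha.2) (fun a ha b hb h => by
      simp only [Finset.mem_filter, Finset.mem_range] at ha hb
      exact rank_injective ha.1 ha.2 hb.1 hb.2 h) (by rw [hk, Finset.card_range])
    (Finset.mem_range.2 hi)
  simp only [Finset.mem_filter, Finset.mem_range] at ha
  exact ⟨a, ha.1, ha.2, h⟩

end

theorem IsForest.ord_injective {N : ℕ} {close : ℕ → ℕ → Prop} {ord pos par comp : ℕ → ℕ}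
    (h : IsForest N close ord pos par comp) {i j : ℕ} (hi : i < N) (hj : j < N)
    (he : ord i = ord j) : i = j := by
  have h1 := h.pos_ord i hi
  have h2 := h.pos_ord j hj
  rw [he] at h1
  omega

theorem IsForest.card_filter_ord {N : ℕ} {close : ℕ → ℕ → Prop} {ord pos par comp : ℕ → ℕ}
    (h : IsForest N close ord pos par comp) (p : ℕ → Prop) [DecidablePred p] :
    ((Finset.range N).filter fun i => p (ord i)).card = ((Finset.range N).filter p).card := by
  refine Finset.card_bij (fun i _ => ord i) ?_ ?_ ?_
  · intro i hi
    simp only [Finset.mem_filter, Finset.mem_range] at hi ⊢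
    exact ⟨h.ord_lt i hi.1, hi.2⟩
  · intro i hi j hj he
    simp only [Finset.mem_filter, Finset.mem_range] at hi hj
    exact h.ord_injective hi.1 hj.1 he
  · intro x hx
    simp only [Finset.mem_filter, Finset.mem_range] at hx
    obtain ⟨i, hi, rfl⟩ := h.exists_ord x hx.1
    exact ⟨i, by simp [hi, hx.2], rfl⟩

/-- The components of the spanning forest of a balanced threshold are balanced. -/
theorem IsForest.cell_eq {N n : ℕ} {d : ℕ → ℕ → ℝ} {T : ℕ → ℕ} {l : ℝ} {ord pos par comp : ℕ → ℕ}
    (h : IsForest N (fun x y => d x y ≤ l) ord pos par comp) (hb : IsBalanced N n d T l) (r : ℕ)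
    {i j : ℕ} (hi : i < n) (hj : j < n) :
    cell N comp (fun x => T (ord x)) r i = cell N comp (fun x => T (ord x)) r j := by
  have key : ∀ i, cell N comp (fun x => T (ord x)) r i =
      ((Finset.range N).filter fun x => comp (pos x - 1) = r ∧ T x = i).card := by
    intro i
    rw [← h.card_filter_ord]
    refine congrArg Finset.card (Finset.filter_congr fun x hx => ?_)
    rw [h.pos_ord x (Finset.mem_range.1 hx), Nat.add_sub_cancel]
  rw [key, key]
  refine hb (fun x => comp (pos x - 1)) (fun x hx y hy hd => ?_) r i hi j hj
  obtain ⟨a, ha, rfl⟩ := h.exists_ord x hx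
  obtain ⟨b, hb, rfl⟩ := h.exists_ord y hy
  simp only [h.pos_ord a ha, h.pos_ord b hb, Nat.add_sub_cancel]
  exact h.comp_eq a ha b hb hd

/-- The colours are the points of tuple `0`, so their ranks number the trees from `0` to `k - 1`.
The hypothesis `hq` is conditional because it describes a search; that the search succeeds is
derived here, by counting. -/
theorem isSolution_of_coloring {N k n : ℕ} (hN : N = k * n) {d : ℕ → ℕ → ℝ} {T : ℕ → ℕ} {l : ℝ}
    {close : ℕ → ℕ → Prop} {ord pos par comp size grp site col c q : ℕ → ℕ}
    (hT : ∀ x < N, T x < n)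
    (hk : ((Finset.range N).filter fun x => T x = 0).card = k)
    (h : IsForest N close ord pos par comp)
    (F : IsMetricForest N par comp size (fun i j => d (ord i) (ord j)) l)
    (hsize : ∀ x < N, ∀ t < n, cell N comp (fun x => T (ord x)) (comp x) t = size (comp x))
    (G : IsGrouping N comp size (fun i j => d (ord i) (ord j)) l grp site)
    (C : IsPartialColoring N comp (fun x => T (ord x)) grp N col)
    (hc : ∀ x < N, c (ord x) = rank N (fun x => T (ord x)) (col x - 1))
    (hq : ∀ x < N, (∃ y < N, col y = col x ∧ grp y = grp (site (grp x))) →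
      ∃ y < N, q (ord x) = ord y ∧ col y = col x ∧ grp y = grp (site (grp x))) :
    IsSolution k n d T ((3 * (k : ℝ) - 2) * l) c q := by
  have hk' : ((Finset.range N).filter fun x => T (ord x) = 0).card = k := by
    rw [← hk, ← h.card_filter_ord fun x => T x = 0]
  have hcol : ∀ x < N, ∀ y < N, col x - 1 = col y - 1 → col x = col y := fun x hx y hy he => by
    have := C.col_ne_zero x hx hx
    have := C.col_ne_zero y hy hy
    omega
  have hcc : ∀ x < N, ∀ y < N, c (ord x) = c (ord y) → col x = col y := by
    intro x hx y hy he
    rw [hc x hx, hc y hy] at he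
    exact hcol x hx y hy (rank_injective (C.col_lt x hx hx) (C.tup_col x hx hx) (C.col_lt y hy hy)
      (C.tup_col y hy hy) he)
  have hcomp : ∀ x < N, ∀ y < N, col x = col y → comp x = comp y := fun x hx y hy he => by
    rw [← C.comp_col x hx hx, ← C.comp_col y hy hy, he]
  have hn : ∀ x < N, 0 < n := fun x hx => (Nat.zero_le _).trans_lt (hT x hx)
  have hsk : ∀ x < N, size (comp x) ≤ k := by
    intro x hx
    rw [← hsize x hx 0 (hn x hx), ← hk', cell]
    exact Finset.card_le_card fun y hy => by
      simp only [Finset.mem_filter] at hy ⊢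
      exact ⟨hy.1, hy.2.2⟩
  -- A group has as many points as its component has colours, and their colours differ; so every
  -- colour of the component occurs in every group of it.
  have hqx : ∀ x < N, ∃ y < N, q (ord x) = ord y ∧ col y = col x ∧ grp y = grp (site (grp x)) := by
    intro x hx
    refine hq x hx ?_
    have hs := G.site_lt x hx
    have hcs := G.comp_site x hx
    have hex : ∃ y ∈ (Finset.range N).filter fun y => grp y = grp (site (grp x)),
        col y - 1 = col x - 1 := by
      refine exists_preimage
        (B := (Finset.range N).filter fun a => comp a = comp x ∧ T (ord a) = 0)
        (f := fun y => col y - 1) (fun y hy => ?_) (fun y hy z hz he => ?_) ?_ ?_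
      · simp only [Finset.mem_filter, Finset.mem_range] at hy ⊢
        refine ⟨C.col_lt y hy.1 hy.1, ?_, C.tup_col y hy.1 hy.1⟩
        rw [C.comp_col y hy.1 hy.1, G.comp_eq y hy.1 _ hs hy.2, hcs]
      · simp only [Finset.mem_filter, Finset.mem_range] at hy hz
        exact C.eq_of_grp y hy.1 z hz.1 (C.col_ne_zero y hy.1 hy.1) (hcol y hy.1 z hz.1 he)
          (hy.2.trans hz.2.symm)
      · rw [G.card _ hs, hcs]
        exact (hsize x hx 0 (hn x hx)).le
      · simp only [Finset.mem_filter, Finset.mem_range]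
        exact ⟨C.col_lt x hx hx, C.comp_col x hx hx, C.tup_col x hx hx⟩
    obtain ⟨y, hy, he⟩ := hex
    simp only [Finset.mem_filter, Finset.mem_range] at hy
    exact ⟨y, hy.1, hcol y hy.1 x hx he, hy.2⟩
  subst hN
  constructor
  · intro x hx
    obtain ⟨i, hi, rfl⟩ := h.exists_ord x hx
    rw [hc i hi]
    exact rank_lt hk' (C.col_lt i hi hi) (C.tup_col i hi hi)
  · intro i hi t ht
    obtain ⟨a, ha, hTa, hra⟩ := exists_rank_eq hk' hi
    -- The same count for a tuple: its points in the component use each colour of the component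
    -- exactly once.
    have hex : ∃ x ∈ (Finset.range (k * n)).filter fun y => comp y = comp a ∧ T (ord y) = t,
        col x - 1 = a := by
      refine exists_preimage
        (B := (Finset.range (k * n)).filter fun b => comp b = comp a ∧ T (ord b) = 0)
        (f := fun y => col y - 1) (fun y hy => ?_) (fun y hy z hz he => ?_) ?_ ?_
      · simp only [Finset.mem_filter, Finset.mem_range] at hy ⊢
        exact ⟨C.col_lt y hy.1 hy.1, (C.comp_col y hy.1 hy.1).trans hy.2.1, C.tup_col y hy.1 hy.1⟩
      · simp only [Finset.mem_filter, Finset.mem_range] at hy hz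
        exact C.eq_of_tup y hy.1 z hz.1 (C.col_ne_zero y hy.1 hy.1) (hcol y hy.1 z hz.1 he)
          (hy.2.2.trans hz.2.2.symm)
      · exact ((hsize a ha 0 (hn a ha)).trans (hsize a ha t ht).symm).le
      · simp [ha, hTa]
    obtain ⟨x, hx, he⟩ := hex
    simp only [Finset.mem_filter, Finset.mem_range] at hx
    refine ⟨ord x, h.ord_lt x hx.1, ?_, hx.2.2⟩
    rw [hc x hx.1, he, hra]
  · intro x hx y hy he ht
    obtain ⟨i, hi, rfl⟩ := h.exists_ord x hx
    obtain ⟨j, hj, rfl⟩ := h.exists_ord y hy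
    rw [C.eq_of_tup i hi j hj (C.col_ne_zero i hi hi) (hcc i hi j hj he) ht]
  · intro x hx
    obtain ⟨i, hi, rfl⟩ := h.exists_ord x hx
    obtain ⟨y, hy, he, -⟩ := hqx i hi
    rw [he]
    exact h.ord_lt y hy
  · intro x hx
    obtain ⟨i, hi, rfl⟩ := h.exists_ord x hx
    obtain ⟨y, hy, he, hcy, -⟩ := hqx i hi
    rw [he, hc y hy, hc i hi, hcy]
  · intro x hx
    obtain ⟨i, hi, rfl⟩ := h.exists_ord x hx
    obtain ⟨y, hy, he, hcy, hgy⟩ := hqx i hi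
    rw [he]
    have hs := G.site_lt i hi
    have h1 := F.triangle i hi _ hs y hy
    have h2 := G.dist_site i hi
    have h3 := G.diam _ hs y hy hgy.symm
    rw [G.comp_site i hi] at h3
    have h4 : (size (comp i) : ℝ) ≤ k := by exact_mod_cast hsk i hi
    have h5 := F.nonneg
    -- `size * l` to the site and `2 * (size - 1) * l` within its group add up to `(3 * size - 2) *
    -- l`, and `size ≤ k`.
    nlinarith
  -- The group number serves as rank, since a group is attached to a later one. Only the group of
  -- the component root is attached to itself, and there each point becomes its own parent.
  · refine ⟨fun x => grp (pos x - 1), fun x hx hne => ?_⟩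
    obtain ⟨i, hi, rfl⟩ := h.exists_ord x hx
    obtain ⟨y, hy, he, hcy, hgy⟩ := hqx i hi
    rw [he] at hne ⊢
    simp only [h.pos_ord i hi, h.pos_ord y hy, Nat.add_sub_cancel]
    rcases G.later i hi with h1 | ⟨h1, -⟩
    · rwa [hgy]
    · refine absurd ?_ hne
      rw [C.eq_of_grp y hy i hi (C.col_ne_zero y hy hy) hcy (hgy.trans h1.symm)]
  · intro x hx y hy he hqx' hqy'
    obtain ⟨i, hi, rfl⟩ := h.exists_ord x hx
    obtain ⟨j, hj, rfl⟩ := h.exists_ord y hy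
    have hroot : ∀ i < k * n, q (ord i) = ord i → grp i = grp (comp i) := by
      intro i hi hq'
      obtain ⟨y, hy, he, -, hgy⟩ := hqx i hi
      have hyi := h.ord_injective hy hi (he.symm.trans hq')
      rw [hyi] at hgy
      rcases G.later i hi with h1 | ⟨-, h1⟩
      · omega
      · exact h1
    have hcij := hcc i hi j hj he
    rw [C.eq_of_grp i hi j hj (C.col_ne_zero i hi hi) hcij]
    rw [hroot i hi hqx', hroot j hj hqy', hcomp i hi j hj hcij]

/-! ### Writing the output -/

namespace Code

variable {D : Comparisons}

/-- Output the solution. -/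
def output : Code :=
  update NUM RANK LA
    (count NUM CA LX skip (.and (.lt (reg LX) (reg LA)) (.eq (reg LX).tup (.lit 0))))
    (.lit 1) (reg CA) ⨾
  loop LQ NUM (
    set 2 (.get ORD (reg LQ)) (.get RANK (.sub (.get COL (reg LQ)) (.lit 1))) ⨾
    find NUM FX LX skip (.and (.eq (.get COL (reg LX)) (.get COL (reg LQ)))
      (.eq (.get GRP (reg LX)) (.get GRP (.get SITE (.get GRP (reg LQ)))))) ⨾
    set 3 (.get ORD (reg LQ)) (.get ORD (reg FX)))

/-- The output is indexed by the original labels; injectivity of `ORD` ensures that entries already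
written are not overwritten. -/
theorem run_output {M : Mem}
    (hinj : ∀ i < M NUM 0, ∀ j < M NUM 0, M ORD i = M ORD j → i = j)
    (hcol : ∀ x < M NUM 0, M COL x - 1 < M NUM 0) :
    ∀ x < M NUM 0,
      output.run D M 2 (M ORD x) = rank (M NUM 0) (fun x => M TUP (M ORD x)) (M COL x - 1) ∧
      ((∃ y < M NUM 0, M COL y = M COL x ∧ M GRP y = M GRP (M SITE (M GRP x))) →
        ∃ y < M NUM 0, output.run D M 3 (M ORD x) = M ORD y ∧ M COL y = M COL x ∧
          M GRP y = M GRP (M SITE (M GRP x))) := by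
  classical
  have h1 : ∀ a < M NUM 0, (update NUM RANK LA
      (count NUM CA LX skip (.and (.lt (reg LX) (reg LA)) (.eq (reg LX).tup (.lit 0))))
      (.lit 1) (reg CA)).run D M RANK a = rank (M NUM 0) (fun x => M TUP (M ORD x)) a := by
    intro a ha
    rw [run_update (by decide) (fun _ => True) (fun a => rank (M NUM 0)
      (fun x => M TUP (M ORD x)) a)]
    · simp [ha]
    · intro i _ M' hM' hv _
      refine ⟨by simp [Exp.holds_lit], fun _ => ?_⟩
      rw [Exp.eval, Exp.eval, run_count (by decide) (fun x => x < i ∧ M TUP (M ORD x) = 0)]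
      · rw [hM' NUM (by decide)]
        rfl
      · intro x _ M'' hM'' hv'
        simp only [run_skip, Exp.holds_and, Exp.holds_lt, Exp.holds_eq, Exp.eval, Exp.tup, hv',
          hM'' LA (by decide), hv, hM'' TUP (by decide), hM'' ORD (by decide),
          hM' TUP (by decide), hM' ORD (by decide)]
  have hM1 := fun a (ha : a ∉ _) => run_frame (D := D) (update NUM RANK LA
    (count NUM CA LX skip (.and (.lt (reg LX) (reg LA)) (.eq (reg LX).tup (.lit 0))))
    (.lit 1) (reg CA)) M (a := a) ha
  rw [output, run_seq]
  set M1 := (update NUM RANK LA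
    (count NUM CA LX skip (.and (.lt (reg LX) (reg LA)) (.eq (reg LX).tup (.lit 0))))
    (.lit 1) (reg CA)).run D M
  rw [← hM1 NUM (by decide), ← hM1 ORD (by decide), ← hM1 TUP (by decide),
    ← hM1 COL (by decide), ← hM1 GRP (by decide), ← hM1 SITE (by decide)] at *
  clear_value M1
  refine loop_induction (D := D) (v := LQ) (r := NUM) (M := M1)
    (fun q M' => ∀ x < q,
      M' 2 (M1 ORD x) = rank (M1 NUM 0) (fun x => M1 TUP (M1 ORD x)) (M1 COL x - 1) ∧
      ((∃ y < M1 NUM 0, M1 COL y = M1 COL x ∧ M1 GRP y = M1 GRP (M1 SITE (M1 GRP x))) →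
        ∃ y < M1 NUM 0, M' 3 (M1 ORD x) = M1 ORD y ∧ M1 COL y = M1 COL x ∧
          M1 GRP y = M1 GRP (M1 SITE (M1 GRP x)))) (fun x hx => by omega) ?_
  intro q hq M' hM' hv h
  simp only [Mem.write_of_ne _ (show 2 ≠ LQ by decide),
    Mem.write_of_ne _ (show 3 ≠ LQ by decide), run_seq]
  have s1 : (set 2 (.get ORD (reg LQ)) (.get RANK (.sub (.get COL (reg LQ)) (.lit 1)))).run D M' 2
      = Function.update (M' 2) (M1 ORD q) (M1 RANK (M1 COL q - 1)) := by
    simp [run_set, Mem.write_self, Exp.eval, hv, hM' ORD (by decide), hM' RANK (by decide),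
      hM' COL (by decide)]
  have hM2 := fun a (ha : a ∉ _) => run_frame (D := D)
    (set 2 (.get ORD (reg LQ)) (.get RANK (.sub (.get COL (reg LQ)) (.lit 1)))) M' (a := a) ha
  set M2 := (set 2 (.get ORD (reg LQ)) (.get RANK (.sub (.get COL (reg LQ)) (.lit 1)))).run D M'
  have s2 := run_find (D := D) (r := NUM) (c := FX) (v := LX) (P := skip)
    (e := .and (.eq (.get COL (reg LX)) (.get COL (reg LQ)))
      (.eq (.get GRP (reg LX)) (.get GRP (.get SITE (.get GRP (reg LQ)))))) (M := M2) (by decide)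
    (fun y => M1 COL y = M1 COL q ∧ M1 GRP y = M1 GRP (M1 SITE (M1 GRP q))) (by
      intro y _ M'' hM'' hv'
      simp only [run_skip, Exp.holds_and, Exp.holds_eq, Exp.eval, hv', hM'' COL (by decide),
        hM'' LQ (by decide), hM'' GRP (by decide), hM'' SITE (by decide), hM2 COL (by decide),
        hM2 LQ (by decide), hM2 GRP (by decide), hM2 SITE (by decide), hM' COL (by decide), hv,
        hM' GRP (by decide), hM' SITE (by decide)])
  have hM3 := fun a (ha : a ∉ _) => run_frame (D := D)
    (find NUM FX LX skip (.and (.eq (.get COL (reg LX)) (.get COL (reg LQ)))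
      (.eq (.get GRP (reg LX)) (.get GRP (.get SITE (.get GRP (reg LQ))))))) M2 (a := a) ha
  set M3 := (find NUM FX LX skip (.and (.eq (.get COL (reg LX)) (.get COL (reg LQ)))
      (.eq (.get GRP (reg LX)) (.get GRP (.get SITE (.get GRP (reg LQ))))))).run D M2
  rw [hM2 NUM (by decide), hM' NUM (by decide)] at s2
  have s3 : (set 3 (.get ORD (reg LQ)) (.get ORD (reg FX))).run D M3 2 = M2 2 := by
    rw [run_frame _ _ (by decide), hM3 2 (by decide)]
  have s4 : (set 3 (.get ORD (reg LQ)) (.get ORD (reg FX))).run D M3 3 =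
      Function.update (M' 3) (M1 ORD q) (M1 ORD (M3 FX 0)) := by
    simp [run_set, Mem.write_self, Exp.eval, hM3 LQ (by decide), hM2 LQ (by decide), hv,
      hM3 ORD (by decide), hM2 ORD (by decide), hM' ORD (by decide), hM3 3 (by decide),
      hM2 3 (by decide)]
  rw [s3, s4, s1]
  intro x hx
  rcases Nat.lt_succ_iff_lt_or_eq.1 hx with hx | rfl
  · have hne : M1 ORD x ≠ M1 ORD q := fun he => by
      have := hinj x (by omega) q hq he
      omega
    rw [Function.update_of_ne hne, Function.update_of_ne hne]
    exact h x hx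
  · rw [Function.update_self, Function.update_self, h1 _ (hcol x hq)]
    refine ⟨rfl, fun hex => ?_⟩
    rcases s2 with ⟨y, hy, hy1, -, hy2⟩ | ⟨hno, -⟩
    · exact ⟨y, hy, by rw [hy2], hy1⟩
    · obtain ⟨y, hy, hy1⟩ := hex
      exact absurd hy1 (hno y hy)

end Code
end KDBST

/-! ### Searching all thresholds, and the main theorem -/

namespace KDBST

open Code (cell)

theorem IsForest.comp_le {N : ℕ} {close : ℕ → ℕ → Prop} {ord pos par comp : ℕ → ℕ}
    (h : IsForest N close ord pos par comp) {i : ℕ} (hi : i < N) : comp i ≤ i := by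
  induction i using Nat.strong_induction_on with
  | _ i ih =>
    have h1 := h.par_le i hi
    rcases h1.lt_or_eq with h2 | h2
    · have := ih _ h2 (by omega)
      rw [h.comp_par i hi] at this
      omega
    · exact (h.comp_root i hi h2).le

/-- A component is the disjoint union of its cells in the `n` tuples, all of the same size; this
gives the divisibility. -/
theorem IsForest.isMetricForest {N n : ℕ} {X : Type*} [MetricSpace X] {p : Fin N → X} {T : ℕ → ℕ}
    {l : ℝ} {ord pos par comp size : ℕ → ℕ} (hl : 0 ≤ l) (hT : ∀ x < N, T x < n)
    (h : IsForest N (fun x y => distN p x y ≤ l) ord pos par comp)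
    (hcell : ∀ r < N, ∀ t < n, cell N comp (fun x => T (ord x)) r t = size r) :
    IsMetricForest N par comp size (fun i j => distN p (ord i) (ord j)) l where
  par_le := h.par_le
  comp_par := h.comp_par
  comp_root := h.comp_root
  size_pos i hi := by
    rw [← hcell (comp i) ((h.comp_le hi).trans_lt hi) _ (hT _ (h.ord_lt i hi))]
    exact Finset.card_pos.2 ⟨i, by simp [hi]⟩
  size_dvd i hi := by
    rw [Finset.card_eq_sum_card_fiberwise (f := fun x => T (ord x)) (t := Finset.range n)
      fun x hx => ?_]
    · refine Finset.dvd_sum fun t ht => dvd_of_eq ?_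
      rw [← hcell (comp i) ((h.comp_le hi).trans_lt hi) t (Finset.mem_range.1 ht), cell,
        Finset.filter_filter]
    · have hx' := Finset.mem_filter.1 (Finset.mem_coe.1 hx)
      exact Finset.mem_coe.2 (Finset.mem_range.2 (hT _ (h.ord_lt x (Finset.mem_range.1 hx'.1))))
  dist_par i hi hp := by
    rw [distN_comm]
    exact h.close_par i hi hp
  dist_comm i j := distN_comm p _ _
  dist_self i := distN_self p _
  triangle i hi j hj m hm := distN_triangle p (h.ord_lt i hi) (h.ord_lt j hj) (h.ord_lt m hm)
  nonneg := hl

theorem IsForest.congr {N : ℕ} {close close' : ℕ → ℕ → Prop} {ord pos par comp : ℕ → ℕ}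
    (h : IsForest N close ord pos par comp)
    (hc : ∀ x < N, ∀ y < N, close x y ↔ close' x y) : IsForest N close' ord pos par comp :=
  { h with
    close_par := fun i hi hp => (hc _ (h.ord_lt _ ((h.par_le i hi).trans_lt hi)) _
      (h.ord_lt i hi)).1 (h.close_par i hi hp)
    comp_eq := fun i hi j hj hd => h.comp_eq i hi j hj
      ((hc _ (h.ord_lt i hi) _ (h.ord_lt j hj)).2 hd) }

namespace Code

/-- Construct a solution for the components of the current threshold, and record it. -/
def construct : Code :=
  groups ⨾ coloring ⨾ output ⨾ assign FOUND (.lit 1) ⨾ assign BU (reg THU) ⨾ assign BV (reg THV)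

/-- Construct a solution for the threshold given by the points `THU` and `THV` if it is balanced
and better than the best threshold so far. -/
def attempt : Code :=
  forest ⨾ check ⨾
  ite (.and (.not (reg BAD))
    (.or (.not (reg FOUND)) (.distLe (reg THU) (reg THV) (reg BU) (reg BV)))) construct skip

/-- Try all thresholds. -/
def main : Code := loop THU NUM (loop THV NUM attempt)

/-- Compute the number of points. -/
def numPoints : Code := loop THU 0 (assign NUM (.add (reg NUM) (.get 0 (.lit 1))))

section

variable {k n : ℕ} {X : Type*} [MetricSpace X] (p : Fin (k * n) → X) (tup : Fin (k * n) → Fin n)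

/-- The memory contains the input. -/
structure HasInput (M : Mem) : Prop where
  num : M NUM 0 = k * n
  tuples : M 0 1 = n
  tup_eq : M TUP = tupN tup

/-- The solution recorded in the memory is as good as its threshold promises. -/
def IsSound (M : Mem) : Prop := M FOUND 0 ≠ 0 → M BU 0 < k * n ∧ M BV 0 < k * n ∧
  IsSolution k n (distN p) (tupN tup) ((3 * (k : ℝ) - 2) * distN p (M BU 0) (M BV 0)) (M 2) (M 3)

/-- A solution has been recorded, and its threshold is at most `l`. -/
def IsAtMost (M : Mem) (l : ℝ) : Prop := M FOUND 0 ≠ 0 ∧ distN p (M BU 0) (M BV 0) ≤ l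

variable {p tup}

theorem run_construct {D : Comparisons} (htup : IsTuplePartition tup) {M : Mem}
    (hin : HasInput tup M) (hu : M THU 0 < k * n) (hv : M THV 0 < k * n)
    (hF : IsForest (k * n) (fun x y => distN p x y ≤ distN p (M THU 0) (M THV 0))
      (M ORD) (M POS) (M PAR) (M COMP))
    (hcell : ∀ r < k * n, ∀ t < n,
      cell (k * n) (M COMP) (fun x => tupN tup (M ORD x)) r t = M SIZE r) :
    IsSound p tup (construct.run D M) ∧
      IsAtMost p (construct.run D M) (distN p (M THU 0) (M THV 0)) := by
  have hT : ∀ x < k * n, tupN tup x < n := fun x hx => tupN_lt tup hx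
  have hn : 0 < n := Nat.pos_of_ne_zero fun h => by simp [h] at hu
  have hMF := hF.isMetricForest (distN_nonneg p _ _) hT hcell
  have hcl : ∀ {x}, x < k * n → M COMP x < k * n := hMF.comp_lt
  have r1 := run_groups (D := D) (M := M) (δ := fun i j => distN p (M ORD i) (M ORD j))
    (l := distN p (M THU 0) (M THV 0))
  have hM1 := fun a (ha : a ∉ _) => run_frame (D := D) groups M (a := a) ha
  rw [construct]
  simp only [run_seq]
  set M1 := groups.run D M
  rw [hin.num] at r1
  have hG := r1 hMF
  have r2 := run_coloring (D := D) (M := M1)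
  have hM2 := fun a (ha : a ∉ _) => run_frame (D := D) coloring M1 (a := a) ha
  set M2 := coloring.run D M1
  rw [hM1 NUM (by decide), hM1 COMP (by decide), hM1 TUP (by decide), hM1 ORD (by decide),
    hin.num, hin.tup_eq] at r2
  have hC := r2 (fun x hx => by
      rw [hG.card x hx, hcell _ (hcl hx) 0 hn]) (fun x hx => by
      rw [hcell _ (hcl hx) _ (hT _ (hF.ord_lt x hx)), hcell _ (hcl hx) 0 hn])
  have r3 := run_output (D := D) (M := M2)
  have hM3 := fun a (ha : a ∉ _) => run_frame (D := D) output M2 (a := a) ha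
  set M3 := output.run D M2
  simp only [hM2 NUM (by decide), hM2 TUP (by decide), hM2 ORD (by decide), hM2 GRP (by decide),
    hM2 SITE (by decide), hM1 NUM (by decide), hM1 TUP (by decide), hM1 ORD (by decide),
    hin.num, hin.tup_eq] at r3
  have r4 := r3 (fun i hi j hj he => hF.ord_injective hi hj he) fun x hx => hC.col_lt x hx hx
  have hS := isSolution_of_coloring rfl hT (card_tuple htup hn) hF hMF
    (fun x hx t ht => hcell _ (hcl hx) t ht) hG hC (c := M3 2) (q := M3 3)
    (fun x hx => (r4 x hx).1) (fun x hx => (r4 x hx).2)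
  have e1 : M3 THU 0 = M THU 0 := by
    rw [hM3 _ (by decide), hM2 _ (by decide), hM1 _ (by decide)]
  have e2 : M3 THV 0 = M THV 0 := by
    rw [hM3 _ (by decide), hM2 _ (by decide), hM1 _ (by decide)]
  simp only [IsSound, IsAtMost, run_set, Mem.write_self, Mem.write_of_ne, Exp.eval, e1, e2, ne_eq,
    Nat.reduceEqDiff, not_false_eq_true, Function.update_self, one_ne_zero,
    forall_const, le_refl, and_self, and_true]
  exact ⟨hu, hv, hS⟩

/-- The recorded threshold never increases. A balanced threshold passes the check, so it is either
recorded or rejected because a smaller one is recorded already. -/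
theorem run_attempt (hk : 1 ≤ k) (htup : IsTuplePartition tup) {M : Mem} (hin : HasInput tup M)
    (hu : M THU 0 < k * n) (hv : M THV 0 < k * n) (hs : IsSound p tup M) :
    IsSound p tup (attempt.run (comparisons p) M) ∧
    (∀ l, IsAtMost p M l → IsAtMost p (attempt.run (comparisons p) M) l) ∧
    (IsBalanced (k * n) n (distN p) (tupN tup) (distN p (M THU 0) (M THV 0)) →
      IsAtMost p (attempt.run (comparisons p) M) (distN p (M THU 0) (M THV 0))) := by
  have r1 := run_forest (D := comparisons p) M
  have hM1 := fun a (ha : a ∉ _) => run_frame (D := comparisons p) forest M (a := a) ha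
  rw [attempt]
  simp only [run_seq]
  set M1 := forest.run (comparisons p) M
  have hcmp : ∀ x < k * n, ∀ y < k * n, comparisons p x y (M THU 0) (M THV 0) ↔
      distN p x y ≤ distN p (M THU 0) (M THV 0) := fun x hx y hy => comparisons_iff p hx hy hu hv
  rw [hin.num] at r1
  have hF := (r1 fun x hx y hy h => by
    rw [hcmp x hx y hy] at h
    rw [hcmp y hy x hx, distN_comm]
    exact h).congr hcmp
  have r2 := run_check (D := comparisons p) M1
  have hM2 := fun a (ha : a ∉ _) => run_frame (D := comparisons p) check M1 (a := a) ha
  set M2 := check.run (comparisons p) M1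
  rw [hM1 NUM (by decide), hM1 TUP (by decide), hM1 0 (by decide), hin.num, hin.tup_eq,
    hin.tuples] at r2
  obtain ⟨hbad, hsize⟩ := r2
  have hf : ∀ a, a = THU ∨ a = THV ∨ a = FOUND ∨ a = BU ∨ a = BV ∨ a = 2 ∨ a = 3 ∨ a = NUM ∨
      a = 0 ∨ a = TUP → M2 a = M a := by
    rintro a (rfl | rfl | rfl | rfl | rfl | rfl | rfl | rfl | rfl | rfl) <;>
      exact (hM2 _ (by decide)).trans (hM1 _ (by decide))
  have hcond : (Exp.and (.not (reg BAD)) (.or (.not (reg FOUND))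
      (.distLe (reg THU) (reg THV) (reg BU) (reg BV)))).Holds (comparisons p) M2 ↔
      M2 BAD 0 = 0 ∧ (M FOUND 0 = 0 ∨
        comparisons p (M THU 0) (M THV 0) (M BU 0) (M BV 0)) := by
    simp only [Exp.holds_and, Exp.holds_not, Exp.holds_or, Exp.holds_get, Exp.holds_distLe,
      Exp.eval, hf THU (by decide), hf THV (by decide), hf FOUND (by decide), hf BU (by decide),
      hf BV (by decide), ne_eq, not_not]
  -- Comparisons are meaningful only for numbers of points; for `BU` and `BV` this is part of the
  -- soundness of a recorded solution.
  have hfound : M FOUND 0 ≠ 0 → (comparisons p (M THU 0) (M THV 0) (M BU 0) (M BV 0) ↔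
      distN p (M THU 0) (M THV 0) ≤ distN p (M BU 0) (M BV 0)) := fun h =>
    comparisons_iff p hu hv (hs h).1 (hs h).2.1
  have hnk : n ≤ k * n := Nat.le_mul_of_pos_left n hk
  have hbal : IsBalanced (k * n) n (distN p) (tupN tup) (distN p (M THU 0) (M THV 0)) →
      M2 BAD 0 = 0 := fun hb => hbad.2 fun r _ t _ ht => hF.cell_eq hb r ht (by omega)
  rw [run_ite]
  by_cases hc : (Exp.and (.not (reg BAD)) (.or (.not (reg FOUND))
      (.distLe (reg THU) (reg THV) (reg BU) (reg BV)))).Holds (comparisons p) M2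
  · rw [if_pos hc]
    obtain ⟨hc1, hc2⟩ := hcond.1 hc
    have r3 := run_construct (D := comparisons p) (p := p) htup (M := M2)
    rw [hf THU (by decide), hf THV (by decide), hM2 ORD (by decide), hM2 POS (by decide),
      hM2 PAR (by decide), hM2 COMP (by decide)] at r3
    obtain ⟨h1, h2⟩ := r3 ⟨by rw [hf NUM (by decide), hin.num],
      by rw [hf 0 (by decide), hin.tuples], by rw [hf TUP (by decide), hin.tup_eq]⟩ hu hv hF
      fun r hr t ht => by rw [hsize r hr, hbad.1 hc1 r hr t (by omega) ht]
    refine ⟨h1, fun l hl => ⟨h2.1, h2.2.trans ?_⟩, fun _ => h2⟩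
    rcases hc2 with hc2 | hc2
    · exact absurd hc2 hl.1
    · exact ((hfound hl.1).1 hc2).trans hl.2
  · rw [if_neg hc, run_skip]
    have hsame : ∀ l, IsAtMost p M2 l ↔ IsAtMost p M l := fun l => by
      simp only [IsAtMost, hf FOUND (by decide), hf BU (by decide), hf BV (by decide)]
    refine ⟨?_, fun l => (hsame l).2, fun hb => (hsame _).2 ?_⟩
    · simp only [IsSound, hf FOUND (by decide), hf BU (by decide), hf BV (by decide),
        hf 2 (by decide), hf 3 (by decide)]
      exact hs
    · have hn := fun h => hc (hcond.2 ⟨hbal hb, h⟩)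
      have h0 : M FOUND 0 ≠ 0 := fun h => hn (Or.inl h)
      exact ⟨h0, (not_le.1 fun h => hn (Or.inr ((hfound h0).2 h))).le⟩

theorem IsSound.congr {M M' : Mem} (h : IsSound p tup M)
    (he : ∀ a, a = FOUND ∨ a = BU ∨ a = BV ∨ a = 2 ∨ a = 3 → M' a = M a) : IsSound p tup M' := by
  simp only [IsSound, he FOUND (by decide), he BU (by decide), he BV (by decide),
    he 2 (by decide), he 3 (by decide)]
  exact h

theorem IsAtMost.congr {M M' : Mem} {l : ℝ} (h : IsAtMost p M l)
    (he : ∀ a, a = FOUND ∨ a = BU ∨ a = BV → M' a = M a) : IsAtMost p M' l := by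
  simp only [IsAtMost, he FOUND (by decide), he BU (by decide), he BV (by decide)]
  exact h

theorem run_main (hk : 1 ≤ k) (htup : IsTuplePartition tup) {M : Mem} (hin : HasInput tup M)
    (hs : IsSound p tup M) :
    IsSound p tup (main.run (comparisons p) M) ∧
    ∀ u < k * n, ∀ v < k * n, IsBalanced (k * n) n (distN p) (tupN tup) (distN p u v) →
      IsAtMost p (main.run (comparisons p) M) (distN p u v) := by
  have key := loop_induction (D := comparisons p) (v := THU) (r := NUM) (M := M)
    (P := loop THV NUM attempt) (fun i M' => IsSound p tup M' ∧ ∀ u < i, ∀ v < k * n,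
      IsBalanced (k * n) n (distN p) (tupN tup) (distN p u v) → IsAtMost p M' (distN p u v)) ?_ ?_
  · rwa [hin.num] at key
  · refine ⟨hs.congr ?_, fun u hu => by omega⟩
    rintro a (rfl | rfl | rfl | rfl | rfl) <;> exact Mem.write_of_ne _ (by decide) _ _
  · rintro u hu M1 hM1 hu1 ⟨h1, h2⟩
    rw [hin.num] at hu
    have key := loop_induction (D := comparisons p) (v := THV) (r := NUM) (M := M1)
      (P := attempt) (fun j M' => IsSound p tup M' ∧
        (∀ l, IsAtMost p M1 l → IsAtMost p M' l) ∧ ∀ v < j,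
        IsBalanced (k * n) n (distN p) (tupN tup) (distN p u v) →
          IsAtMost p M' (distN p u v)) ?_ ?_
    · rw [hM1 NUM (by decide), hin.num] at key
      obtain ⟨k1, k2, k3⟩ := key
      refine ⟨k1.congr ?_, fun w hw v hv hb => ?_⟩
      · rintro a (rfl | rfl | rfl | rfl | rfl) <;> exact Mem.write_of_ne _ (by decide) _ _
      · refine IsAtMost.congr (M := (loop THV NUM attempt).run (comparisons p) M1) ?_ ?_
        · rcases Nat.lt_succ_iff_lt_or_eq.1 hw with hw | rfl
          · exact k2 _ (h2 w hw v hv hb)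
          · exact k3 v hv hb
        · rintro a (rfl | rfl | rfl) <;> exact Mem.write_of_ne _ (by decide) _ _
    · refine ⟨h1.congr ?_, fun l hl => hl.congr ?_, fun v hv => by omega⟩
      · rintro a (rfl | rfl | rfl | rfl | rfl) <;> exact Mem.write_of_ne _ (by decide) _ _
      · rintro a (rfl | rfl | rfl) <;> exact Mem.write_of_ne _ (by decide) _ _
    · rintro v hv M2 hM2 hv2 ⟨k1, k2, k3⟩
      rw [hM1 NUM (by decide), hin.num] at hv
      have hu2 : M2 THU 0 = u := by rw [hM2 _ (by decide), hu1]
      have ha := run_attempt hk htup (p := p) (M := M2)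
        ⟨by rw [hM2 _ (by decide), hM1 _ (by decide), hin.num],
          by rw [hM2 _ (by decide), hM1 _ (by decide), hin.tuples],
          by rw [hM2 _ (by decide), hM1 _ (by decide), hin.tup_eq]⟩ (by rwa [hu2]) (by rwa [hv2]) k1
      rw [hu2, hv2] at ha
      obtain ⟨a1, a2, a3⟩ := ha
      have he : ∀ a, a = FOUND ∨ a = BU ∨ a = BV →
          ((attempt.run (comparisons p) M2).write THV 0 (v + 1)) a =
            attempt.run (comparisons p) M2 a := by
        rintro a (rfl | rfl | rfl) <;> exact Mem.write_of_ne _ (by decide) _ _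
      refine ⟨a1.congr ?_, fun l hl => (a2 l (k2 l hl)).congr he, fun w hw hb => ?_⟩
      · rintro a (rfl | rfl | rfl | rfl | rfl) <;> exact Mem.write_of_ne _ (by decide) _ _
      · refine IsAtMost.congr ?_ he
        rcases Nat.lt_succ_iff_lt_or_eq.1 hw with hw | rfl
        · exact a2 _ (k3 w hw hb)
        · exact a3 hb

/-- The machine cannot multiply, so `k * n` is computed by adding `n` in a loop of `k` rounds. -/
theorem run_numPoints (D : Comparisons) :
    HasInput tup (numPoints.run D (inputMem tup)) ∧
      numPoints.run D (inputMem tup) FOUND 0 = 0 := by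
  have hf := fun a (ha : a ∉ _) => run_frame (D := D) numPoints (inputMem tup) (a := a) ha
  refine ⟨⟨?_, ?_, ?_⟩, ?_⟩
  · have hk : inputMem tup 0 0 = k := by simp [inputMem]
    have := loop_induction (D := D) (v := THU) (r := 0) (M := inputMem tup)
      (P := assign NUM (.add (reg NUM) (.get 0 (.lit 1)))) (fun i M' => M' NUM 0 = i * n) ?_ ?_
    · rwa [hk] at this
    · rw [Mem.write_of_ne _ (by decide)]
      simp [inputMem]
    · intro i _ M' hM' _ h
      rw [Mem.write_of_ne _ (by decide)]
      simp [run_set, Mem.write_self, Exp.eval, h, hM' 0 (by decide), inputMem]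
      ring
  · rw [hf 0 (by decide)]
    simp [inputMem]
  · rw [hf TUP (by decide)]
    rfl
  · rw [hf FOUND (by decide)]
    simp [inputMem]

end

end Code
end KDBST

theorem theorem3 :
    ∃ (P : KDBST.Prog) (B : Polynomial ℕ),
      ∀ (k n : ℕ), 1 ≤ k → 1 ≤ n →
      ∀ (X : Type*) [MetricSpace X] (p : Fin (k * n) → X) (tup : Fin (k * n) → Fin n),
        KDBST.IsTuplePartition tup →
        ∃ (M : KDBST.Mem) (t : ℕ),
          KDBST.Exec (KDBST.comparisons p) P (KDBST.inputMem tup) M t ∧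
          t ≤ B.eval (k * n) ∧
          KDBST.IsFeasible tup (KDBST.outputFamily k n M) ∧
          ∀ S : KDBST.Family k n, KDBST.IsFeasible tup S →
            KDBST.bottleneck p (KDBST.outputFamily k n M) ≤
              (3 * (k : ℝ) - 2) * KDBST.bottleneck p S := by
  refine ⟨.seq KDBST.Code.numPoints.prog KDBST.Code.main.prog,
    KDBST.Code.numPoints.cost + KDBST.Code.main.cost, ?_⟩
  intro k n hk hn X _ p tup htup
  have hN : 0 < k * n := Nat.mul_pos hk hn
  obtain ⟨hin, hfound⟩ := KDBST.Code.run_numPoints (tup := tup) (KDBST.comparisons p)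
  -- Register `0` holds `k ≤ k * n` and bounds the loop of this first program, whereas the loops of
  -- the main program are bounded by `NUM`.
  obtain ⟨s, hs, hexec⟩ := KDBST.Code.exists_exec (D := KDBST.comparisons p) (r := 0) (B := k * n)
    KDBST.Code.numPoints (by decide) (KDBST.inputMem tup)
    (by simpa [KDBST.inputMem] using Nat.le_mul_of_pos_right k hn)
  obtain ⟨t, ht, hexec'⟩ := KDBST.Code.exists_exec (D := KDBST.comparisons p) (r := NUM)
    (B := k * n) KDBST.Code.main (by decide) _ hin.num.le
  obtain ⟨hsound, hbest⟩ := KDBST.Code.run_main (p := p) hk htup hin fun h => absurd hfound h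
  refine ⟨_, _, hexec.seq hexec', by rw [Polynomial.eval_add]; exact add_le_add hs ht, ?_⟩
  -- The largest distance is a balanced threshold, so a solution has been recorded at the end.
  have hmax : ∃ u < k * n, ∃ v < k * n, ∀ x < k * n, ∀ y < k * n,
      KDBST.distN p x y ≤ KDBST.distN p u v := by
    obtain ⟨⟨u, v⟩, huv, hmax⟩ := Finset.exists_max_image
      (Finset.range (k * n) ×ˢ Finset.range (k * n)) (fun z => KDBST.distN p z.1 z.2)
      ⟨(0, 0), by simp [hN]⟩
    simp only [Finset.mem_product, Finset.mem_range] at huv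
    exact ⟨u, huv.1, v, huv.2, fun x hx y hy => hmax (x, y) (by simp [hx, hy])⟩
  obtain ⟨u, hu, v, hv, hmax⟩ := hmax
  obtain ⟨hf, -⟩ := hbest u hu v hv (KDBST.isBalanced_of_forall_dist_le htup hmax)
  obtain ⟨-, -, hsol⟩ := hsound hf
  have hk' : (1 : ℝ) ≤ k := by exact_mod_cast hk
  refine ⟨hsol.isFeasible hn, fun S hS => ?_⟩
  -- The bottleneck of `S` is one of the thresholds tried and is balanced, so the recorded threshold
  -- does not exceed it.
  obtain ⟨u, hu, v, hv, huv⟩ := KDBST.exists_eq_bottleneck hN p S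
  obtain ⟨-, hle⟩ := hbest u hu v hv (huv ▸ hS.isBalanced htup)
  refine (hsol.bottleneck_le ?_).trans ?_
  · exact mul_nonneg (by linarith) (KDBST.distN_nonneg p _ _)
  · rw [← huv]
    exact mul_le_mul_of_nonneg_left hle (by linarith)
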